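/- Let $X$ be a complex manifold and let $(E,\theta)$ be a Higgs bundle over $X$: $E$ is a holomorphic vector bundle of finite rank with Dolbeault operator $\bar\partial_E$, and $\theta\in\mathcal A^{1,0}(X;\operatorname{End}E)$ is a smooth form with $[\bar\partial_E,\theta]=0$ and $\theta\wedge\theta=0$. A connection $\nabla$ on $E$ (smooth, complex linear) is called compatible if its $(0,1)$-part is $\bar\partial_E$; write $(\nabla^2)_{(1,1)}\in\mathcal A^{1,1}(X;\operatorname{End}E)$ for the $(1,1)$-part of its curvature. For $k\ge 0$ put $$\operatorname{ah}_k(E,\theta,\nabla)=\frac1{k!}\Big(\frac{i}{2\pi}\Big)^k\operatorname{tr}\Big(\big((\nabla^2)_{(1,1)}\big)^k\wedge\theta\Big)\in\mathcal A^{k+1,k}(X).$$ The characteristic class $\operatorname{ah}_k(E,\theta)=\frac1{k!}\big(\frac{i}{2\pi}\big)^k\operatorname{tr}(\operatorname{At}(E)^k\theta)\in H^{k+1,k}(X)$ in Dolbeault cohomology is the class of the $\bar\partial$-closed form $\operatorname{ah}_k(E,\theta,\nabla)$ for any compatible $\nabla$ (the Atiyah class $\operatorname{At}(E)\in H^{1,1}(X;\operatorname{End}E)$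 being represented by $(\nabla^2)_{(1,1)}$). For connections $\nabla_0,\nabla_1$ on $E$, consider on the pull-back of $E$ to $X\times[0,1]$ the connection $\widetilde\nabla=\nabla_0+t(\nabla_1-\nabla_0)+dt\otimes\frac{\partial}{\partial t}$ and define the transgression form of the $(k+1)$-st scalar Atiyah class by $$\operatorname{at}_{k+1}(E,\nabla_0,\nabla_1)=\left(\frac{1}{(k+1)!}\Big(\frac{i}{2\pi}\Big)^{k+1}\int_0^1\operatorname{tr}\big((\widetilde\nabla^2)^{k+1}\big)\right)_{(k+1,k)}\in\mathcal A^{k+1,k}(X),$$ where the subscript denotes the part of bidegree $(k+1,k)$ and $\int_0^1$ is integration over the fibre of $X\times[0,1]\to X$ with $dt$ written last, i.e. $\int_0^1\alpha_t\wedge dt=\int_0^1\alpha_t\,dt$ and $\int_0^1\beta_t=0$ for forms $\alpha_t,\beta_t$ not involving $dt$. Then for every compatible connection $\nabla$ on $E$ and every $k\ge0$ $$\operatorname{ah}_k(E,\theta,\nabla)=2\pi i\,\operatorname{at}_{k+1}(E,\nabla,\nabla+\theta)$$ as differential forms on $X$. In particular $2\pi i\operatorname{at}_{k+1}(E,\nabla,\nabla+\theta)$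 is $\bar\partial$-closed of type $(k+1,k)$ and represents $\operatorname{ah}_k(E,\theta)$ in $H^{k+1,k}(X)$, i.e. it has the same Dolbeault class as $\operatorname{ah}_k(E,\theta,\nabla')$ for every compatible connection $\nabla'$. -/

import Mathlib

open Bundle Manifold
open scoped ContDiff Topology

noncomputable section

namespace Higgs

/-! ### Multilinear algebra of forms at a point

`T` is a (complex) tangent space regarded as a real vector space, and an `n`-form at the point is
a real alternating map on `T` with values in a complex vector space or algebra. -/

section Pointwise

/-- The wedge product of two alternating forms with values in an algebra `A`:
`(α ∧ β)(v₁, …, v_{m+n}) = ∑ sgn(σ) α(v_{σ 1}, …, v_{σ m}) * β(v_{σ (m+1)}, …, v_{σ (m+n)})`,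
the sum being over the `(m, n)`-shuffles. -/
def wedge {T A : Type*} [AddCommGroup T] [Module ℝ T] [Ring A] [Algebra ℝ A] {m n : ℕ}
    (α : T [⋀^Fin m]→ₗ[ℝ] A) (β : T [⋀^Fin n]→ₗ[ℝ] A) : T [⋀^Fin (m + n)]→ₗ[ℝ] A :=
  ((LinearMap.mul' ℝ A).compAlternatingMap (α.domCoprod β)).domDomCongr finSumFinEquiv

/-- The `k`-th wedge power of an algebra valued 2-form. -/
def wedgePow {T A : Type*} [AddCommGroup T] [Module ℝ T] [Ring A] [Algebra ℝ A]
    (α : T [⋀^Fin 2]→ₗ[ℝ] A) : (k : ℕ) → T [⋀^Fin (2 * k)]→ₗ[ℝ] A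
  | 0 => AlternatingMap.constOfIsEmpty ℝ T (Fin 0) (1 : A)
  | k + 1 => wedge (wedgePow α k) α

/-- The trace of an endomorphism valued form. -/
def trForm {T W : Type*} [AddCommGroup T] [Module ℝ T] [AddCommGroup W] [Module ℂ W] {n : ℕ}
    (α : T [⋀^Fin n]→ₗ[ℝ] Module.End ℂ W) : T [⋀^Fin n]→ₗ[ℝ] ℂ :=
  ((LinearMap.trace ℂ W).restrictScalars ℝ).compAlternatingMap α

/-- A form `η` on a complex vector space is of type `(p, q)`:
`η(c v₁, …, c vₙ) = c^p c̄^q η(v₁, …, vₙ)` for every complex number `c`. -/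
def IsOfType {T W : Type*} [AddCommGroup T] [Module ℂ T] [AddCommGroup W] [Module ℂ W] {n : ℕ}
    (p q : ℕ) (η : T [⋀^Fin n]→ₗ[ℝ] W) : Prop :=
  ∀ (c : ℂ) (v : Fin n → T),
    η (fun i => c • v i) = (c ^ p * (starRingEnd ℂ c) ^ q) • η v

/-- The pull-back of a form under multiplication by the complex number `c`. -/
def scaleForm {T W : Type*} [AddCommGroup T] [Module ℂ T] [AddCommGroup W] [Module ℂ W] {n : ℕ}
    (c : ℂ) (η : T [⋀^Fin n]→ₗ[ℝ] W) : T [⋀^Fin n]→ₗ[ℝ] W :=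
  η.compLinearMap ((LinearMap.lsmul ℂ T c).restrictScalars ℝ)

/-- The `(p, q)`-part of an `n`-form, `n = p + q`. Forms of type `(p', q')` are those of weight
`p' - q'` under multiplication of all arguments by unit complex numbers, so the part of type
`(p, q)` is obtained by averaging against the character of weight `p - q`; since the weights that
occur are `-n, -n + 2, …, n`, it is enough to average over `exp(π i j / (n + 1))`, `0 ≤ j ≤ n`. -/
def typePart {T W : Type*} [AddCommGroup T] [Module ℂ T] [AddCommGroup W] [Module ℂ W] {n : ℕ}
    (p q : ℕ) (η : T [⋀^Fin n]→ₗ[ℝ] W) : T [⋀^Fin n]→ₗ[ℝ] W :=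
  ((n : ℂ) + 1)⁻¹ • ∑ j ∈ Finset.range (n + 1),
    Complex.exp (-(Real.pi * Complex.I * j * ((p : ℂ) - q) / (n + 1))) •
      scaleForm (Complex.exp (Real.pi * Complex.I * j / (n + 1))) η

/-- `typePart p q` is the identity on forms of type `(p, q)` and kills forms of the other types. -/
theorem typePart_of_isOfType {T W : Type*} [AddCommGroup T] [Module ℂ T] [AddCommGroup W]
    [Module ℂ W] {n p q p' q' : ℕ} (h : p + q = n) (h' : p' + q' = n) {η : T [⋀^Fin n]→ₗ[ℝ] W}
    (hη : IsOfType p' q' η) : typePart p q η = if p = p' then η else 0 := by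
  have key : ∀ j : ℕ, Complex.exp (-(Real.pi * Complex.I * j * ((p : ℂ) - q) / (n + 1))) •
      scaleForm (Complex.exp (Real.pi * Complex.I * j / (n + 1))) η =
      (Complex.exp (2 * Real.pi * Complex.I * (((p' : ℤ) - p : ℤ) / ((n + 1 : ℕ) : ℂ)))) ^ j • η := by
    intro j
    ext v
    have := hη (Complex.exp (Real.pi * Complex.I * j / (n + 1))) v
    simp only [scaleForm, AlternatingMap.smul_apply, AlternatingMap.compLinearMap_apply]
    erw [this]
    rw [smul_smul]
    congr 1
    rw [← Complex.exp_conj, ← Complex.exp_nat_mul, ← Complex.exp_nat_mul, ← Complex.exp_nat_mul,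
      ← Complex.exp_add, ← Complex.exp_add]
    congr 1
    have hn : (n : ℂ) + 1 ≠ 0 := by exact_mod_cast n.succ_ne_zero
    have e1 : (q : ℂ) = n - p := by rw [← h]; push_cast; ring
    have e2 : (q' : ℂ) = n - p' := by rw [← h']; push_cast; ring
    simp only [map_div₀, map_mul, Complex.conj_ofReal, Complex.conj_I, map_natCast,
      map_add, map_one]
    push_cast
    field_simp
    rw [e1, e2]; ring
  rw [typePart]
  simp only [key, ← Finset.sum_smul]
  have hn : (n : ℂ) + 1 ≠ 0 := by exact_mod_cast n.succ_ne_zero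
  split_ifs with hp
  · subst hp; simp [smul_smul, hn]
  · set z := Complex.exp (2 * Real.pi * Complex.I * (((p' : ℤ) - p : ℤ) / ((n + 1 : ℕ) : ℂ))) with hz
    have hz1 : z ≠ 1 := by
      intro h1
      rw [hz, Complex.exp_eq_one_iff] at h1
      obtain ⟨m, hm⟩ := h1
      have hpi : (2 * Real.pi * Complex.I : ℂ) ≠ 0 := Complex.two_pi_I_ne_zero
      rw [mul_comm (m : ℂ)] at hm
      have hm := mul_left_cancel₀ hpi hm
      rw [div_eq_iff (by exact_mod_cast n.succ_ne_zero)] at hm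
      have hm' : (p' : ℤ) - p = m * (n + 1 : ℕ) := by exact_mod_cast hm
      have hlt : |(p' : ℤ) - p| < (n + 1 : ℕ) := by rw [abs_lt]; omega
      have := Int.eq_zero_of_abs_lt_dvd ⟨m, by rw [hm']; ring⟩ hlt
      omega
    have hzn : z ^ (n + 1) = 1 := by
      rw [hz, ← Complex.exp_nat_mul, Complex.exp_eq_one_iff]
      refine ⟨(p' : ℤ) - p, ?_⟩
      push_cast; field_simp
    have := geom_sum_eq hz1 (n + 1)
    rw [this, hzn]; simp

/-- A form is the sum of its parts. -/
theorem sum_typePart {T W : Type*} [AddCommGroup T] [Module ℂ T] [AddCommGroup W]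
    [Module ℂ W] {n : ℕ} (η : T [⋀^Fin n]→ₗ[ℝ] W) :
    ∑ p ∈ Finset.range (n + 1), typePart p (n - p) η = η := by
  have hn : (n : ℂ) + 1 ≠ 0 := by exact_mod_cast n.succ_ne_zero
  simp only [typePart]
  rw [← Finset.smul_sum, Finset.sum_comm]
  simp only [← Finset.sum_smul]
  rw [Finset.sum_eq_single 0]
  · have : scaleForm (1:ℂ) η = η := by ext v; simp [scaleForm]
    simp [this, smul_smul, hn]
  · intro j hj hj0
    convert zero_smul ℂ _
    have : ∀ p ∈ Finset.range (n + 1),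
        Complex.exp (-(Real.pi * Complex.I * j * ((p : ℂ) - (n - p : ℕ)) / (n + 1))) =
          Complex.exp (Real.pi * Complex.I * j * n / (n + 1)) *
            (Complex.exp (2 * Real.pi * Complex.I *
              ((-(j : ℤ) : ℤ) / ((n + 1 : ℕ) : ℂ)))) ^ p := by
      intro p hp
      rw [← Complex.exp_nat_mul, ← Complex.exp_add]
      congr 1
      rw [Nat.cast_sub (by simp at hp; omega)]
      push_cast; field_simp; ring
    rw [Finset.sum_congr rfl this, ← Finset.mul_sum]
    set z := Complex.exp (2 * Real.pi * Complex.I * ((-(j:ℤ) : ℤ) / ((n + 1 : ℕ) : ℂ))) with hz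
    have hz1 : z ≠ 1 := by
      intro h1
      rw [hz, Complex.exp_eq_one_iff] at h1
      obtain ⟨m, hm⟩ := h1
      have hpi : (2 * Real.pi * Complex.I : ℂ) ≠ 0 := Complex.two_pi_I_ne_zero
      rw [mul_comm (m : ℂ)] at hm
      have hm := mul_left_cancel₀ hpi hm
      rw [div_eq_iff (by exact_mod_cast n.succ_ne_zero)] at hm
      have hm' : (-j : ℤ) = m * (n + 1 : ℕ) := by exact_mod_cast hm
      simp at hj
      have hlt : |(-j : ℤ)| < (n + 1 : ℕ) := by rw [abs_lt]; omega
      have := Int.eq_zero_of_abs_lt_dvd ⟨m, by rw [hm']; ring⟩ hlt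
      omega
    have hzn : z ^ (n + 1) = 1 := by
      rw [hz, ← Complex.exp_nat_mul, Complex.exp_eq_one_iff]
      refine ⟨-(j : ℤ), ?_⟩
      push_cast; field_simp
    rw [geom_sum_eq hz1 (n + 1), hzn]; simp
  · simp

/-- Multilinear maps on a finite-dimensional space are continuous. -/
theorem continuous_multilinear {T W : Type*} [NormedAddCommGroup T] [NormedSpace ℝ T]
    [FiniteDimensional ℝ T] [NormedAddCommGroup W] [NormedSpace ℝ W] {n : ℕ}
    (f : MultilinearMap ℝ (fun _ : Fin n => T) W) : Continuous f := by
  classical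
  let b := Module.finBasis ℝ T
  have h : ∀ v : Fin n → T, f v = ∑ r : Fin n → Fin (Module.finrank ℝ T),
      (∏ i, b.repr (v i) (r i)) • f (fun i => b (r i)) := by
    intro v
    conv_lhs => rw [show v = fun i => ∑ j, b.repr (v i) j • b j from
      funext fun i => (b.sum_repr (v i)).symm]
    rw [f.map_sum]
    simp only [f.map_smul_univ]
  rw [show (f : (Fin n → T) → W) = _ from funext h]
  have hc (j) : Continuous fun t : T => b.repr t j :=
    (b.coord j).continuous_of_finiteDimensional
  fun_prop

/-- A form on a finite-dimensional space as a continuous alternating map. -/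
def toCont {T W : Type*} [NormedAddCommGroup T] [NormedSpace ℝ T] [FiniteDimensional ℝ T]
    [NormedAddCommGroup W] [NormedSpace ℝ W] {n : ℕ} (η : T [⋀^Fin n]→ₗ[ℝ] W) :
    T [⋀^Fin n]→L[ℝ] W :=
  { η with cont := continuous_multilinear η.toMultilinearMap }

end Pointwise

/-! ### Scalar forms and Dolbeault cohomology of a complex manifold

`X` is a manifold modelled on the complex vector space `V`. As usual in Mathlib, the tangent space
at `x` is the model space `V`, identified through the preferred chart at `x`. -/

section Dolbeault

/-- Complex valued `n`-forms on `X` (not necessarily smooth). -/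
abbrev Form (V : Type*) [NormedAddCommGroup V] [NormedSpace ℂ V] (X : Type*) (n : ℕ) : Type _ :=
  X → V [⋀^Fin n]→ₗ[ℝ] ℂ

variable {V : Type*} [NormedAddCommGroup V] [NormedSpace ℂ V] [FiniteDimensional ℂ V]
  {X : Type*} [TopologicalSpace X] [ChartedSpace V X]

/-- The real differential, at the point `z` of the model space, of the inverse of the preferred
chart at `x`. -/
def chartSymmDeriv (x : X) (z : V) : V →L[ℝ] V :=
  mfderiv 𝓘(ℝ, V) 𝓘(ℝ, V) (extChartAt 𝓘(ℝ, V) x).symm z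

/-- The expression of a form in the preferred chart at `x`. -/
def Form.inChart {n : ℕ} (η : Form V X n) (x : X) (z : V) : V [⋀^Fin n]→L[ℝ] ℂ :=
  toCont ((η ((extChartAt 𝓘(ℝ, V) x).symm z)).compLinearMap (chartSymmDeriv x z).toLinearMap)

/-- Smooth forms. -/
def Form.IsSmooth {n : ℕ} (η : Form V X n) : Prop :=
  ∀ x, ContDiffAt ℝ ∞ (η.inChart x) (extChartAt 𝓘(ℝ, V) x x)

/-- The exterior derivative of a form, computed at each point in the preferred chart. -/
def Form.extDeriv {n : ℕ} (η : Form V X n) : Form V X (n + 1) := fun x =>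
  (_root_.extDeriv (η.inChart x) (extChartAt 𝓘(ℝ, V) x x)).toAlternatingMap

/-- `∂̄` on forms of type `(p, q)`: the `(p, q + 1)`-part of the exterior derivative. -/
def dbar (p q : ℕ) (η : Form V X (p + q)) : Form V X (p + q + 1) := fun x =>
  typePart p (q + 1) (η.extDeriv x)

theorem Form.inChart_add {n : ℕ} (η η' : Form V X n) (x : X) :
    (η + η').inChart x = η.inChart x + η'.inChart x := rfl

theorem Form.inChart_smul {n : ℕ} (c : ℂ) (η : Form V X n) (x : X) :
    (c • η).inChart x = c • η.inChart x := rfl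

variable (V X) in
/-- The space `𝒜^{p,q}(X)` of smooth forms of type `(p, q)`. -/
def smoothForms (p q : ℕ) : Submodule ℂ (Form V X (p + q)) where
  carrier := {η | η.IsSmooth ∧ ∀ x, IsOfType p q (η x)}
  add_mem' := by
    rintro a b ⟨ha, ha'⟩ ⟨hb, hb'⟩
    refine ⟨fun x => ?_, fun x c v => ?_⟩
    · rw [Form.inChart_add]; exact (ha x).add (hb x)
    · simp [ha' x c v, hb' x c v, mul_add]
  zero_mem' := by
    refine ⟨fun x => ?_, fun x c v => by simp⟩
    exact (contDiff_const (c := (0 : V [⋀^Fin (p + q)]→L[ℝ] ℂ))).contDiffAt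
  smul_mem' := by
    rintro r a ⟨ha, ha'⟩
    refine ⟨fun x => ?_, fun x c v => ?_⟩
    · rw [Form.inChart_smul]; exact (ha x).const_smul r
    · simp [ha' x c v, mul_left_comm]

theorem typePart_add {T W : Type*} [AddCommGroup T] [Module ℂ T] [AddCommGroup W] [Module ℂ W]
    {n : ℕ} (p q : ℕ) (a b : T [⋀^Fin n]→ₗ[ℝ] W) :
    typePart p q (a + b) = typePart p q a + typePart p q b := by
  ext v
  simp [typePart, scaleForm, Finset.sum_add_distrib]

theorem typePart_smul {T W : Type*} [AddCommGroup T] [Module ℂ T] [AddCommGroup W] [Module ℂ W]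
    {n : ℕ} (p q : ℕ) (c : ℂ) (a : T [⋀^Fin n]→ₗ[ℝ] W) :
    typePart p q (c • a) = c • typePart p q a := by
  have h (r : ℂ) : scaleForm r (c • a) = c • scaleForm r a := rfl
  simp only [typePart, h, smul_comm _ c, ← Finset.smul_sum]

theorem dbar_add {p q : ℕ} {a b : Form V X (p + q)} (ha : a.IsSmooth) (hb : b.IsSmooth) :
    dbar p q (a + b) = dbar p q a + dbar p q b := by
  funext x
  have h : (a + b).extDeriv x = a.extDeriv x + b.extDeriv x := by
    unfold Form.extDeriv
    rw [Form.inChart_add, extDeriv_add ((ha x).differentiableAt (by simp))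
      ((hb x).differentiableAt (by simp))]
    rfl
  simp only [dbar, Pi.add_apply, h, typePart_add]

theorem dbar_smul {p q : ℕ} {a : Form V X (p + q)} (c : ℂ) (ha : a.IsSmooth) :
    dbar p q (c • a) = c • dbar p q a := by
  funext x
  have h : (c • a).extDeriv x = c • a.extDeriv x := by
    have hf := fderiv_const_smul ((ha x).differentiableAt (by simp)) c
    ext v
    unfold Form.extDeriv
    rw [Form.inChart_smul, _root_.extDeriv, hf]
    simp [_root_.extDeriv, ContinuousAlternatingMap.alternatizeUncurryFin_apply, Finset.mul_sum]
  simp only [dbar, Pi.smul_apply, h, typePart_smul]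

variable (V X) in
/-- The `∂̄`-closed forms in `𝒜^{p,q}(X)`. -/
def closedForms (p q : ℕ) : Submodule ℂ (Form V X (p + q)) where
  carrier := {η | η ∈ smoothForms V X p q ∧ dbar p q η = 0}
  add_mem' := by
    rintro a b ⟨ha, ha'⟩ ⟨hb, hb'⟩
    exact ⟨add_mem ha hb, by rw [dbar_add ha.1 hb.1, ha', hb', add_zero]⟩
  zero_mem' := ⟨zero_mem _, by
    have h := dbar_smul (0 : ℂ) (zero_mem (smoothForms V X p q)).1
    simpa using h⟩
  smul_mem' := by
    rintro c a ⟨ha, ha'⟩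
    exact ⟨Submodule.smul_mem _ c ha, by rw [dbar_smul c ha.1, ha', smul_zero]⟩

variable (V X) in
/-- The `∂̄`-exact forms in `𝒜^{p,q}(X)`. -/
def exactForms (p : ℕ) : (q : ℕ) → Submodule ℂ (Form V X (p + q))
  | 0 => ⊥
  | q + 1 =>
    { carrier := {η | η ∈ smoothForms V X p (q + 1) ∧ ∃ β ∈ smoothForms V X p q, η = dbar p q β}
      add_mem' := by
        rintro _ _ ⟨ha, a, ha', rfl⟩ ⟨hb, b, hb', rfl⟩
        exact ⟨add_mem ha hb, a + b, add_mem ha' hb', (dbar_add ha'.1 hb'.1).symm⟩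
      zero_mem' := ⟨zero_mem _, 0, zero_mem _, by
        have h := dbar_smul (0 : ℂ) (zero_mem (smoothForms V X p q)).1
        simpa using h.symm⟩
      smul_mem' := by
        rintro c _ ⟨ha, a, ha', rfl⟩
        exact ⟨Submodule.smul_mem _ c ha, c • a, Submodule.smul_mem _ c ha',
          (dbar_smul c ha'.1).symm⟩ }

variable (V X) in
/-- The Dolbeault cohomology group `H^{p,q}(X)`. -/
abbrev DolbeaultCohomology (p q : ℕ) : Type _ :=
  closedForms V X p q ⧸ (exactForms V X p q).comap (closedForms V X p q).subtype

/-- The Dolbeault class of a `∂̄`-closed form. -/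
def dolbeaultClass {p q : ℕ} (η : Form V X (p + q)) (h : η ∈ closedForms V X p q) :
    DolbeaultCohomology V X p q :=
  Submodule.Quotient.mk ⟨η, h⟩

end Dolbeault

/-! ### Connections and curvature -/

section Connection

variable {X : Type*} [TopologicalSpace X]
  (F : Type*) [NormedAddCommGroup F] [NormedSpace ℂ F] [FiniteDimensional ℂ F]
  {E : X → Type*} [TopologicalSpace (TotalSpace F E)]
  [∀ x, AddCommGroup (E x)] [∀ x, Module ℂ (E x)] [∀ x, TopologicalSpace (E x)]
  [FiberBundle F E] [VectorBundle ℂ F E]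
  {H : Type*} [NormedAddCommGroup H] [NormedSpace ℝ H]
  {HY : Type*} [TopologicalSpace HY] (I : ModelWithCorners ℝ H HY)
  {Y : Type*} [TopologicalSpace Y] [ChartedSpace HY Y]
  (g : Y → X)
  (D : (Π y, E (g y)) → Π y, TangentSpace I y →L[ℝ] E (g y))

/-- The coordinate map `E_y → F` of the fibre at `y` in the preferred trivialization at `x`. -/
def fibreCoord (x y : X) : E y →L[ℂ] F := (trivializationAt F E x).continuousLinearMapAt ℂ y

/-- The inverse `F → E_y` of `fibreCoord`. -/
def fibreCoordSymm (x y : X) : F →L[ℂ] E y := (trivializationAt F E x).symmL ℂ y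

/-- Endomorphisms of the fibre `E_y` as endomorphisms of `F`, in the preferred trivialization
at `x`. -/
def endToModel (x y : X) : Module.End ℂ (E y) →ₗ[ℝ] (F →L[ℂ] F) where
  toFun L := LinearMap.toContinuousLinearMap
    ((fibreCoord F x y).toLinearMap ∘ₗ L ∘ₗ (fibreCoordSymm F x y).toLinearMap)
  map_add' L L' := by ext f; simp
  map_smul' c L := by ext f; simp

/-- Endomorphisms of `F` as endomorphisms of the fibre `E_y`, in the preferred trivialization
at `x`. -/
def endOfModel (x y : X) : (F →L[ℂ] F) →ₗ[ℝ] Module.End ℂ (E y) where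
  toFun L := (fibreCoordSymm F x y).toLinearMap ∘ₗ L.toLinearMap ∘ₗ (fibreCoord F x y).toLinearMap
  map_add' L L' := by ext f; simp
  map_smul' c L := by ext f; simp

/-- Let `g : Y → X` be a map of manifolds and let `D` be a connection on `g^*E`, whose sections are
the families `σ y ∈ E (g y)`. This is its connection form, in the preferred chart of `Y` at `y` and
in the frame `s_j` of `g^*E` that the preferred trivialization of `E` at `g y` induces from a basis
`b_j` of `F`: the `F`-endomorphism valued 1-form `A` such that `D s_j = A b_j` in this
trivialization. -/
def connectionForm (y : Y) (z : H) : H →L[ℝ] (F →L[ℂ] F) :=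
  let y' : Y := (extChartAt I y).symm z
  let dφ : H →L[ℝ] TangentSpace I y' := mfderiv 𝓘(ℝ, H) I (extChartAt I y).symm z
  let b := Module.finBasis ℂ F
  ∑ j, ((ContinuousLinearMap.smulRightL ℂ F F
      (LinearMap.toContinuousLinearMap (b.coord j))).restrictScalars ℝ) ∘L
    ((fibreCoord F (g y) (g y')).restrictScalars ℝ) ∘L
    (D (fun y'' => fibreCoordSymm F (g y) (g y'') (b j)) y') ∘L dφ

/-- The curvature `D²` of a connection `D` on `g^*E` (`Y` is without boundary), as an
endomorphism valued 2-form: `D² = dA + A ∧ A` in terms of the connection form `A`. -/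
def curvature (y : Y) : H [⋀^Fin 2]→ₗ[ℝ] Module.End ℂ (E (g y)) :=
  let A : H → H [⋀^Fin 1]→L[ℝ] (F →L[ℂ] F) := fun z =>
    ContinuousAlternatingMap.ofSubsingleton ℝ H (F →L[ℂ] F) 0 (connectionForm F I g D y z)
  let z := extChartAt I y y
  (endOfModel F (g y) (g y)).compAlternatingMap
    ((extDeriv A z).toAlternatingMap + wedge (A z).toAlternatingMap (A z).toAlternatingMap)

end Connection

/-! ### Higgs bundles -/

section HiggsBundle

instance continuousSMul_real {W : Type*} [AddCommGroup W] [Module ℂ W] [TopologicalSpace W]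
    [ContinuousSMul ℂ W] : ContinuousSMul ℝ W where
  continuous_smul :=
    (Complex.continuous_ofReal.comp continuous_fst).smul continuous_snd

variable {V : Type*} [NormedAddCommGroup V] [NormedSpace ℂ V] [FiniteDimensional ℂ V]
  {X : Type*} [TopologicalSpace X] [ChartedSpace V X]
  {F : Type*} [NormedAddCommGroup F] [NormedSpace ℂ F] [FiniteDimensional ℂ F]
  {E : X → Type*} [TopologicalSpace (TotalSpace F E)]
  [∀ x, AddCommGroup (E x)] [∀ x, Module ℂ (E x)] [∀ x, TopologicalSpace (E x)]
  [∀ x, IsTopologicalAddGroup (E x)] [∀ x, ContinuousSMul ℂ (E x)]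
  [FiberBundle F E] [VectorBundle ℂ F E]

variable (V E) in
/-- `n`-forms on `X` with values in `End E` (not necessarily smooth). -/
abbrev EndForm (n : ℕ) : Type _ := (x : X) → V [⋀^Fin n]→ₗ[ℝ] Module.End ℂ (E x)

variable (F) in
/-- The expression of an `End E`-valued form in the preferred chart at `x` and the preferred
(holomorphic) trivialization of `E` at `x`. -/
def EndForm.inChart {n : ℕ} (α : EndForm V E n) (x : X) (z : V) :
    V [⋀^Fin n]→L[ℝ] (F →L[ℂ] F) :=
  toCont ((endToModel F x ((extChartAt 𝓘(ℝ, V) x).symm z)).compAlternatingMap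
    ((α ((extChartAt 𝓘(ℝ, V) x).symm z)).compLinearMap (chartSymmDeriv x z).toLinearMap))

variable (F) in
/-- The form `θ` is a Higgs field on the holomorphic bundle `E`. In a holomorphic frame, `∂̄_E` is
`∂̄` on components, so that `[∂̄_E, θ]` is given by the `(1, 1)`-part of the exterior derivative of
the matrix of `θ`. -/
structure IsHiggsField (θ : EndForm V E 1) : Prop where
  smooth : ∀ x, ContDiffAt ℝ ∞ (θ.inChart F x) (extChartAt 𝓘(ℝ, V) x x)
  type_one_zero : ∀ x, IsOfType 1 0 (θ x)
  holomorphic : ∀ x, typePart 1 1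
    (extDeriv (θ.inChart F x) (extChartAt 𝓘(ℝ, V) x x)).toAlternatingMap = 0
  integrable : ∀ x, wedge (θ x) (θ x) = 0

variable (F) in
/-- The operator `∂̄_E` on sections of the holomorphic bundle `E`: the antilinear part
`v ↦ (ds(v) + i ds(i v)) / 2` of the differential, computed at each point `x` in the preferred
(holomorphic) trivialization at `x` and the preferred chart at `x`. -/
def dbarE (σ : Π x, E x) (x : X) (v : V) : E x :=
  let d : V →L[ℝ] F := fderiv ℝ
    (fun z => fibreCoord F x _ (σ ((extChartAt 𝓘(ℝ, V) x).symm z))) (extChartAt 𝓘(ℝ, V) x x)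
  fibreCoordSymm F x x ((2⁻¹ : ℂ) • (d v + Complex.I • d (Complex.I • v)))

/-- The connection `D` (a covariant derivative for the underlying real manifold) is a smooth
connection on the complex vector bundle `E` and its `(0, 1)`-part is `∂̄_E`. -/
structure IsCompatible (D : CovariantDerivative 𝓘(ℝ, V) F E) : Prop where
  smul : ∀ (c : ℂ) (σ : Π x, E x) (x : X),
    MDifferentiableAt 𝓘(ℝ, V) (𝓘(ℝ, V).prod 𝓘(ℝ, F)) (fun y => TotalSpace.mk' F y (σ y)) x →
    ∀ v : V, D (fun y => c • σ y) x v = c • D σ x v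
  smooth : ∀ x : X, ContDiffAt ℝ ∞ (connectionForm F 𝓘(ℝ, V) id D x) (extChartAt 𝓘(ℝ, V) x x)
  zero_one_part : ∀ (σ : Π x, E x) (x : X),
    MDifferentiableAt 𝓘(ℝ, V) (𝓘(ℝ, V).prod 𝓘(ℝ, F)) (fun y => TotalSpace.mk' F y (σ y)) x →
    ∀ v : V, (2⁻¹ : ℂ) • (D σ x v + Complex.I • D σ x (Complex.I • v)) = dbarE F σ x v

/-- The `E`-valued 1-form `v ↦ θ(v) σ`, for a 1-form `θ` with values in `End E` and a section `σ`
of `E`. -/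
def EndForm.applySection (θ : EndForm V E 1) (σ : Π x, E x) (x : X) :
    TangentSpace 𝓘(ℝ, V) x →L[ℝ] E x :=
  (LinearMap.toContinuousLinearMap
    { toFun := fun v : V => θ x (fun _ => v) (σ x)
      map_add' := fun v w => LinearMap.congr_fun
        (((AlternatingMap.ofSubsingleton ℝ V (Module.End ℂ (E x)) 0).symm (θ x)).map_add v w) (σ x)
      map_smul' := fun c v => LinearMap.congr_fun
        (((AlternatingMap.ofSubsingleton ℝ V (Module.End ℂ (E x)) 0).symm (θ x)).map_smul c v)
          (σ x) } : V →L[ℝ] E x)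

theorem EndForm.applySection_add (θ : EndForm V E 1) (σ σ' : Π x, E x) (x : X) :
    θ.applySection (σ + σ') x = θ.applySection σ x + θ.applySection σ' x :=
  ContinuousLinearMap.ext fun v => (θ x (fun _ => v)).map_add (σ x) (σ' x)

theorem EndForm.applySection_smul (θ : EndForm V E 1) (g : X → ℝ) (σ : Π x, E x) (x : X) :
    θ.applySection (g • σ) x = g x • θ.applySection σ x :=
  ContinuousLinearMap.ext fun v => (θ x (fun _ => v)).map_smul (g x : ℂ) (σ x)

/-- The connection `D + θ`, for a 1-form `θ` with values in `End E`. -/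
def addEndForm (D : CovariantDerivative 𝓘(ℝ, V) F E) (θ : EndForm V E 1) :
    CovariantDerivative 𝓘(ℝ, V) F E where
  toFun σ x := D σ x + θ.applySection σ x
  isCovariantDerivativeOnUniv :=
    { add := by
        intro σ σ' x hσ hσ' _
        rw [D.isCovariantDerivativeOnUniv.add hσ hσ', EndForm.applySection_add]
        abel
      leibniz := by
        intro σ g x hσ hg _
        rw [D.isCovariantDerivativeOnUniv.leibniz hσ hg, EndForm.applySection_smul, smul_add]
        abel }

/-- The `(1, 1)`-part of the curvature of a connection. -/
def curvature11 (D : CovariantDerivative 𝓘(ℝ, V) F E) : EndForm V E 2 := fun x =>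
  typePart 1 1 (curvature F 𝓘(ℝ, V) id D x)

/-- The form `(1/k!) (i/2π)^k tr (R^k ∧ θ)` of type `(k + 1, k)`, where `R` is the `(1, 1)`-part of
the curvature of `D`. -/
def ahForm (D : CovariantDerivative 𝓘(ℝ, V) F E) (θ : EndForm V E 1) (k : ℕ) :
    Form V X (k + 1 + k) := fun x =>
  (((k.factorial : ℂ)⁻¹ * (Complex.I / (2 * Real.pi)) ^ k) •
    trForm (wedge (wedgePow (curvature11 D x) k) (θ x))).domDomCongr (finCongr (by omega))

/-- The class `c ∈ H^{k+1,k}(X)` is the characteristic class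
`ah_k(E, θ) = (1/k!) (i/2π)^k tr (At(E)^k θ)`: the representatives of the Atiyah class `At(E)` are
the `(1, 1)`-parts of the curvatures of compatible connections, and `c` is the class of the
resulting `∂̄`-closed form for each of them. -/
def IsHiggsClass (θ : EndForm V E 1) (k : ℕ) (c : DolbeaultCohomology V X (k + 1) k) : Prop :=
  ∀ D : CovariantDerivative 𝓘(ℝ, V) F E, IsCompatible D →
    ∃ h : ahForm D θ k ∈ closedForms V X (k + 1) k, c = dolbeaultClass (ahForm D θ k) h

/-- The connection `D₀ + t (D₁ - D₀) + dt ⊗ ∂/∂t` on the pull-back of `E` to `X × ℝ`. -/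
def pathConnection (D₀ D₁ : CovariantDerivative 𝓘(ℝ, V) F E) (σ : Π p : X × ℝ, E p.1)
    (p : X × ℝ) : V × ℝ →L[ℝ] E p.1 :=
  let σt : Π x, E x := fun x => σ (x, p.2)
  let d₀ : V →L[ℝ] E p.1 := D₀ σt p.1
  let d₁ : V →L[ℝ] E p.1 := D₁ σt p.1
  let dt : E p.1 := deriv (fun t : ℝ => (σ (p.1, t) : E p.1)) p.2
  (d₀ + p.2 • (d₁ - d₀)) ∘L ContinuousLinearMap.fst ℝ V ℝ +
    (ContinuousLinearMap.snd ℝ V ℝ).smulRight dt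

/-- Integration over the fibre `[0, 1]` of a form on `X × ℝ`, with `dt` in the last place:
`∫ α ∧ dt = ∫₀¹ α_t dt`. So `(∫ η)(v₁, …, vₙ) = ∫₀¹ η_{(x,t)}(v₁, …, vₙ, ∂/∂t) dt`. -/
def fibreIntegral {n : ℕ} (η : X × ℝ → (V × ℝ) [⋀^Fin (n + 1)]→ₗ[ℝ] ℂ) : Form V X n := fun x =>
  (∫ t in (0 : ℝ)..1, toCont ((-1 : ℂ) ^ n •
    ((η (x, t)).curryLeft (0, 1)).compLinearMap (LinearMap.inl ℝ V ℝ))).toAlternatingMap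

/-- The transgression form `at_{k+1}(E, D₀, D₁)` of type `(k + 1, k)` of the `(k+1)`-st scalar
Atiyah class. -/
def atTransgression (D₀ D₁ : CovariantDerivative 𝓘(ℝ, V) F E) (k : ℕ) :
    Form V X (k + 1 + k) := fun x =>
  let R : (p : X × ℝ) → (V × ℝ) [⋀^Fin 2]→ₗ[ℝ] Module.End ℂ (E p.1) :=
    curvature F (𝓘(ℝ, V).prod 𝓘(ℝ, ℝ)) Prod.fst (pathConnection D₀ D₁)
  (typePart (k + 1) k ((((k + 1).factorial : ℂ)⁻¹ * (Complex.I / (2 * Real.pi)) ^ (k + 1)) •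
    fibreIntegral (n := 2 * k + 1) (fun p => trForm (wedgePow (R p) (k + 1))) x)).domDomCongr
      (finCongr (by omega))

end HiggsBundle

end Higgs

end

/-! Write `∇ = d + A` in a holomorphic frame. Compatibility means that `A` is of type (1,0). Hence
the curvature `dA + A ∧ A` is `∂̄A` plus a form of type (2,0), and its (1,1)-part is `∂̄A`.

On `X × ℝ` the path `∇ + tθ` has connection form `A + tθ`, without `dt`-component, and curvature
`R_t + dt ∧ θ`, where `R_t` is the curvature of `∇ + tθ` at fixed `t` (`curvForm_path`). A product
with two factors `dt` vanishes, and the trace is cyclic for the even forms `R_t^j`. So the `dt`-part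
of `tr (R_t + dt ∧ θ)^(k+1)` is `(k+1) dt ∧ tr (R_t^k ∧ θ)` (`trace_wedgePow_add_timeWedge`). Moving
`dt` to the last place, past a form of degree `2k+1`, costs a sign. Since `∂̄θ = 0`, the (1,1)-part
of `R_t` is `∂̄A` for every `t`, and the rest of `R_t` is of type (2,0). Only `∂̄A` can contribute
to the (k+1,k)-part of `R_t^k ∧ θ` (`typePart_wedgePow_wedge`), so that part is constant in `t` and
the integral over `[0,1]` does nothing. The constants match because `2πi · (i/2π) · (-1) = 1` and
`(k+1)/(k+1)! = 1/k!`.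

For the cohomological statement, `tr ((∂̄A)^k ∧ θ)` is `∂̄`-closed by the Leibniz rule, `∂̄² = 0`
and `∂̄θ = 0`. For a second compatible connection `A'`, the curvatures satisfy `R' - R = ∂̄(A' -
A)`, and the difference of the two forms is `∂̄` of the trace of `∑ R'^i ∧ (A' - A) ∧ R^(j-i) ∧ θ`
with `j = k - 1` (`dbarAt_telescope`).

Two devices carry the calculations. Algebraic identities between forms are checked on generating
functions in `A ⊗ Λ(ℝ^N)`, where the wedge product is a ring multiplication (`genFun_wedge`,
`genFun_ext`). Moreover, the curvature at a point is defined through the chart and frame preferred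
at that very point. To differentiate it along `X` one must know that it is given near `x` by one
smooth expression in the chart and frame at `x`; this is the gauge transformation law
(`curvForm_gauge`, `chartForm_curvatureForm`). -/

noncomputable section

set_option linter.unusedSectionVars false

namespace Higgs

/-! ### Generating functions: the algebra of forms inside `A ⊗ Λ(ℝ^N)`. -/

section GeneratingFunction

open scoped TensorProduct

/-- The `i`-th generator of the exterior algebra on `N` generators. -/
abbrev gen {N : ℕ} (i : Fin N) : Fin N → ℝ := Pi.single i 1

/-- The generating function of the values of an alternating form on a family `v` of vectors:
`(1 / n!) ∑ α(v_{r 1}, …, v_{r n}) ⊗ ε_{r 1} ⋯ ε_{r n}`. -/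
def genFun {T W : Type*} [AddCommGroup T] [Module ℝ T] [AddCommGroup W] [Module ℝ W] {n N : ℕ}
    (v : Fin N → T) (α : T [⋀^Fin n]→ₗ[ℝ] W) : W ⊗[ℝ] ExteriorAlgebra ℝ (Fin N → ℝ) :=
  (n.factorial : ℝ)⁻¹ •
    ∑ r : Fin n → Fin N, α (v ∘ r) ⊗ₜ[ℝ] ExteriorAlgebra.ιMulti ℝ n (gen ∘ r)

variable {T T' W W' A : Type*} [AddCommGroup T] [Module ℝ T] [AddCommGroup T'] [Module ℝ T']
  [AddCommGroup W] [Module ℝ W] [AddCommGroup W'] [Module ℝ W'] [Ring A] [Algebra ℝ A]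
  {m n N : ℕ}

theorem genFun_add (v : Fin N → T) (α β : T [⋀^Fin n]→ₗ[ℝ] W) :
    genFun v (α + β) = genFun v α + genFun v β := by
  simp [genFun, TensorProduct.add_tmul, Finset.sum_add_distrib]

theorem genFun_smul (v : Fin N → T) (c : ℝ) (α : T [⋀^Fin n]→ₗ[ℝ] W) :
    genFun v (c • α) = c • genFun v α := by
  simp only [genFun, AlternatingMap.smul_apply, ← TensorProduct.smul_tmul', ← Finset.smul_sum]
  rw [smul_comm]

theorem genFun_zero (v : Fin N → T) : genFun v (0 : T [⋀^Fin n]→ₗ[ℝ] W) = 0 := by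
  simp [genFun]

theorem genFun_sub (v : Fin N → T) (α β : T [⋀^Fin n]→ₗ[ℝ] W) :
    genFun v (α - β) = genFun v α - genFun v β := by
  simp [genFun, TensorProduct.sub_tmul, Finset.sum_sub_distrib, smul_sub]

theorem genFun_compAlternatingMap (v : Fin N → T) (f : W →ₗ[ℝ] W') (α : T [⋀^Fin n]→ₗ[ℝ] W) :
    genFun v (f.compAlternatingMap α) = f.rTensor _ (genFun v α) := by
  simp [genFun]

/-- A form is determined by its generating functions. -/
theorem genFun_ext {α β : T [⋀^Fin n]→ₗ[ℝ] W}
    (h : ∀ v : Fin n → T, genFun v α = genFun v β) : α = β := by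
  ext v
  -- The functional that is the determinant in degree `n` and zero in the other degrees. Only words
  -- `r` that are permutations survive, and each contributes `γ v` because its sign occurs twice;
  -- the number `n!` of them cancels the normalization.
  let b : ExteriorAlgebra ℝ (Fin n → ℝ) →ₗ[ℝ] ℝ :=
    ExteriorAlgebra.liftAlternating (Function.update 0 n (Pi.basisFun ℝ (Fin n)).det)
  have hb (r : Fin n → Fin n) : b (ExteriorAlgebra.ιMulti ℝ n (gen ∘ r)) =
      (Pi.basisFun ℝ (Fin n)).det (gen ∘ r) := by
    simp only [b]
    rw [ExteriorAlgebra.liftAlternating_apply_ιMulti]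
    simp
  have key (γ : T [⋀^Fin n]→ₗ[ℝ] W) :
      TensorProduct.rid ℝ W (b.lTensor W (genFun v γ)) = γ v := by
    simp only [genFun, map_smul, map_sum, LinearMap.lTensor_tmul, TensorProduct.rid_tmul, hb]
    have : ∑ r : Fin n → Fin n, (Pi.basisFun ℝ (Fin n)).det (gen ∘ r) • γ (v ∘ r) =
        ∑ σ : Equiv.Perm (Fin n), γ v := by
      symm
      refine Fintype.sum_of_injective (fun σ : Equiv.Perm (Fin n) => (σ : Fin n → Fin n))
        DFunLike.coe_injective _ _ ?_ ?_
      · intro r hr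
        have hr' : ¬ Function.Injective r := fun hi => hr
          ⟨Equiv.ofBijective r ⟨hi, Finite.surjective_of_injective hi⟩, rfl⟩
        simp only [Function.Injective, not_forall] at hr'
        obtain ⟨i, j, hij, hne⟩ := hr'
        rw [AlternatingMap.map_eq_zero_of_eq _ _ (i := i) (j := j) (by simp [hij]) hne, zero_smul]
      · intro σ
        have h1 : (Pi.basisFun ℝ (Fin n)).det (gen ∘ σ) = (Equiv.Perm.sign σ : ℝ) := by
          rw [AlternatingMap.map_perm]
          have : (gen : Fin n → Fin n → ℝ) = Pi.basisFun ℝ (Fin n) := by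
            funext i; simp [gen]
          rw [this, Module.Basis.det_self]
          simp [Units.smul_def]
        simp only [h1, AlternatingMap.map_perm, Units.smul_def]
        rw [← Int.cast_smul_eq_zsmul ℝ, smul_smul, ← Int.cast_mul]
        rcases Int.units_eq_one_or (Equiv.Perm.sign σ) with h | h <;> simp [h]
    rw [this, Finset.sum_const, Finset.card_univ, Fintype.card_perm, Fintype.card_fin,
      ← Nat.cast_smul_eq_nsmul ℝ, smul_smul, inv_mul_cancel₀ (by positivity), one_smul]
  rw [← key α, ← key β, h]

/-- The wedge product as a sum over all permutations. -/
theorem factorial_smul_wedge_apply (α : T [⋀^Fin m]→ₗ[ℝ] A) (β : T [⋀^Fin n]→ₗ[ℝ] A)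
    (v : Fin (m + n) → T) :
    (m.factorial * n.factorial) • wedge α β v =
      ∑ σ : Equiv.Perm (Fin m ⊕ Fin n), Equiv.Perm.sign σ •
        (α (fun i => v (finSumFinEquiv (σ (Sum.inl i)))) *
          β (fun i => v (finSumFinEquiv (σ (Sum.inr i))))) := by
  have h := congrArg (fun γ => LinearMap.mul' ℝ A (γ (v ∘ finSumFinEquiv)))
    (MultilinearMap.domCoprod_alternization_eq α β)
  simp only [Fintype.card_fin, AlternatingMap.smul_apply, map_nsmul] at h
  refine h.symm.trans ?_
  rw [MultilinearMap.alternatization_apply, map_sum]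
  refine Finset.sum_congr rfl fun σ _ => ?_
  rw [Units.smul_def, Units.smul_def, map_zsmul]
  simp [MultilinearMap.domDomCongr_apply, Function.comp_def]

/-- The sign of a permutation in the wedge product is absorbed by reordering the exterior
generators, so all `(m + n)!` permutations contribute equally and cancel the normalization.
Associativity, cyclicity and Leibniz rules for forms thereby become identities in a ring. -/
theorem genFun_wedge (v : Fin N → T) (α : T [⋀^Fin m]→ₗ[ℝ] A) (β : T [⋀^Fin n]→ₗ[ℝ] A) :
    genFun v (wedge α β) = genFun v α * genFun v β := by
  have hm : (m.factorial : ℝ) ≠ 0 := by positivity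
  have hn : (n.factorial : ℝ) ≠ 0 := by positivity
  have hmn : ((m + n).factorial : ℝ) ≠ 0 := by positivity
  let s : Equiv.Perm (Fin m ⊕ Fin n) → (Fin (m + n) → Fin N) → A ⊗[ℝ] ExteriorAlgebra ℝ (Fin N → ℝ) :=
    fun σ r => (Equiv.Perm.sign σ : ℤ) •
        ((α (fun i => v (r (finSumFinEquiv (σ (Sum.inl i))))) *
          β (fun i => v (r (finSumFinEquiv (σ (Sum.inr i)))))) ⊗ₜ[ℝ]
            ExteriorAlgebra.ιMulti ℝ (m + n) (gen ∘ r))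
  have hs (σ : Equiv.Perm (Fin m ⊕ Fin n)) : ∑ r, s σ r = ∑ r, s 1 r := by
    let τ : Equiv.Perm (Fin (m + n)) := finSumFinEquiv.permCongr σ
    refine Fintype.sum_equiv (Equiv.arrowCongr τ.symm (Equiv.refl _)) _ _ fun r => ?_
    have e1 : ((Equiv.arrowCongr τ.symm (Equiv.refl _)) r : Fin (m + n) → Fin N) = r ∘ τ := by
      funext i; simp [Equiv.arrowCongr]
    have e2 : ExteriorAlgebra.ιMulti ℝ (m + n) (gen ∘ (r ∘ τ)) =
        Equiv.Perm.sign σ • ExteriorAlgebra.ιMulti ℝ (m + n) (gen ∘ r) := by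
      rw [← Function.comp_assoc, AlternatingMap.map_perm, Equiv.Perm.sign_permCongr]
    simp only [s, e1, e2]
    rw [Units.smul_def, TensorProduct.tmul_smul]
    simp [τ]
  have h1 : (m.factorial * n.factorial : ℝ) • ∑ r : Fin (m + n) → Fin N,
      wedge α β (v ∘ r) ⊗ₜ[ℝ] ExteriorAlgebra.ιMulti ℝ (m + n) (gen ∘ r) =
      ((m + n).factorial : ℝ) • ∑ r, s 1 r := by
    calc _ = ∑ r, ∑ σ, s σ r := by
          rw [Finset.smul_sum]
          refine Finset.sum_congr rfl fun r _ => ?_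
          rw [TensorProduct.smul_tmul', ← Nat.cast_mul, Nat.cast_smul_eq_nsmul,
            factorial_smul_wedge_apply, TensorProduct.sum_tmul]
          refine Finset.sum_congr rfl fun σ _ => ?_
          simp only [s, Units.smul_def, Function.comp_def]
          exact (TensorProduct.smul_tmul' _ _ _).symm
      _ = _ := by
          rw [Finset.sum_comm]
          simp only [hs]
          rw [Finset.sum_const, Finset.card_univ, Fintype.card_perm, Fintype.card_sum,
            Fintype.card_fin, Fintype.card_fin, Nat.cast_smul_eq_nsmul]
  -- A word of length `m + n` is the concatenation of its first `m` and last `n` letters, so the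
  -- term of the identity permutation factors.
  have h2 : ∑ r, s 1 r = (∑ r : Fin m → Fin N, α (v ∘ r) ⊗ₜ[ℝ] ExteriorAlgebra.ιMulti ℝ m (gen ∘ r)) *
      ∑ r : Fin n → Fin N, β (v ∘ r) ⊗ₜ[ℝ] ExteriorAlgebra.ιMulti ℝ n (gen ∘ r) := by
    rw [Finset.sum_mul_sum, ← Fintype.sum_prod_type']
    refine Fintype.sum_equiv (Fin.appendEquiv m n).symm _ _ fun r => ?_
    obtain ⟨⟨p, q⟩, rfl⟩ := (Fin.appendEquiv m n).surjective r
    simp only [Equiv.symm_apply_apply, s, Algebra.TensorProduct.tmul_mul_tmul,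
      ExteriorAlgebra.ιMulti_mul_ιMulti]
    simp only [Equiv.Perm.sign_one, Units.val_one, one_smul, Equiv.Perm.coe_one, id, Fin.appendEquiv,
      Equiv.coe_fn_mk, finSumFinEquiv_apply_left, finSumFinEquiv_apply_right, Fin.append_left,
      Fin.append_right, Function.comp_def]
    congr 2
    funext i
    refine Fin.addCases (fun i => ?_) (fun i => ?_) i <;> simp
  rw [genFun, genFun, genFun, smul_mul_smul_comm, ← h2]
  rw [← inv_smul_smul₀ (mul_ne_zero hm hn) (∑ r, wedge α β (v ∘ r) ⊗ₜ[ℝ] _), h1, smul_comm,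
    inv_smul_smul₀ hmn, mul_inv]

theorem genFun_wedgePow (v : Fin N → T) (α : T [⋀^Fin 2]→ₗ[ℝ] A) (k : ℕ) :
    genFun v (wedgePow α k) = genFun v α ^ k := by
  induction k with
  | zero =>
    simp [wedgePow, genFun, Algebra.TensorProduct.one_def]
  | succ k ih => rw [wedgePow, genFun_wedge, ih, pow_succ]

/-- Moving the argument at position `i` to the front costs `(-1)^i`, which cancels the sign in the
alternatization. The `n + 1` positions therefore give equal sums and turn `1/(n+1)!` into `1/n!`.
Differentiation of forms becomes left multiplication by odd generators. -/
theorem genFun_alternatizeUncurryFin (v : Fin N → T) (L : T →ₗ[ℝ] T [⋀^Fin n]→ₗ[ℝ] A) :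
    genFun v (AlternatingMap.alternatizeUncurryFin L) =
      ∑ j, (1 : A) ⊗ₜ[ℝ] ExteriorAlgebra.ι ℝ (gen j) * genFun v (L (v j)) := by
  have hn : (n.factorial : ℝ) ≠ 0 := by positivity
  have hn' : ((n : ℝ) + 1) ≠ 0 := by positivity
  let s : Fin (n + 1) → (Fin (n + 1) → Fin N) → A ⊗[ℝ] ExteriorAlgebra ℝ (Fin N → ℝ) :=
    fun i r => ((-1 : ℤ) ^ (i : ℕ)) • ((L (v (r i)) (i.removeNth (v ∘ r))) ⊗ₜ[ℝ]
      ExteriorAlgebra.ιMulti ℝ (n + 1) (gen ∘ r))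
  have hs (i : Fin (n + 1)) : ∑ r, s i r =
      ∑ j, ∑ q : Fin n → Fin N, (L (v j) (v ∘ q)) ⊗ₜ[ℝ]
        (ExteriorAlgebra.ι ℝ (gen j) * ExteriorAlgebra.ιMulti ℝ n (gen ∘ q)) := by
    rw [← Fintype.sum_prod_type']
    refine Fintype.sum_equiv (Fin.insertNthEquiv (fun _ => Fin N) i).symm _ _ fun r => ?_
    obtain ⟨⟨j, q⟩, rfl⟩ := (Fin.insertNthEquiv (fun _ => Fin N) i).surjective r
    have e1 : (v ∘ (Fin.insertNthEquiv (fun _ => Fin N) i) (j, q)) = i.insertNth (v j) (v ∘ q) := by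
      funext l
      refine Fin.succAboveCases i ?_ (fun l => ?_) l <;> simp
    have e2 : (gen ∘ (Fin.insertNthEquiv (fun _ => Fin N) i) (j, q)) =
        i.insertNth (gen j) (gen ∘ q) := by
      funext l
      refine Fin.succAboveCases i ?_ (fun l => ?_) l <;> simp
    simp only [Equiv.symm_apply_apply, s, e1, e2]
    rw [← TensorProduct.tmul_smul, AlternatingMap.neg_one_pow_smul_map_insertNth]
    simp [ExteriorAlgebra.ιMulti_succ_apply, Matrix.vecTail, Function.comp_def]
  have h1 : ∑ r : Fin (n + 1) → Fin N, AlternatingMap.alternatizeUncurryFin L (v ∘ r) ⊗ₜ[ℝ]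
      ExteriorAlgebra.ιMulti ℝ (n + 1) (gen ∘ r) = ∑ i, ∑ r, s i r := by
    rw [Finset.sum_comm]
    refine Finset.sum_congr rfl fun r _ => ?_
    rw [AlternatingMap.alternatizeUncurryFin_apply, TensorProduct.sum_tmul]
    refine Finset.sum_congr rfl fun i _ => ?_
    exact (TensorProduct.smul_tmul' _ _ _).symm
  rw [genFun, h1]
  simp only [hs]
  rw [Finset.sum_const, Finset.card_univ, Fintype.card_fin, ← Nat.cast_smul_eq_nsmul ℝ, smul_smul,
    Nat.factorial_succ]
  push_cast
  rw [mul_inv, mul_right_comm, inv_mul_cancel₀ hn', one_mul, Finset.smul_sum]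
  refine Finset.sum_congr rfl fun j _ => ?_
  rw [genFun, mul_smul_comm, Finset.mul_sum]
  simp [Algebra.TensorProduct.tmul_mul_tmul]

theorem iotaMulti_mul_iota (w : Fin n → Fin N → ℝ) (x : Fin N → ℝ) :
    ExteriorAlgebra.ιMulti ℝ n w * ExteriorAlgebra.ι ℝ x =
      (-1 : ℤ) ^ n • (ExteriorAlgebra.ι ℝ x * ExteriorAlgebra.ιMulti ℝ n w) := by
  have anti (a b : Fin N → ℝ) : ExteriorAlgebra.ι ℝ a * ExteriorAlgebra.ι ℝ b =
      - (ExteriorAlgebra.ι ℝ b * ExteriorAlgebra.ι ℝ a) :=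
    eq_neg_of_add_eq_zero_left (ExteriorAlgebra.ι_add_mul_swap a b)
  induction n with
  | zero => simp
  | succ l ih =>
    rw [ExteriorAlgebra.ιMulti_succ_apply, mul_assoc, ih, mul_smul_comm, ← mul_assoc, anti,
      neg_mul, mul_assoc, smul_neg, pow_succ]
    simp

/-- Even elements commute with the generators. -/
theorem commute_iotaMulti_even (w : Fin n → Fin N → ℝ) (hn : Even n) (x : Fin N → ℝ) :
    Commute (ExteriorAlgebra.ιMulti ℝ n w) (ExteriorAlgebra.ι ℝ x) := by
  rw [Commute, SemiconjBy, iotaMulti_mul_iota, hn.neg_one_pow, one_smul]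

theorem commute_iotaMulti_iotaMulti (w : Fin n → Fin N → ℝ) (hn : Even n) (u : Fin m → Fin N → ℝ) :
    Commute (ExteriorAlgebra.ιMulti ℝ n w) (ExteriorAlgebra.ιMulti ℝ m u) := by
  induction m with
  | zero => simp
  | succ m ih =>
    rw [ExteriorAlgebra.ιMulti_succ_apply]
    exact (commute_iotaMulti_even w hn _).mul_right (ih _)

theorem genFun_mul_iota (v : Fin N → T) (α : T [⋀^Fin n]→ₗ[ℝ] A) (x : Fin N → ℝ) :
    genFun v α * (1 : A) ⊗ₜ[ℝ] ExteriorAlgebra.ι ℝ x =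
      (-1 : ℤ) ^ n • ((1 : A) ⊗ₜ[ℝ] ExteriorAlgebra.ι ℝ x * genFun v α) := by
  rw [genFun, smul_mul_assoc, mul_smul_comm, smul_comm ((-1 : ℤ) ^ n), Finset.sum_mul,
    Finset.mul_sum]
  simp only [Finset.smul_sum]
  refine Finset.sum_congr rfl fun r _ => ?_
  rw [Algebra.TensorProduct.tmul_mul_tmul, Algebra.TensorProduct.tmul_mul_tmul, one_mul, mul_one,
    iotaMulti_mul_iota, TensorProduct.tmul_smul]

/-- Cyclicity of a trace on generating functions, one factor being even. -/
theorem rTensor_genFun_mul_comm (v : Fin N → T) {f : A →ₗ[ℝ] W} (hf : ∀ a b, f (a * b) = f (b * a))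
    (α : T [⋀^Fin n]→ₗ[ℝ] A) (hn : Even n) (β : T [⋀^Fin m]→ₗ[ℝ] A) :
    f.rTensor _ (genFun v α * genFun v β) = f.rTensor _ (genFun v β * genFun v α) := by
  rw [genFun, genFun, smul_mul_smul_comm, smul_mul_smul_comm, Finset.sum_mul_sum,
    Finset.sum_mul_sum, Finset.sum_comm, mul_comm]
  simp only [map_smul, map_sum]
  congr 1
  refine Finset.sum_congr rfl fun r _ => Finset.sum_congr rfl fun q _ => ?_
  rw [Algebra.TensorProduct.tmul_mul_tmul, Algebra.TensorProduct.tmul_mul_tmul,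
    LinearMap.rTensor_tmul, LinearMap.rTensor_tmul, hf, (commute_iotaMulti_iotaMulti _ hn _).eq]

end GeneratingFunction

/-! ### Types (p,q), the Hodge filtration, and `∂̄` at the level of symbols. -/

section Types

variable {T T' W W' A : Type*} [AddCommGroup T] [Module ℂ T] [AddCommGroup T'] [Module ℂ T']
  [AddCommGroup W] [Module ℂ W] [AddCommGroup W'] [Module ℂ W'] [Ring A] [Algebra ℂ A]
  {m n p q p' q' : ℕ}

theorem IsOfType.add {α β : T [⋀^Fin n]→ₗ[ℝ] W} (hα : IsOfType p q α) (hβ : IsOfType p q β) :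
    IsOfType p q (α + β) := fun c v => by
  simp [hα c v, hβ c v]

theorem IsOfType.neg {α : T [⋀^Fin n]→ₗ[ℝ] W} (hα : IsOfType p q α) :
    IsOfType p q (-α) := fun c v => by
  simp [hα c v]

theorem IsOfType.sub {α β : T [⋀^Fin n]→ₗ[ℝ] W} (hα : IsOfType p q α) (hβ : IsOfType p q β) :
    IsOfType p q (α - β) := fun c v => by
  simp [hα c v, hβ c v, smul_sub]

theorem IsOfType.smul {α : T [⋀^Fin n]→ₗ[ℝ] W} (hα : IsOfType p q α) (r : ℂ) :
    IsOfType p q (r • α) := fun c v => by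
  simp [hα c v, smul_comm r]

theorem IsOfType.compLinearMap {α : T' [⋀^Fin n]→ₗ[ℝ] W} (hα : IsOfType p q α) (g : T →ₗ[ℝ] T')
    (hg : ∀ (c : ℂ) v, g (c • v) = c • g v) : IsOfType p q (α.compLinearMap g) := fun c v => by
  simp only [AlternatingMap.compLinearMap_apply]
  rw [← hα c]
  simp only [hg]

theorem IsOfType.compAlternatingMap {α : T [⋀^Fin n]→ₗ[ℝ] W} (hα : IsOfType p q α)
    (f : W →ₗ[ℝ] W') (hf : ∀ (c : ℂ) w, f (c • w) = c • f w) :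
    IsOfType p q (f.compAlternatingMap α) := fun c v => by
  simp [hα c v, hf]

theorem IsOfType.wedge {α : T [⋀^Fin m]→ₗ[ℝ] A} {β : T [⋀^Fin n]→ₗ[ℝ] A}
    (hα : IsOfType p q α) (hβ : IsOfType p' q' β) :
    IsOfType (p + p') (q + q') (Higgs.wedge α β) := fun c v => by
  have h : ((m.factorial * n.factorial : ℕ) : ℂ) ≠ 0 :=
    Nat.cast_ne_zero.2 (Nat.mul_ne_zero m.factorial_ne_zero n.factorial_ne_zero)
  have key := factorial_smul_wedge_apply α β (fun i => c • v i)
  rw [← Nat.cast_smul_eq_nsmul ℂ] at key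
  rw [← inv_smul_smul₀ h (Higgs.wedge α β fun i => c • v i), key, inv_smul_eq_iff₀ h, smul_comm,
    Nat.cast_smul_eq_nsmul, factorial_smul_wedge_apply, Finset.smul_sum]
  refine Finset.sum_congr rfl fun σ _ => ?_
  rw [hα c, hβ c, smul_mul_smul_comm, Units.smul_def, Units.smul_def, smul_comm (_ * _ : ℂ)]
  congr 2
  rw [pow_add, pow_add, mul_mul_mul_comm]

theorem isOfType_wedgePow {α : T [⋀^Fin 2]→ₗ[ℝ] A} (hα : IsOfType 1 1 α) (k : ℕ) :
    IsOfType k k (wedgePow α k) := by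
  induction k with
  | zero => intro c v; simp [wedgePow]
  | succ k ih => exact ih.wedge hα

theorem typePart_apply (η : T [⋀^Fin n]→ₗ[ℝ] W) (v : Fin n → T) :
    typePart p q η v = ((n : ℂ) + 1)⁻¹ • ∑ j ∈ Finset.range (n + 1),
      Complex.exp (-(Real.pi * Complex.I * j * ((p : ℂ) - q) / (n + 1))) •
        η (fun i => Complex.exp (Real.pi * Complex.I * j / (n + 1)) • v i) := by
  let ev : (T [⋀^Fin n]→ₗ[ℝ] W) →+ W :=
    { toFun := fun η => η v, map_zero' := rfl, map_add' := fun _ _ => rfl }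
  exact congrArg (((n : ℂ) + 1)⁻¹ • ·) (map_sum ev _ _)

theorem typePart_compLinearMap (g : T →ₗ[ℝ] T') (hg : ∀ (c : ℂ) v, g (c • v) = c • g v)
    (α : T' [⋀^Fin n]→ₗ[ℝ] W) :
    typePart p q (α.compLinearMap g) = (typePart p q α).compLinearMap g := by
  ext v
  simp [typePart_apply, hg]

theorem typePart_compAlternatingMap (f : W →ₗ[ℝ] W') (hf : ∀ (c : ℂ) w, f (c • w) = c • f w)
    (α : T [⋀^Fin n]→ₗ[ℝ] W) :
    typePart p q (f.compAlternatingMap α) = f.compAlternatingMap (typePart p q α) := by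
  ext v
  simp only [typePart_apply, LinearMap.compAlternatingMap_apply, hf, map_sum]

theorem typePart_zero : typePart p q (0 : T [⋀^Fin n]→ₗ[ℝ] W) = 0 := by
  simpa using typePart_smul p q (0 : ℂ) (0 : T [⋀^Fin n]→ₗ[ℝ] W)

/-- The step `F^p` of the Hodge filtration on `n`-forms. -/
def hodgeFil (T W : Type*) [AddCommGroup T] [Module ℂ T] [AddCommGroup W] [Module ℂ W]
    (n p : ℕ) : Submodule ℂ (T [⋀^Fin n]→ₗ[ℝ] W) :=
  Submodule.span ℂ {η | ∃ p' q', p' + q' = n ∧ p ≤ p' ∧ IsOfType p' q' η}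

theorem IsOfType.mem_hodgeFil {η : T [⋀^Fin n]→ₗ[ℝ] W} (hη : IsOfType p' q η) (h : p' + q = n)
    (hp : p ≤ p') : η ∈ hodgeFil T W n p :=
  Submodule.subset_span ⟨p', q, h, hp, hη⟩

/-- The projection kills every pure type except `(p, q)`, and the generators of `F^(p+1)` all have
first index larger than `p`. -/
theorem typePart_eq_zero_of_mem_hodgeFil {η : T [⋀^Fin n]→ₗ[ℝ] W}
    (hη : η ∈ hodgeFil T W n (p + 1)) (h : p + q = n) : typePart p q η = 0 := by
  induction hη using Submodule.span_induction with
  | mem η hη =>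
    obtain ⟨p', q', h', hp, hη⟩ := hη
    rw [typePart_of_isOfType h h' hη, if_neg (by omega)]
  | zero => exact typePart_zero
  | add a b _ _ ha hb => rw [typePart_add, ha, hb, add_zero]
  | smul c a _ ha => rw [typePart_smul, ha, smul_zero]

theorem wedge_add_left (α β : T [⋀^Fin m]→ₗ[ℝ] A) (γ : T [⋀^Fin n]→ₗ[ℝ] A) :
    wedge (α + β) γ = wedge α γ + wedge β γ :=
  genFun_ext fun v => by simp only [genFun_wedge, genFun_add, add_mul]

theorem wedge_add_right (α : T [⋀^Fin m]→ₗ[ℝ] A) (β γ : T [⋀^Fin n]→ₗ[ℝ] A) :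
    wedge α (β + γ) = wedge α β + wedge α γ :=
  genFun_ext fun v => by simp only [genFun_wedge, genFun_add, mul_add]

theorem wedge_sub_left (α β : T [⋀^Fin m]→ₗ[ℝ] A) (γ : T [⋀^Fin n]→ₗ[ℝ] A) :
    wedge (α - β) γ = wedge α γ - wedge β γ :=
  genFun_ext fun v => by simp only [genFun_wedge, genFun_sub, sub_mul]

theorem wedge_sub_right (α : T [⋀^Fin m]→ₗ[ℝ] A) (β γ : T [⋀^Fin n]→ₗ[ℝ] A) :
    wedge α (β - γ) = wedge α β - wedge α γ :=
  genFun_ext fun v => by simp only [genFun_wedge, genFun_sub, mul_sub]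

/-- `genFun_smul` covers real scalars only, so complex ones are pulled out of the sum over
permutations. -/
theorem wedge_smul_left (c : ℂ) (α : T [⋀^Fin m]→ₗ[ℝ] A) (γ : T [⋀^Fin n]→ₗ[ℝ] A) :
    wedge (c • α) γ = c • wedge α γ := by
  ext v
  have h : ((m.factorial * n.factorial : ℕ) : ℂ) ≠ 0 :=
    Nat.cast_ne_zero.2 (Nat.mul_ne_zero m.factorial_ne_zero n.factorial_ne_zero)
  rw [← inv_smul_smul₀ h (wedge (c • α) γ v), Nat.cast_smul_eq_nsmul, factorial_smul_wedge_apply,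
    inv_smul_eq_iff₀ h, AlternatingMap.smul_apply, smul_comm, Nat.cast_smul_eq_nsmul,
    factorial_smul_wedge_apply, Finset.smul_sum]
  refine Finset.sum_congr rfl fun σ _ => ?_
  rw [AlternatingMap.smul_apply, smul_mul_assoc, Units.smul_def, Units.smul_def, smul_comm]

theorem wedge_smul_right (c : ℂ) (α : T [⋀^Fin m]→ₗ[ℝ] A) (γ : T [⋀^Fin n]→ₗ[ℝ] A) :
    wedge α (c • γ) = c • wedge α γ := by
  ext v
  have h : ((m.factorial * n.factorial : ℕ) : ℂ) ≠ 0 :=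
    Nat.cast_ne_zero.2 (Nat.mul_ne_zero m.factorial_ne_zero n.factorial_ne_zero)
  rw [← inv_smul_smul₀ h (wedge α (c • γ) v), Nat.cast_smul_eq_nsmul, factorial_smul_wedge_apply,
    inv_smul_eq_iff₀ h, AlternatingMap.smul_apply, smul_comm, Nat.cast_smul_eq_nsmul,
    factorial_smul_wedge_apply, Finset.smul_sum]
  refine Finset.sum_congr rfl fun σ _ => ?_
  rw [AlternatingMap.smul_apply, mul_smul_comm, Units.smul_def, Units.smul_def, smul_comm]

theorem wedge_mem_hodgeFil {α : T [⋀^Fin m]→ₗ[ℝ] A} {β : T [⋀^Fin n]→ₗ[ℝ] A}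
    (hα : α ∈ hodgeFil T A m p) (hβ : β ∈ hodgeFil T A n q) :
    wedge α β ∈ hodgeFil T A (m + n) (p + q) := by
  induction hα, hβ using Submodule.span_induction₂ with
  | mem_mem α β hα hβ =>
    obtain ⟨a, b, h, hp, hα⟩ := hα
    obtain ⟨a', b', h', hp', hβ⟩ := hβ
    exact (hα.wedge hβ).mem_hodgeFil (by omega) (by omega)
  | zero_left y hy =>
    rw [show wedge (0 : T [⋀^Fin m]→ₗ[ℝ] A) y = 0 by simpa using wedge_smul_left (0 : ℂ) 0 y]
    exact zero_mem _
  | zero_right x hx =>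
    rw [show wedge x (0 : T [⋀^Fin n]→ₗ[ℝ] A) = 0 by simpa using wedge_smul_right (0 : ℂ) x 0]
    exact zero_mem _
  | add_left x y z _ _ _ h1 h2 => rw [wedge_add_left]; exact add_mem h1 h2
  | add_right x y z _ _ _ h1 h2 => rw [wedge_add_right]; exact add_mem h1 h2
  | smul_left r x y _ _ h => rw [wedge_smul_left]; exact Submodule.smul_mem _ _ h
  | smul_right r x y _ _ h => rw [wedge_smul_right]; exact Submodule.smul_mem _ _ h

/-- The filtration is multiplicative. In `α^(k+1) - β^(k+1) = (α^k - β^k) ∧ α + β^k ∧ (α - β)` each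
factor `α` or `β` lies in `F^1`, while `α - β` lies in `F^2`: exchanging `β` for `α` gains one step.
-/
theorem wedgePow_sub_mem_hodgeFil {α β : T [⋀^Fin 2]→ₗ[ℝ] A} (hβ : IsOfType 1 1 β)
    (h : α - β ∈ hodgeFil T A 2 2) (k : ℕ) :
    wedgePow α k - wedgePow β k ∈ hodgeFil T A (2 * k) (k + 1) := by
  have hα : α ∈ hodgeFil T A 2 1 := by
    rw [← sub_add_cancel α β]
    refine add_mem (Submodule.span_mono ?_ h) (hβ.mem_hodgeFil rfl le_rfl)
    rintro _ ⟨p', q', h1, h2, h3⟩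
    exact ⟨p', q', h1, by omega, h3⟩
  induction k with
  | zero => simp [wedgePow]
  | succ k ih =>
    have e : wedgePow α (k + 1) - wedgePow β (k + 1) =
        wedge (wedgePow α k - wedgePow β k) α + wedge (wedgePow β k) (α - β) := by
      rw [wedge_sub_left, wedge_sub_right, wedgePow, wedgePow]
      abel
    rw [e]
    exact add_mem (wedge_mem_hodgeFil ih hα)
      (wedge_mem_hodgeFil (p := k) (q := 2)
        ((isOfType_wedgePow hβ k).mem_hodgeFil (by omega) le_rfl) h)

/-- The part of type `(k + 1, k)` of `tr (α^k ∧ θ)` for a 2-form `α` without `(0, 2)`-part and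
a form `θ` of type `(1, 0)`. -/
theorem typePart_wedgePow_wedge {α β : T [⋀^Fin 2]→ₗ[ℝ] A} (hβ : IsOfType 1 1 β)
    (h : α - β ∈ hodgeFil T A 2 2) {θ : T [⋀^Fin 1]→ₗ[ℝ] A} (hθ : IsOfType 1 0 θ) (k : ℕ) :
    typePart (k + 1) k (wedge (wedgePow α k) θ) = wedge (wedgePow β k) θ := by
  have h1 : IsOfType (k + 1) k (wedge (wedgePow β k) θ) := (isOfType_wedgePow hβ k).wedge hθ
  have h2 : wedge (wedgePow α k) θ =
      wedge (wedgePow α k - wedgePow β k) θ + wedge (wedgePow β k) θ := by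
    rw [wedge_sub_left, sub_add_cancel]
  rw [h2, typePart_add, typePart_of_isOfType (by omega) (by omega) h1, if_pos rfl,
    typePart_eq_zero_of_mem_hodgeFil
      (wedge_mem_hodgeFil (wedgePow_sub_mem_hodgeFil hβ h k) (hθ.mem_hodgeFil rfl le_rfl))
      (by omega), zero_add]

/-- The antilinear part of a real linear map. -/
def antiPart (L : T →ₗ[ℝ] W) : T →ₗ[ℝ] W :=
  (2⁻¹ : ℂ) • (L + Complex.I • L ∘ₗ ((LinearMap.lsmul ℂ T Complex.I).restrictScalars ℝ))

theorem antiPart_apply (L : T →ₗ[ℝ] W) (v : T) :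
    antiPart L v = (2⁻¹ : ℂ) • (L v + Complex.I • L (Complex.I • v)) := rfl

theorem real_linear_apply_smul (L : T →ₗ[ℝ] W) (c : ℂ) (v : T) :
    L (c • v) = c.re • L v + c.im • L (Complex.I • v) := by
  conv_lhs => rw [← Complex.re_add_im c]
  rw [add_smul, mul_smul, Complex.coe_smul, Complex.coe_smul, map_add, map_smul, map_smul]

theorem antiPart_apply_smul (L : T →ₗ[ℝ] W) (c : ℂ) (v : T) :
    antiPart L (c • v) = (starRingEnd ℂ c) • antiPart L v := by
  have hI : antiPart L (Complex.I • v) = -Complex.I • antiPart L v := by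
    rw [antiPart_apply, antiPart_apply, smul_smul Complex.I Complex.I, Complex.I_mul_I, neg_one_smul,
      map_neg, smul_comm (-Complex.I), smul_add (-Complex.I), smul_smul (-Complex.I)]
    simp [add_comm]
  rw [real_linear_apply_smul, hI]
  conv_rhs => rw [← Complex.re_add_im c]
  rw [← Complex.coe_smul, ← Complex.coe_smul, smul_smul, ← add_smul]
  congr 1
  apply Complex.ext <;> simp

theorem sub_antiPart_apply_smul (L : T →ₗ[ℝ] W) (c : ℂ) (v : T) :
    (L - antiPart L) (c • v) = c • (L - antiPart L) v := by
  have hI : (L - antiPart L) (Complex.I • v) = Complex.I • (L - antiPart L) v := by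
    rw [LinearMap.sub_apply, LinearMap.sub_apply, antiPart_apply_smul, antiPart_apply, smul_sub]
    simp only [smul_add, smul_smul, Complex.conj_I]
    have h1 : -Complex.I * (2⁻¹ * Complex.I) = 2⁻¹ := by
      linear_combination (-2⁻¹ : ℂ) * Complex.I_mul_I
    have h2 : Complex.I * (2⁻¹ * Complex.I) = -2⁻¹ := by
      linear_combination (2⁻¹ : ℂ) * Complex.I_mul_I
    rw [h1, h2]
    module
  rw [real_linear_apply_smul, hI]
  conv_rhs => rw [← Complex.re_add_im c]
  rw [add_smul, mul_smul, Complex.coe_smul, Complex.coe_smul]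

/-- The alternatization of the antilinear part: `∂̄` at the level of symbols. -/
def dbarAlt (L : T →ₗ[ℝ] T [⋀^Fin n]→ₗ[ℝ] W) : T [⋀^Fin (n + 1)]→ₗ[ℝ] W :=
  AlternatingMap.alternatizeUncurryFin (antiPart L)

theorem antiPart_add (L L' : T →ₗ[ℝ] W) : antiPart (L + L') = antiPart L + antiPart L' := by
  ext v
  simp only [antiPart_apply, LinearMap.add_apply, smul_add]
  abel

theorem antiPart_smul (r : ℝ) (L : T →ₗ[ℝ] W) : antiPart (r • L) = r • antiPart L := by
  ext v
  simp only [antiPart_apply, LinearMap.smul_apply, smul_add, smul_comm r]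

theorem dbarAlt_add (L L' : T →ₗ[ℝ] T [⋀^Fin n]→ₗ[ℝ] W) :
    dbarAlt (L + L') = dbarAlt L + dbarAlt L' := by
  rw [dbarAlt, antiPart_add, AlternatingMap.alternatizeUncurryFin_add]
  rfl

theorem dbarAlt_smul (r : ℝ) (L : T →ₗ[ℝ] T [⋀^Fin n]→ₗ[ℝ] W) :
    dbarAlt (r • L) = r • dbarAlt L := by
  rw [dbarAlt, antiPart_smul, AlternatingMap.alternatizeUncurryFin_smul]
  rfl

theorem isOfType_dbarAlt {L : T →ₗ[ℝ] T [⋀^Fin n]→ₗ[ℝ] W} (hL : ∀ w, IsOfType p q (L w)) :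
    IsOfType p (q + 1) (dbarAlt L) := fun c v => by
  have h (w) : IsOfType p q (antiPart L w) := ((hL _).add ((hL _).smul _)).smul _
  rw [dbarAlt, AlternatingMap.alternatizeUncurryFin_apply,
    AlternatingMap.alternatizeUncurryFin_apply, Finset.smul_sum]
  refine Finset.sum_congr rfl fun i _ => ?_
  have := h (v i) c (i.removeNth v)
  rw [antiPart_apply_smul, AlternatingMap.smul_apply,
    show (i.removeNth fun j => c • v j) = fun j => c • i.removeNth v j from rfl, this,
    smul_comm (_ * _ : ℂ), smul_smul (starRingEnd ℂ c)]
  congr 2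
  ring

/-- What remains is the alternatization of the complex linear part of `L`, the symbol of `∂`, which
raises `p` instead of `q`. -/
theorem isOfType_alternatize_sub_dbarAlt {L : T →ₗ[ℝ] T [⋀^Fin n]→ₗ[ℝ] W}
    (hL : ∀ w, IsOfType p q (L w)) :
    IsOfType (p + 1) q (AlternatingMap.alternatizeUncurryFin L - dbarAlt L) := fun c v => by
  have h (w) : IsOfType p q ((L - antiPart L) w) :=
    (hL w).sub (((hL _).add ((hL _).smul _)).smul _)
  have e : AlternatingMap.alternatizeUncurryFin L - dbarAlt L =
      AlternatingMap.alternatizeUncurryFin (L - antiPart L) := by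
    rw [dbarAlt, sub_eq_iff_eq_add, ← AlternatingMap.alternatizeUncurryFin_add, sub_add_cancel]
  rw [e, AlternatingMap.alternatizeUncurryFin_apply,
    AlternatingMap.alternatizeUncurryFin_apply, Finset.smul_sum]
  refine Finset.sum_congr rfl fun i _ => ?_
  have := h (v i) c (i.removeNth v)
  rw [sub_antiPart_apply_smul, AlternatingMap.smul_apply,
    show (i.removeNth fun j => c • v j) = fun j => c • i.removeNth v j from rfl, this,
    smul_comm (_ * _ : ℂ), smul_smul c]
  congr 2
  ring

/-- The linear and antilinear parts of `L` give forms of types `(p + 1, q)` and `(p, q + 1)`, and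
the projection keeps the second. This replaces the averaging projection by an explicit operator that
obeys a Leibniz rule. -/
theorem typePart_alternatize {L : T →ₗ[ℝ] T [⋀^Fin n]→ₗ[ℝ] W} (hL : ∀ w, IsOfType p q (L w))
    (h : p + q = n) :
    typePart p (q + 1) (AlternatingMap.alternatizeUncurryFin L) = dbarAlt L := by
  rw [← sub_add_cancel (AlternatingMap.alternatizeUncurryFin L) (dbarAlt L), typePart_add,
    typePart_of_isOfType (by omega) (by omega) (isOfType_alternatize_sub_dbarAlt hL),
    typePart_of_isOfType (by omega) (by omega) (isOfType_dbarAlt hL), if_neg (by omega),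
    if_pos rfl, zero_add]

end Types

/-! ### Forms on a vector space: `∂̄² = 0`, the Leibniz rule and telescoping sums. -/

section LocalForms

open scoped TensorProduct

/-- With this, every linear operator on forms is continuous (`contOperator`), hence smooth and
compatible with derivatives and integrals. -/
instance finiteDimensional_continuousAlternatingMap {T W : Type*} [NormedAddCommGroup T]
    [NormedSpace ℝ T] [FiniteDimensional ℝ T] [NormedAddCommGroup W] [NormedSpace ℝ W]
    [FiniteDimensional ℝ W] {n : ℕ} : FiniteDimensional ℝ (T [⋀^Fin n]→L[ℝ] W) := by
  let b := Module.finBasis ℝ T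
  let ev : (T [⋀^Fin n]→L[ℝ] W) →ₗ[ℝ] ((Fin n → Fin (Module.finrank ℝ T)) → W) :=
    LinearMap.pi fun r => (ContinuousAlternatingMap.apply ℝ T W (b ∘ r)).toLinearMap
  refine FiniteDimensional.of_injective ev fun α β h => ?_
  apply ContinuousAlternatingMap.toAlternatingMap_injective
  exact b.ext_alternating fun r _ => congrFun h r

variable {V W W' A : Type*} [NormedAddCommGroup V] [NormedSpace ℂ V] [FiniteDimensional ℂ V]
  [NormedAddCommGroup W] [NormedSpace ℂ W] [FiniteDimensional ℂ W]
  [NormedAddCommGroup W'] [NormedSpace ℂ W'] [FiniteDimensional ℂ W']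
  [NormedRing A] [NormedAlgebra ℂ A] [FiniteDimensional ℂ A] {m n p q : ℕ}

/-- A form on the vector space `V` is of class `C^r` at `c`. -/
def FormContDiffAt (r : WithTop ℕ∞) (η : V → V [⋀^Fin n]→ₗ[ℝ] W) (c : V) : Prop :=
  ContDiffAt ℝ r (fun z => toCont (η z)) c

/-- The differential at `c` of a form on the vector space `V`. -/
def formDeriv (η : V → V [⋀^Fin n]→ₗ[ℝ] W) (c : V) : V →ₗ[ℝ] V [⋀^Fin n]→ₗ[ℝ] W :=
  ContinuousAlternatingMap.toAlternatingMapLinear ∘ₗ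
    (fderiv ℝ (fun z => toCont (η z)) c : V →ₗ[ℝ] V [⋀^Fin n]→L[ℝ] W)

/-- The operator `∂̄` on forms on the vector space `V`. -/
def dbarAt (η : V → V [⋀^Fin n]→ₗ[ℝ] W) (c : V) : V [⋀^Fin (n + 1)]→ₗ[ℝ] W :=
  dbarAlt (formDeriv η c)

theorem toAlternatingMap_extDeriv (η : V → V [⋀^Fin n]→ₗ[ℝ] W) (c : V) :
    (extDeriv (fun z => toCont (η z)) c).toAlternatingMap =
      AlternatingMap.alternatizeUncurryFin (formDeriv η c) :=
  ContinuousAlternatingMap.toAlternatingMap_alternatizeUncurryFin _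

theorem FormContDiffAt.differentiableAt {r : WithTop ℕ∞} {η : V → V [⋀^Fin n]→ₗ[ℝ] W} {c : V}
    (h : FormContDiffAt r η c) (hr : r ≠ 0) : DifferentiableAt ℝ (fun z => toCont (η z)) c :=
  ContDiffAt.differentiableAt h hr

/-- A linear operator on forms as a continuous linear map. -/
def contOperator (Φ : (V [⋀^Fin n]→ₗ[ℝ] W) →ₗ[ℝ] (V [⋀^Fin m]→ₗ[ℝ] W')) :
    (V [⋀^Fin n]→L[ℝ] W) →L[ℝ] (V [⋀^Fin m]→L[ℝ] W') :=
  LinearMap.toContinuousLinearMap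
    { toFun := fun α => toCont (Φ α.toAlternatingMap)
      map_add' := fun α β => by
        ext v
        exact congrArg (fun γ => γ v) (Φ.map_add α.toAlternatingMap β.toAlternatingMap)
      map_smul' := fun c α => by
        ext v
        exact congrArg (fun γ => γ v) (Φ.map_smul c α.toAlternatingMap) }

theorem FormContDiffAt.operator {r : WithTop ℕ∞} {η : V → V [⋀^Fin n]→ₗ[ℝ] W} {c : V}
    (h : FormContDiffAt r η c) (Φ : (V [⋀^Fin n]→ₗ[ℝ] W) →ₗ[ℝ] (V [⋀^Fin m]→ₗ[ℝ] W')) :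
    FormContDiffAt r (fun z => Φ (η z)) c :=
  (contOperator Φ).contDiff.contDiffAt.comp c h

theorem formDeriv_operator {η : V → V [⋀^Fin n]→ₗ[ℝ] W} {c : V}
    (h : DifferentiableAt ℝ (fun z => toCont (η z)) c)
    (Φ : (V [⋀^Fin n]→ₗ[ℝ] W) →ₗ[ℝ] (V [⋀^Fin m]→ₗ[ℝ] W')) (w : V) :
    formDeriv (fun z => Φ (η z)) c w = Φ (formDeriv η c w) := by
  have := ((contOperator Φ).hasFDerivAt.comp c h.hasFDerivAt).fderiv
  have e : (fun z => toCont (Φ (η z))) = contOperator Φ ∘ fun z => toCont (η z) := rfl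
  rw [formDeriv, e, this]
  rfl

theorem formDeriv_add {η ζ : V → V [⋀^Fin n]→ₗ[ℝ] W} {c : V}
    (hη : DifferentiableAt ℝ (fun z => toCont (η z)) c)
    (hζ : DifferentiableAt ℝ (fun z => toCont (ζ z)) c) :
    formDeriv (fun z => η z + ζ z) c = formDeriv η c + formDeriv ζ c := by
  have e : (fun z => toCont (η z + ζ z)) = fun z => toCont (η z) + toCont (ζ z) := rfl
  rw [formDeriv, e, fderiv_fun_add hη hζ]
  rfl

theorem FormContDiffAt.add {r : WithTop ℕ∞} {η ζ : V → V [⋀^Fin n]→ₗ[ℝ] W} {c : V}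
    (hη : FormContDiffAt r η c) (hζ : FormContDiffAt r ζ c) :
    FormContDiffAt r (fun z => η z + ζ z) c :=
  ContDiffAt.add hη hζ

theorem FormContDiffAt.sub {r : WithTop ℕ∞} {η ζ : V → V [⋀^Fin n]→ₗ[ℝ] W} {c : V}
    (hη : FormContDiffAt r η c) (hζ : FormContDiffAt r ζ c) :
    FormContDiffAt r (fun z => η z - ζ z) c :=
  ContDiffAt.sub hη hζ

theorem formDeriv_sub {η ζ : V → V [⋀^Fin n]→ₗ[ℝ] W} {c : V}
    (hη : DifferentiableAt ℝ (fun z => toCont (η z)) c)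
    (hζ : DifferentiableAt ℝ (fun z => toCont (ζ z)) c) :
    formDeriv (fun z => η z - ζ z) c = formDeriv η c - formDeriv ζ c := by
  have e : (fun z => toCont (η z - ζ z)) = fun z => toCont (η z) - toCont (ζ z) := rfl
  rw [formDeriv, e, fderiv_fun_sub hη hζ]
  rfl

variable (V A m n) in
/-- The wedge product as a continuous bilinear map. -/
def wedgeCLM : (V [⋀^Fin m]→L[ℝ] A) →L[ℝ] (V [⋀^Fin n]→L[ℝ] A) →L[ℝ] (V [⋀^Fin (m + n)]→L[ℝ] A) :=
  (LinearMap.mk₂ ℝ (fun (α : V [⋀^Fin m]→L[ℝ] A) (β : V [⋀^Fin n]→L[ℝ] A) =>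
      toCont (wedge α.toAlternatingMap β.toAlternatingMap))
    (fun α β γ => ContinuousAlternatingMap.toAlternatingMap_injective
      (wedge_add_left α.toAlternatingMap β.toAlternatingMap γ.toAlternatingMap))
    (fun c α β => ContinuousAlternatingMap.toAlternatingMap_injective
      (wedge_smul_left (c : ℂ) α.toAlternatingMap β.toAlternatingMap))
    (fun α β γ => ContinuousAlternatingMap.toAlternatingMap_injective
      (wedge_add_right α.toAlternatingMap β.toAlternatingMap γ.toAlternatingMap))
    (fun c α β => ContinuousAlternatingMap.toAlternatingMap_injective
      (wedge_smul_right (c : ℂ) α.toAlternatingMap β.toAlternatingMap))).toContinuousBilinearMap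

theorem FormContDiffAt.wedge {r : WithTop ℕ∞} {η : V → V [⋀^Fin m]→ₗ[ℝ] A}
    {ζ : V → V [⋀^Fin n]→ₗ[ℝ] A} {c : V}
    (hη : FormContDiffAt r η c) (hζ : FormContDiffAt r ζ c) :
    FormContDiffAt r (fun z => Higgs.wedge (η z) (ζ z)) c := by
  have h : ContDiff ℝ r (wedgeCLM V A m n) := ContinuousLinearMap.contDiff _
  have h1 : ContDiffAt ℝ r (fun z => wedgeCLM V A m n (toCont (η z))) c :=
    h.contDiffAt.comp c hη
  have h2 : ContDiffAt ℝ r (fun z => wedgeCLM V A m n (toCont (η z)) (toCont (ζ z))) c :=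
    h1.clm_apply hζ
  exact h2

theorem FormContDiffAt.wedgePow {r : WithTop ℕ∞} {η : V → V [⋀^Fin 2]→ₗ[ℝ] A} {c : V}
    (hη : FormContDiffAt r η c) (k : ℕ) :
    FormContDiffAt r (fun z => Higgs.wedgePow (η z) k) c := by
  induction k with
  | zero =>
    change ContDiffAt ℝ r (fun _ : V => toCont (AlternatingMap.constOfIsEmpty ℝ V (Fin 0) (1 : A))) c
    exact contDiffAt_const
  | succ k ih => exact ih.wedge hη

theorem formDeriv_wedge {η : V → V [⋀^Fin m]→ₗ[ℝ] A} {ζ : V → V [⋀^Fin n]→ₗ[ℝ] A} {c : V}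
    (hη : DifferentiableAt ℝ (fun z => toCont (η z)) c)
    (hζ : DifferentiableAt ℝ (fun z => toCont (ζ z)) c) (w : V) :
    formDeriv (fun z => wedge (η z) (ζ z)) c w =
      wedge (formDeriv η c w) (ζ c) + wedge (η c) (formDeriv ζ c w) := by
  have := ((wedgeCLM V A m n).hasFDerivAt_of_bilinear hη.hasFDerivAt hζ.hasFDerivAt).fderiv
  refine (congrArg (fun L => (L w).toAlternatingMap) this).trans ?_
  exact add_comm (wedge (η c) (formDeriv ζ c w)) (wedge (formDeriv η c w) (ζ c))

/-- For fixed scalar and vectors the type condition is a linear identity between values of the form.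
It holds on a neighbourhood, so it can be differentiated. -/
theorem isOfType_formDeriv {η : V → V [⋀^Fin n]→ₗ[ℝ] W} {c : V}
    (h : ∀ᶠ z in 𝓝 c, IsOfType p q (η z))
    (hd : DifferentiableAt ℝ (fun z => toCont (η z)) c) (w : V) :
    IsOfType p q (formDeriv η c w) := fun s v => by
  have key (u : Fin n → V) : HasFDerivAt (fun z => η z u)
      ((ContinuousAlternatingMap.apply ℝ V W u).comp (fderiv ℝ (fun z => toCont (η z)) c)) c :=
    (ContinuousAlternatingMap.apply ℝ V W u).hasFDerivAt.comp c hd.hasFDerivAt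
  have h1 := key (fun i => s • v i)
  have h2 := ((key v).const_smul (s ^ p * (starRingEnd ℂ s) ^ q)).congr_of_eventuallyEq
    (f₁ := fun z => η z fun i => s • v i) (h.mono fun z hz => hz s v)
  exact DFunLike.congr_fun (h1.unique h2) w

/-- `∂̄` is the `(p, q + 1)`-part of the exterior derivative of a form of type `(p, q)`. -/
theorem typePart_extDeriv {η : V → V [⋀^Fin n]→ₗ[ℝ] W} {c : V}
    (h : ∀ᶠ z in 𝓝 c, IsOfType p q (η z))
    (hd : DifferentiableAt ℝ (fun z => toCont (η z)) c) (hn : p + q = n) :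
    typePart p (q + 1) (extDeriv (fun z => toCont (η z)) c).toAlternatingMap = dbarAt η c := by
  rw [toAlternatingMap_extDeriv, typePart_alternatize (isOfType_formDeriv h hd) hn, dbarAt]

theorem contDiffAt_operator_fderiv {E G H : Type*} [NormedAddCommGroup E] [NormedSpace ℝ E]
    [FiniteDimensional ℝ E] [NormedAddCommGroup G] [NormedSpace ℝ G] [FiniteDimensional ℝ G]
    [NormedAddCommGroup H] [NormedSpace ℝ H] (Φ : (E →L[ℝ] G) →ₗ[ℝ] H) {f : E → G} {c : E}
    {r s : WithTop ℕ∞} (h : ContDiffAt ℝ r f c) (hs : s + 1 ≤ r) :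
    ContDiffAt ℝ s (fun z => Φ (fderiv ℝ f z)) c :=
  (LinearMap.toContinuousLinearMap Φ).contDiff.contDiffAt.comp c (h.fderiv_right hs)

theorem contDiffAt_extDeriv {E G : Type*} [NormedAddCommGroup E] [NormedSpace ℝ E]
    [NormedAddCommGroup G] [NormedSpace ℝ G] {f : E → E [⋀^Fin n]→L[ℝ] G} {c : E}
    {r s : WithTop ℕ∞} (h : ContDiffAt ℝ r f c) (hs : s + 1 ≤ r) :
    ContDiffAt ℝ s (extDeriv f) c := by
  have h1 := h.fderiv_right hs
  have h2 : ContDiff ℝ s (ContinuousAlternatingMap.alternatizeUncurryFinCLM (n := n) ℝ E G) :=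
    ContinuousLinearMap.contDiff _
  exact h2.contDiffAt.comp c h1

variable (V W n) in
/-- `∂̄` as a linear map on differentials. -/
def dbarAltLM : (V →L[ℝ] V [⋀^Fin n]→L[ℝ] W) →ₗ[ℝ] (V [⋀^Fin (n + 1)]→L[ℝ] W) where
  toFun L := toCont (dbarAlt (ContinuousAlternatingMap.toAlternatingMapLinear ∘ₗ
    (L : V →ₗ[ℝ] V [⋀^Fin n]→L[ℝ] W)))
  map_add' L L' := by
    have e : (ContinuousAlternatingMap.toAlternatingMapLinear ∘ₗ
        ((L + L' : V →L[ℝ] V [⋀^Fin n]→L[ℝ] W) : V →ₗ[ℝ] V [⋀^Fin n]→L[ℝ] W) :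
          V →ₗ[ℝ] V [⋀^Fin n]→ₗ[ℝ] W) =
        (ContinuousAlternatingMap.toAlternatingMapLinear ∘ₗ
          (L : V →ₗ[ℝ] V [⋀^Fin n]→L[ℝ] W)) +
        (ContinuousAlternatingMap.toAlternatingMapLinear ∘ₗ
          (L' : V →ₗ[ℝ] V [⋀^Fin n]→L[ℝ] W)) := LinearMap.ext fun _ => rfl
    rw [e, dbarAlt_add]
    rfl
  map_smul' c L := by
    have e : (ContinuousAlternatingMap.toAlternatingMapLinear ∘ₗ
        ((c • L : V →L[ℝ] V [⋀^Fin n]→L[ℝ] W) : V →ₗ[ℝ] V [⋀^Fin n]→L[ℝ] W) :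
          V →ₗ[ℝ] V [⋀^Fin n]→ₗ[ℝ] W) =
        c • (ContinuousAlternatingMap.toAlternatingMapLinear ∘ₗ
          (L : V →ₗ[ℝ] V [⋀^Fin n]→L[ℝ] W)) := LinearMap.ext fun _ => rfl
    rw [e, dbarAlt_smul]
    rfl

theorem FormContDiffAt.dbarAt {r s : WithTop ℕ∞} {η : V → V [⋀^Fin n]→ₗ[ℝ] W} {c : V}
    (h : FormContDiffAt r η c) (hs : s + 1 ≤ r) : FormContDiffAt s (Higgs.dbarAt η) c :=
  contDiffAt_operator_fderiv (dbarAltLM V W n) h hs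

/-- `∂̄² = 0`. -/
theorem dbarAt_dbarAt {η : V → V [⋀^Fin n]→ₗ[ℝ] W} {c : V}
    (h : ∀ᶠ z in 𝓝 c, IsOfType p q (η z)) (hd : FormContDiffAt 2 η c) (hn : p + q = n) :
    dbarAt (dbarAt η) c = 0 := by
  have hd1 : ∀ᶠ z in 𝓝 c, DifferentiableAt ℝ (fun z => toCont (η z)) z :=
    (ContDiffAt.eventually hd (by simp)).mono fun z hz => hz.differentiableAt (by simp)
  have hty : ∀ᶠ z in 𝓝 c, ∀ w, IsOfType p q (formDeriv η z w) := by
    filter_upwards [h.eventually_nhds, hd1] with z hz hz' w using isOfType_formDeriv hz hz' w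
  -- Split `dη = R + S` with `R = ∂̄η` of type `(p, q+1)` and `S` of type `(p+1, q)`. Then `d² = 0`
  -- gives `dR = -dS`. The `(p, q+2)`-part of `dR` is `∂̄R`, whereas `dS` has only the types `(p+2,
  -- q)` and `(p+1, q+1)`.
  set δ : V → V [⋀^Fin (n + 1)]→ₗ[ℝ] W := fun z =>
    (extDeriv (fun z => toCont (η z)) z).toAlternatingMap with hδ
  have hδ' : (fun z => toCont (δ z)) = extDeriv (fun z => toCont (η z)) := by
    funext z; ext v; rfl
  have hδd : DifferentiableAt ℝ (fun z => toCont (δ z)) c := by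
    rw [hδ']
    exact (contDiffAt_extDeriv (s := 1) hd (by norm_num)).differentiableAt (by simp)
  have hRd : DifferentiableAt ℝ (fun z => toCont (dbarAt η z)) c :=
    (hd.dbarAt (s := 1) (by norm_num)).differentiableAt (by simp)
  have hSd : DifferentiableAt ℝ (fun z => toCont (δ z - dbarAt η z)) c := hδd.sub hRd
  have hR : ∀ w, IsOfType p (q + 1) (formDeriv (dbarAt η) c w) :=
    isOfType_formDeriv (hty.mono fun z hz => isOfType_dbarAlt hz) hRd
  have hS : ∀ w, IsOfType (p + 1) q (formDeriv (fun z => δ z - dbarAt η z) c w) := by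
    refine isOfType_formDeriv (hty.mono fun z hz => ?_) hSd
    change IsOfType (p + 1) q ((extDeriv (fun z => toCont (η z)) z).toAlternatingMap - dbarAt η z)
    rw [toAlternatingMap_extDeriv]
    exact isOfType_alternatize_sub_dbarAlt hz
  have hdd : AlternatingMap.alternatizeUncurryFin (formDeriv δ c) = 0 := by
    rw [← toAlternatingMap_extDeriv, hδ', extDeriv_extDeriv_apply hd (by simp)]
    rfl
  have e : AlternatingMap.alternatizeUncurryFin (formDeriv (dbarAt η) c) =
      -AlternatingMap.alternatizeUncurryFin (formDeriv (fun z => δ z - dbarAt η z) c) := by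
    rw [eq_neg_iff_add_eq_zero, ← AlternatingMap.alternatizeUncurryFin_add, formDeriv_sub hδd hRd,
      add_sub_cancel, hdd]
  have e1 := typePart_alternatize hR (by omega)
  rw [e, ← sub_add_cancel (AlternatingMap.alternatizeUncurryFin _) (dbarAlt _), neg_add,
    typePart_add, typePart_of_isOfType (by omega) (by omega)
      (isOfType_alternatize_sub_dbarAlt hS).neg, typePart_of_isOfType (by omega) (by omega)
      (isOfType_dbarAlt hS).neg, if_neg (by omega), if_neg (by omega), zero_add] at e1
  rw [dbarAt, ← e1]

theorem dbarAt_add {η ζ : V → V [⋀^Fin n]→ₗ[ℝ] W} {c : V}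
    (hη : DifferentiableAt ℝ (fun z => toCont (η z)) c)
    (hζ : DifferentiableAt ℝ (fun z => toCont (ζ z)) c) :
    dbarAt (fun z => η z + ζ z) c = dbarAt η c + dbarAt ζ c := by
  rw [dbarAt, formDeriv_add hη hζ, dbarAlt_add]
  rfl

/-- The graded Leibniz rule. On generating functions `∂̄` multiplies antilinear derivatives by
generators from the left, and moving a generator past the first factor, of degree `m`, produces
`(-1)^m`. -/
theorem genFun_dbarAt_wedge {η : V → V [⋀^Fin m]→ₗ[ℝ] A} {ζ : V → V [⋀^Fin n]→ₗ[ℝ] A} {c : V}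
    (hη : DifferentiableAt ℝ (fun z => toCont (η z)) c)
    (hζ : DifferentiableAt ℝ (fun z => toCont (ζ z)) c) {N : ℕ} (v : Fin N → V) :
    genFun v (dbarAt (fun z => wedge (η z) (ζ z)) c) =
      genFun v (dbarAt η c) * genFun v (ζ c) +
        (-1 : ℤ) ^ m • (genFun v (η c) * genFun v (dbarAt ζ c)) := by
  have e (w : V) : antiPart (formDeriv (fun z => wedge (η z) (ζ z)) c) w =
      wedge (antiPart (formDeriv η c) w) (ζ c) + wedge (η c) (antiPart (formDeriv ζ c) w) := by
    simp only [antiPart_apply, formDeriv_wedge hη hζ, wedge_smul_left, wedge_smul_right,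
      wedge_add_left, wedge_add_right, smul_add]
    abel
  simp only [dbarAt, dbarAlt]
  rw [genFun_alternatizeUncurryFin, genFun_alternatizeUncurryFin, genFun_alternatizeUncurryFin,
    Finset.sum_mul, Finset.mul_sum, Finset.smul_sum, ← Finset.sum_add_distrib]
  refine Finset.sum_congr rfl fun j _ => ?_
  rw [e, genFun_add, genFun_wedge, genFun_wedge, mul_add, mul_assoc, ← mul_assoc (genFun v (η c)),
    genFun_mul_iota, smul_mul_assoc, smul_smul, ← mul_pow]
  simp [mul_assoc]

theorem dbarAt_compAlternatingMap (f : W →ₗ[ℂ] W') {η : V → V [⋀^Fin n]→ₗ[ℝ] W} {c : V}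
    (h : DifferentiableAt ℝ (fun z => toCont (η z)) c) :
    dbarAt (fun z => (f.restrictScalars ℝ).compAlternatingMap (η z)) c =
      (f.restrictScalars ℝ).compAlternatingMap (dbarAt η c) := by
  have e (w : V) : formDeriv (fun z => (f.restrictScalars ℝ).compAlternatingMap (η z)) c w =
      (f.restrictScalars ℝ).compAlternatingMap (formDeriv η c w) :=
    formDeriv_operator h
      { toFun := fun α => (f.restrictScalars ℝ).compAlternatingMap α
        map_add' := fun α β => by ext; simp
        map_smul' := fun r α => by ext; simp } w
  ext v
  simp only [dbarAt, dbarAlt, AlternatingMap.alternatizeUncurryFin_apply, antiPart_apply, e,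
    LinearMap.compAlternatingMap_apply, map_sum]
  simp

theorem dbarAt_wedgePow {η : V → V [⋀^Fin 2]→ₗ[ℝ] A} {c : V}
    (hη : FormContDiffAt 1 η c) (h : dbarAt η c = 0) (k : ℕ) :
    dbarAt (fun z => wedgePow (η z) k) c = 0 := by
  induction k with
  | zero =>
    have : formDeriv (fun z => wedgePow (η z) 0) c = 0 := by
      have e : (fun z => toCont (wedgePow (η z) 0)) =
        fun _ => toCont (AlternatingMap.constOfIsEmpty ℝ V (Fin 0) (1 : A)) := rfl
      rw [formDeriv, e, fderiv_const_apply]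
      rfl
    rw [dbarAt, this]
    ext v
    simp [dbarAlt, AlternatingMap.alternatizeUncurryFin_apply, antiPart_apply]
  | succ k ih =>
    refine genFun_ext fun v => ?_
    have e := genFun_dbarAt_wedge ((hη.wedgePow k).differentiableAt (by simp))
      (hη.differentiableAt (by simp)) v
    rw [ih, h, genFun_zero, genFun_zero, zero_mul, mul_zero, smul_zero, add_zero] at e
    rw [genFun_zero]
    exact e

/-- For endomorphism valued forms with `∂̄η = ∂̄θ = 0`, the form `f (η^k ∧ θ)` is `∂̄`-closed. -/
theorem dbarAt_wedgePow_wedge {η : V → V [⋀^Fin 2]→ₗ[ℝ] A} {θ : V → V [⋀^Fin n]→ₗ[ℝ] A} {c : V}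
    (hη : FormContDiffAt 1 η c) (h : dbarAt η c = 0) (hθ : FormContDiffAt 1 θ c)
    (h' : dbarAt θ c = 0) (k : ℕ) :
    dbarAt (fun z => wedge (wedgePow (η z) k) (θ z)) c = 0 := by
  refine genFun_ext fun v => ?_
  rw [genFun_dbarAt_wedge ((hη.wedgePow k).differentiableAt (by simp))
      (hθ.differentiableAt (by simp)), dbarAt_wedgePow hη h, h', genFun_zero, genFun_zero,
      genFun_zero]
  simp

/-- The form `∑ j, η^j ∧ β ∧ ζ^(k - j)`. -/
def telescope {T A : Type*} [AddCommGroup T] [Module ℝ T] [Ring A] [Algebra ℝ A]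
    (η ζ : T [⋀^Fin 2]→ₗ[ℝ] A) (β : T [⋀^Fin 1]→ₗ[ℝ] A) : (k : ℕ) → T [⋀^Fin (2 * k + 1)]→ₗ[ℝ] A
  | 0 => β
  | k + 1 => wedge (telescope η ζ β k) ζ + wedge (wedgePow η (k + 1)) β

theorem FormContDiffAt.telescope {r : WithTop ℕ∞} {η ζ : V → V [⋀^Fin 2]→ₗ[ℝ] A}
    {β : V → V [⋀^Fin 1]→ₗ[ℝ] A} {c : V} (hη : FormContDiffAt r η c) (hζ : FormContDiffAt r ζ c)
    (hβ : FormContDiffAt r β c) (k : ℕ) :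
    FormContDiffAt r (fun z => Higgs.telescope (η z) (ζ z) (β z) k) c := by
  induction k with
  | zero => exact hβ
  | succ k ih => exact (ih.wedge hζ).add ((hη.wedgePow (k + 1)).wedge hβ)

theorem isOfType_telescope {A : Type*} [Ring A] [Algebra ℂ A] {η ζ : V [⋀^Fin 2]→ₗ[ℝ] A} {β : V [⋀^Fin 1]→ₗ[ℝ] A}
    (hη : IsOfType 1 1 η) (hζ : IsOfType 1 1 ζ) (hβ : IsOfType 1 0 β) (k : ℕ) :
    IsOfType (k + 1) k (telescope η ζ β k) := by
  induction k with
  | zero => exact hβ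
  | succ k ih => exact (ih.wedge hζ).add ((isOfType_wedgePow hη (k + 1)).wedge hβ)

/-- If `∂̄β = η - ζ` then `∂̄ ∑ j, η^j ∧ β ∧ ζ^(k - j) = η^(k + 1) - ζ^(k + 1)`. -/
theorem dbarAt_telescope {η ζ : V → V [⋀^Fin 2]→ₗ[ℝ] A}
    {β : V → V [⋀^Fin 1]→ₗ[ℝ] A} {c : V} (hη : FormContDiffAt 1 η c) (hζ : FormContDiffAt 1 ζ c)
    (hβ : FormContDiffAt 1 β c) (hη' : dbarAt η c = 0) (hζ' : dbarAt ζ c = 0)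
    (hβ' : dbarAt β c = η c - ζ c) (k : ℕ) :
    dbarAt (fun z => telescope (η z) (ζ z) (β z) k) c =
      wedgePow (η c) (k + 1) - wedgePow (ζ c) (k + 1) := by
  induction k with
  | zero =>
    refine genFun_ext fun v => ?_
    rw [genFun_sub, genFun_wedgePow, genFun_wedgePow, pow_one, pow_one, ← genFun_sub, ← hβ']
    rfl
  | succ k ih =>
    refine genFun_ext fun v => ?_
    have h1 := (hη.telescope hζ hβ k).differentiableAt (by simp)
    have h2 := (hη.wedgePow (k + 1)).differentiableAt (by simp)
    have e1 := genFun_dbarAt_wedge h1 (hζ.differentiableAt (by simp)) v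
    have e2 := genFun_dbarAt_wedge h2 (hβ.differentiableAt (by simp)) v
    have e3 := dbarAt_add (((hη.telescope hζ hβ k).wedge hζ).differentiableAt (by simp))
      (((hη.wedgePow (k + 1)).wedge hβ).differentiableAt (by simp))
    refine (congrArg (genFun v) e3).trans ((genFun_add v _ _).trans ?_)
    refine (congrArg₂ (· + ·) e1 e2).trans ?_
    -- What is left is `(η^(k+1) - ζ^(k+1)) ζ + η^(k+1) (η - ζ)`; the even degree of `η^(k+1)`
    -- leaves no sign in the second term.
    rw [ih, hζ', hβ', dbarAt_wedgePow hη hη', genFun_sub, genFun_sub, genFun_sub, genFun_zero,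
      genFun_zero, genFun_wedgePow, genFun_wedgePow, genFun_wedgePow, genFun_wedgePow,
      (even_two_mul (k + 1)).neg_one_pow, one_smul]
    simp only [zero_mul, mul_zero, smul_zero, add_zero, zero_add, sub_mul, mul_sub, pow_succ,
      mul_assoc]
    abel

end LocalForms

/-! ### Differentials of holomorphic charts. -/

section Charts

variable {V : Type*} [NormedAddCommGroup V] [NormedSpace ℂ V] [FiniteDimensional ℂ V]
  {X : Type*} [TopologicalSpace X] [ChartedSpace V X] [IsManifold 𝓘(ℂ, V) ω X]

/-- A complex manifold is a real manifold. -/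
instance isManifold_real : IsManifold 𝓘(ℝ, V) ω X := by
  refine isManifold_of_contDiffOn _ _ _ fun e e' he he' => ?_
  have h : ContDiffOn ℂ ω (𝓘(ℂ, V) ∘ (e.symm ≫ₕ e') ∘ 𝓘(ℂ, V).symm)
      (𝓘(ℂ, V).symm ⁻¹' (e.symm ≫ₕ e').source ∩ Set.range 𝓘(ℂ, V)) :=
    (HasGroupoid.compatible (G := contDiffGroupoid ω 𝓘(ℂ, V)) he he').1
  exact h.restrict_scalars ℝ

theorem contMDiffAt_extChartAt_symm_of_mem {x : X} {z : V}
    (hz : z ∈ (extChartAt 𝓘(ℂ, V) x).target) :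
    ContMDiffAt 𝓘(ℂ, V) 𝓘(ℂ, V) ω (extChartAt 𝓘(ℂ, V) x).symm z :=
  (contMDiffOn_extChartAt_symm x).contMDiffAt ((isOpen_extChartAt_target x).mem_nhds hz)

theorem contMDiffAt_real_extChartAt_symm_of_mem {x : X} {z : V}
    (hz : z ∈ (extChartAt 𝓘(ℝ, V) x).target) :
    ContMDiffAt 𝓘(ℝ, V) 𝓘(ℝ, V) ω (extChartAt 𝓘(ℝ, V) x).symm z :=
  (contMDiffOn_extChartAt_symm x).contMDiffAt ((isOpen_extChartAt_target x).mem_nhds hz)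

/-- Transition maps are holomorphic. -/
theorem contDiffAt_transition {x y : X} {z : V} (hz : z ∈ (extChartAt 𝓘(ℂ, V) x).target)
    (hy : (extChartAt 𝓘(ℂ, V) x).symm z ∈ (chartAt V y).source) :
    ContDiffAt ℂ ω (extChartAt 𝓘(ℂ, V) y ∘ (extChartAt 𝓘(ℂ, V) x).symm) z :=
  contMDiffAt_iff_contDiffAt.1
    ((contMDiffAt_extChartAt' hy).comp z (contMDiffAt_extChartAt_symm_of_mem hz))

/-- The tangent space at a point is identified with `V` through the preferred chart at that point,
so the differential of an inverse chart is that of a transition map. -/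
theorem chartSymmDeriv_eq_fderiv {x : X} {z : V} (hz : z ∈ (extChartAt 𝓘(ℝ, V) x).target) :
    chartSymmDeriv x z = fderiv ℝ (extChartAt 𝓘(ℝ, V) ((extChartAt 𝓘(ℝ, V) x).symm z) ∘
      (extChartAt 𝓘(ℝ, V) x).symm) z := by
  have h : MDifferentiableAt 𝓘(ℝ, V) 𝓘(ℝ, V) (extChartAt 𝓘(ℝ, V) x).symm z :=
    (contMDiffAt_real_extChartAt_symm_of_mem hz).mdifferentiableAt (by simp)
  rw [chartSymmDeriv, h.mfderiv]
  simp [writtenInExtChartAt, fderivWithin_univ, chartAt_self_eq]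

/-- Transition maps are holomorphic. This is why passing to a chart preserves the types of forms. -/
theorem chartSymmDeriv_smul {x : X} {z : V} (hz : z ∈ (extChartAt 𝓘(ℝ, V) x).target) (c : ℂ)
    (v : V) : chartSymmDeriv x z (c • v) = c • chartSymmDeriv x z v := by
  have h := (contDiffAt_transition (x := x) (y := (extChartAt 𝓘(ℂ, V) x).symm z) hz
    (mem_chart_source V _)).differentiableAt (by simp)
  have e := h.fderiv_restrictScalars ℝ
  rw [chartSymmDeriv_eq_fderiv hz]
  have e' : fderiv ℝ (extChartAt 𝓘(ℝ, V) ((extChartAt 𝓘(ℝ, V) x).symm z) ∘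
      (extChartAt 𝓘(ℝ, V) x).symm) z = _ := e
  rw [e']
  exact (fderiv ℂ _ z).map_smul c v

theorem chartSymmDeriv_center (x : X) :
    chartSymmDeriv x (extChartAt 𝓘(ℝ, V) x x) = ContinuousLinearMap.id ℝ V := by
  rw [chartSymmDeriv_eq_fderiv (mem_extChartAt_target x), extChartAt_to_inv]
  have e : (extChartAt 𝓘(ℝ, V) x ∘ (extChartAt 𝓘(ℝ, V) x).symm) =ᶠ[𝓝 (extChartAt 𝓘(ℝ, V) x x)]
      id := by
    filter_upwards [extChartAt_target_mem_nhds (I := 𝓘(ℝ, V)) x] with z hz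
    exact (extChartAt 𝓘(ℝ, V) x).right_inv hz
  rw [e.fderiv_eq, fderiv_id]

theorem eventually_mem_target (x : X) :
    ∀ᶠ z in 𝓝 (extChartAt 𝓘(ℝ, V) x x), z ∈ (extChartAt 𝓘(ℝ, V) x).target :=
  extChartAt_target_mem_nhds x

/-- The chain rule for the differentials of inverse charts. -/
theorem chartSymmDeriv_transition {x y : X} {z : V} (hz : z ∈ (extChartAt 𝓘(ℝ, V) x).target)
    (hy : (extChartAt 𝓘(ℝ, V) x).symm z ∈ (chartAt V y).source) (w : V) :
    chartSymmDeriv y (extChartAt 𝓘(ℝ, V) y ((extChartAt 𝓘(ℝ, V) x).symm z))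
      (fderiv ℝ (extChartAt 𝓘(ℝ, V) y ∘ (extChartAt 𝓘(ℝ, V) x).symm) z w) =
        chartSymmDeriv x z w := by
  have h : MDifferentiableAt 𝓘(ℝ, V) 𝓘(ℝ, V)
      (extChartAt 𝓘(ℝ, V) y ∘ (extChartAt 𝓘(ℝ, V) x).symm) z :=
    ((contDiffAt_transition hz hy).restrict_scalars ℝ).differentiableAt (by simp)
      |>.mdifferentiableAt
  have h' : MDifferentiableAt 𝓘(ℝ, V) 𝓘(ℝ, V) (extChartAt 𝓘(ℝ, V) y).symm
      ((extChartAt 𝓘(ℝ, V) y ∘ (extChartAt 𝓘(ℝ, V) x).symm) z) :=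
    (contMDiffAt_real_extChartAt_symm_of_mem ((extChartAt 𝓘(ℝ, V) y).map_source
      (by rwa [extChartAt_source]))).mdifferentiableAt (by simp)
  have e : (extChartAt 𝓘(ℝ, V) x).symm =ᶠ[𝓝 z] (extChartAt 𝓘(ℝ, V) y).symm ∘
      (extChartAt 𝓘(ℝ, V) y ∘ (extChartAt 𝓘(ℝ, V) x).symm) := by
    filter_upwards [(continuousAt_extChartAt_symm'' hz).preimage_mem_nhds
      ((chartAt V y).open_source.mem_nhds hy)] with z' hz'
    exact ((extChartAt 𝓘(ℝ, V) y).left_inv (by rwa [extChartAt_source])).symm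
  have key := e.mfderiv_eq (I := 𝓘(ℝ, V)) (I' := 𝓘(ℝ, V))
  rw [mfderiv_comp z h' h, mfderiv_eq_fderiv] at key
  exact (congrArg (fun L : V →L[ℝ] V => L w) key).symm

/-- The differential of a function in a chart. -/
theorem fderiv_comp_extChartAt_symm {W : Type*} [NormedAddCommGroup W] [NormedSpace ℝ W]
    {x : X} {z : V} (hz : z ∈ (extChartAt 𝓘(ℝ, V) x).target) {u : X → W}
    (hu : MDifferentiableAt 𝓘(ℝ, V) 𝓘(ℝ, W) u ((extChartAt 𝓘(ℝ, V) x).symm z)) (w : V) :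
    fderiv ℝ (u ∘ (extChartAt 𝓘(ℝ, V) x).symm) z w =
      mfderiv 𝓘(ℝ, V) 𝓘(ℝ, W) u ((extChartAt 𝓘(ℝ, V) x).symm z) (chartSymmDeriv x z w) := by
  have h : MDifferentiableAt 𝓘(ℝ, V) 𝓘(ℝ, V) (extChartAt 𝓘(ℝ, V) x).symm z :=
    (contMDiffAt_real_extChartAt_symm_of_mem hz).mdifferentiableAt (by simp)
  rw [← mfderiv_eq_fderiv, mfderiv_comp z hu h]
  rfl

end Charts

/-! ### Holomorphic frames and connection forms. -/

section Frames

variable {V : Type*} [NormedAddCommGroup V] [NormedSpace ℂ V] [FiniteDimensional ℂ V]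
  {X : Type*} [TopologicalSpace X] [ChartedSpace V X] [IsManifold 𝓘(ℂ, V) ω X]
  {F : Type*} [NormedAddCommGroup F] [NormedSpace ℂ F] [FiniteDimensional ℂ F]
  {E : X → Type*} [TopologicalSpace (TotalSpace F E)]
  [∀ x, AddCommGroup (E x)] [∀ x, Module ℂ (E x)] [∀ x, TopologicalSpace (E x)]
  [∀ x, IsTopologicalAddGroup (E x)] [∀ x, ContinuousSMul ℂ (E x)]
  [FiberBundle F E] [VectorBundle ℂ F E]

theorem fibreCoord_fibreCoordSymm {x p : X} (hp : p ∈ (trivializationAt F E x).baseSet) (f : F) :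
    fibreCoord F x p (fibreCoordSymm (E := E) F x p f) = f :=
  (trivializationAt F E x).continuousLinearMapAt_symmL hp f

theorem fibreCoordSymm_fibreCoord {x p : X} (hp : p ∈ (trivializationAt F E x).baseSet) (e : E p) :
    fibreCoordSymm F x p (fibreCoord F x p e) = e :=
  (trivializationAt F E x).symmL_continuousLinearMapAt hp e

variable (F E) in
/-- The change of frame from the preferred trivialization at `x` to that at `y`. -/
def frameChange (x y p : X) : F →L[ℂ] F := fibreCoord (E := E) F y p ∘L fibreCoordSymm F x p

theorem frameChange_frameChange {x y p : X} (hx : p ∈ (trivializationAt F E x).baseSet)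
    (hy : p ∈ (trivializationAt F E y).baseSet) (f : F) :
    frameChange F E y x p (frameChange F E x y p f) = f := by
  simp only [frameChange, ContinuousLinearMap.comp_apply]
  rw [fibreCoordSymm_fibreCoord hy, fibreCoord_fibreCoordSymm hx]

theorem frameChange_mul_frameChange {x y p : X} (hx : p ∈ (trivializationAt F E x).baseSet)
    (hy : p ∈ (trivializationAt F E y).baseSet) :
    frameChange F E y x p * frameChange F E x y p = 1 :=
  ContinuousLinearMap.ext (frameChange_frameChange hx hy)

variable [ContMDiffVectorBundle ω F E 𝓘(ℂ, V)]

theorem contMDiffAt_frameChange {x y p : X} (hx : p ∈ (trivializationAt F E x).baseSet)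
    (hy : p ∈ (trivializationAt F E y).baseSet) :
    ContMDiffAt 𝓘(ℂ, V) 𝓘(ℂ, F →L[ℂ] F) ω (frameChange F E x y) p := by
  have ho : IsOpen ((trivializationAt F E x).baseSet ∩ (trivializationAt F E y).baseSet) :=
    (trivializationAt F E x).open_baseSet.inter (trivializationAt F E y).open_baseSet
  have h := (contMDiffOn_coordChangeL (n := ω) (IB := 𝓘(ℂ, V)) (trivializationAt F E x)
    (trivializationAt F E y)).contMDiffAt (ho.mem_nhds ⟨hx, hy⟩)
  refine h.congr_of_eventuallyEq ?_
  filter_upwards [ho.mem_nhds ⟨hx, hy⟩] with q hq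
  ext f
  rw [ContinuousLinearEquiv.coe_coe, Trivialization.coordChangeL_apply _ _ hq,
    ← Trivialization.symmL_apply (R := ℂ) _ hq.1]
  exact Trivialization.continuousLinearMapAt_apply_of_mem ℂ _ hq.2 (fibreCoordSymm F x q f)

theorem contMDiffAt_restrictScalars {W : Type*} [NormedAddCommGroup W] [NormedSpace ℂ W]
    {n : WithTop ℕ∞} {u : X → W} {p : X} (h : ContMDiffAt 𝓘(ℂ, V) 𝓘(ℂ, W) n u p) :
    ContMDiffAt 𝓘(ℝ, V) 𝓘(ℝ, W) n u p := by
  rw [contMDiffAt_iff] at h ⊢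
  exact ⟨h.1, h.2.restrict_scalars ℝ⟩

theorem contDiffAt_frameChange {x y x' : X} {z : V} (hz : z ∈ (extChartAt 𝓘(ℂ, V) x').target)
    (hx : (extChartAt 𝓘(ℂ, V) x').symm z ∈ (trivializationAt F E x).baseSet)
    (hy : (extChartAt 𝓘(ℂ, V) x').symm z ∈ (trivializationAt F E y).baseSet) :
    ContDiffAt ℂ ω (fun z => frameChange F E x y ((extChartAt 𝓘(ℂ, V) x').symm z)) z :=
  contMDiffAt_iff_contDiffAt.1
    ((contMDiffAt_frameChange hx hy).comp z (contMDiffAt_extChartAt_symm_of_mem hz))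

theorem mdifferentiableAt_frameChange {x y p : X} (hx : p ∈ (trivializationAt F E x).baseSet)
    (hy : p ∈ (trivializationAt F E y).baseSet) :
    MDifferentiableAt 𝓘(ℝ, V) 𝓘(ℝ, F →L[ℂ] F) (frameChange F E x y) p :=
  (contMDiffAt_restrictScalars (contMDiffAt_frameChange hx hy)).mdifferentiableAt (by simp)

theorem mdifferentiableAt_clm_apply {u : X → F} {g : X → F →L[ℂ] F} {p : X}
    (hg : MDifferentiableAt 𝓘(ℝ, V) 𝓘(ℝ, F →L[ℂ] F) g p)
    (hu : MDifferentiableAt 𝓘(ℝ, V) 𝓘(ℝ, F) u p) :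
    MDifferentiableAt 𝓘(ℝ, V) 𝓘(ℝ, F) (fun q => g q (u q)) p := by
  let L : (F →L[ℂ] F) →L[ℝ] (F →L[ℝ] F) := ContinuousLinearMap.restrictScalarsL ℂ F F ℝ ℝ
  have h : MDifferentiableAt 𝓘(ℝ, V) 𝓘(ℝ, F →L[ℝ] F) (fun q => L (g q)) p :=
    L.differentiable.differentiableAt.mdifferentiableAt.comp p hg
  exact h.clm_apply hu

/-- The frame of the preferred trivialization at `x` is smooth. -/
theorem mdifferentiableAt_frame {x p : X} (hp : p ∈ (trivializationAt F E x).baseSet) {u : X → F}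
    (hu : MDifferentiableAt 𝓘(ℝ, V) 𝓘(ℝ, F) u p) :
    MDifferentiableAt 𝓘(ℝ, V) (𝓘(ℝ, V).prod 𝓘(ℝ, F))
      (fun q => TotalSpace.mk' F q (fibreCoordSymm (E := E) F x q (u q))) p := by
  refine (mdifferentiableAt_section 𝓘(ℝ, V) _).2 ?_
  have hp' : p ∈ (trivializationAt F E p).baseSet := mem_baseSet_trivializationAt F E p
  refine (mdifferentiableAt_clm_apply (mdifferentiableAt_frameChange hp hp')
    hu).congr_of_eventuallyEq ?_
  filter_upwards [(trivializationAt F E p).open_baseSet.mem_nhds hp'] with q hq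
  exact (Trivialization.continuousLinearMapAt_apply_of_mem ℂ _ hq _).symm

/-- The connection form `A` at the point `p` in the frame `s` of the preferred trivialization at
`x`: `D (s f) = s (A f)` for constant `f`. -/
def frameForm (D : CovariantDerivative 𝓘(ℝ, V) F E) (x p : X) (v : V) (f : F) : F :=
  fibreCoord F x p (D (fun q => fibreCoordSymm F x q f) p v)

variable {D : CovariantDerivative 𝓘(ℝ, V) F E}

theorem mdifferentiableAt_frame_const {x p : X} (hp : p ∈ (trivializationAt F E x).baseSet) (f : F) :
    MDifferentiableAt 𝓘(ℝ, V) (𝓘(ℝ, V).prod 𝓘(ℝ, F))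
      (fun q => TotalSpace.mk' F q (fibreCoordSymm (E := E) F x q f)) p :=
  mdifferentiableAt_frame hp mdifferentiableAt_const

theorem frameForm_add {x p : X} (hp : p ∈ (trivializationAt F E x).baseSet) (v : V) (f f' : F) :
    frameForm D x p v (f + f') = frameForm D x p v f + frameForm D x p v f' := by
  have e : (fun q => fibreCoordSymm (E := E) F x q (f + f')) =
      (fun q => fibreCoordSymm F x q f) + fun q => fibreCoordSymm F x q f' :=
    funext fun q => map_add _ f f'
  rw [frameForm, e, D.isCovariantDerivativeOnUniv.add (mdifferentiableAt_frame_const hp f)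
    (mdifferentiableAt_frame_const hp f')]
  exact map_add (fibreCoord F x p) _ _

theorem frameForm_smul (hD : IsCompatible D) {x p : X}
    (hp : p ∈ (trivializationAt F E x).baseSet) (v : V) (c : ℂ) (f : F) :
    frameForm D x p v (c • f) = c • frameForm D x p v f := by
  have e : (fun q => fibreCoordSymm (E := E) F x q (c • f)) =
      (fun q => c • fibreCoordSymm F x q f) :=
    funext fun q => map_smul _ c f
  rw [frameForm, e, hD.smul c _ p (mdifferentiableAt_frame_const hp f)]
  exact map_smul (fibreCoord F x p) c _

/-- The differential of a vector valued function on `X`. -/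
def realDeriv {W : Type*} [NormedAddCommGroup W] [NormedSpace ℝ W] (u : X → W) (p : X) :
    V →L[ℝ] W :=
  mfderiv 𝓘(ℝ, V) 𝓘(ℝ, W) u p

theorem realDeriv_add {W : Type*} [NormedAddCommGroup W] [NormedSpace ℝ W] {u u' : X → W} {p : X}
    (hu : MDifferentiableAt 𝓘(ℝ, V) 𝓘(ℝ, W) u p)
    (hu' : MDifferentiableAt 𝓘(ℝ, V) 𝓘(ℝ, W) u' p) (v : V) :
    realDeriv (fun q => u q + u' q) p v = realDeriv u p v + realDeriv u' p v := by
  exact congrArg (fun L : V →L[ℝ] W => L v) (hu.hasMFDerivAt.add hu'.hasMFDerivAt).mfderiv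

theorem realDeriv_smul_const {W : Type*} [NormedAddCommGroup W] [NormedSpace ℝ W] {g : X → ℝ}
    {p : X} (hg : MDifferentiableAt 𝓘(ℝ, V) 𝓘(ℝ, ℝ) g p) (f : W) (v : V) :
    realDeriv (fun q => g q • f) p v = realDeriv g p v • f := by
  have h := (((ContinuousLinearMap.id ℝ ℝ).smulRight f).hasFDerivAt.hasMFDerivAt.comp p
    hg.hasMFDerivAt).mfderiv
  exact congrArg (fun L : V →L[ℝ] W => L v) h

/-- The covariant derivative of a section in a frame. -/
theorem fibreCoord_covariantDerivative (hD : IsCompatible D) {x p : X}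
    (hp : p ∈ (trivializationAt F E x).baseSet) {u : X → F}
    (hu : MDifferentiableAt 𝓘(ℝ, V) 𝓘(ℝ, F) u p) (v : V) :
    fibreCoord F x p (D (fun q => fibreCoordSymm F x q (u q)) p v) =
      realDeriv u p v + frameForm D x p v (u p) := by
  -- The covariant derivative satisfies the Leibniz rule for real functions, so `u` is expanded in a
  -- real basis of `F`. The formula is checked on sums and on products of a real function with a
  -- constant vector.
  let P (u : X → F) : Prop := MDifferentiableAt 𝓘(ℝ, V) 𝓘(ℝ, F) u p ∧
    fibreCoord F x p (D (fun q => fibreCoordSymm F x q (u q)) p v) =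
      realDeriv u p v + frameForm D x p v (u p)
  have hzero : P fun _ => 0 := by
    refine ⟨mdifferentiableAt_const, ?_⟩
    have : realDeriv (fun _ : X => (0 : F)) p v = 0 := by
      rw [realDeriv, mfderiv_const]; rfl
    rw [this, zero_add]
    rfl
  have hadd (u u' : X → F) (hu : P u) (hu' : P u') : P fun q => u q + u' q := by
    refine ⟨hu.1.add hu'.1, ?_⟩
    have e : (fun q => fibreCoordSymm (E := E) F x q (u q + u' q)) =
        (fun q => fibreCoordSymm F x q (u q)) + fun q => fibreCoordSymm F x q (u' q) :=
      funext fun q => map_add _ _ _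
    rw [e, D.isCovariantDerivativeOnUniv.add (mdifferentiableAt_frame hp hu.1)
      (mdifferentiableAt_frame hp hu'.1), realDeriv_add hu.1 hu'.1, frameForm_add hp,
      add_add_add_comm, ← hu.2, ← hu'.2]
    exact map_add (fibreCoord F x p) _ _
  have hsmul (g : X → ℝ) (hg : MDifferentiableAt 𝓘(ℝ, V) 𝓘(ℝ, ℝ) g p) (f : F) :
      P fun q => g q • f := by
    refine ⟨hg.smul mdifferentiableAt_const, ?_⟩
    have e : (fun q => fibreCoordSymm (E := E) F x q (g q • f)) =
        g • fun q => fibreCoordSymm F x q f :=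
      funext fun q => map_smul (fibreCoordSymm (E := E) F x q) (g q : ℂ) f
    rw [e, D.isCovariantDerivativeOnUniv.leibniz (mdifferentiableAt_frame_const hp f) hg,
      realDeriv_smul_const hg, add_comm]
    have e1 : frameForm D x p v (g p • f) = (g p : ℂ) • frameForm D x p v f :=
      frameForm_smul hD hp v (g p) f
    rw [e1]
    refine (map_add (fibreCoord F x p) _ _).trans ?_
    refine congrArg₂ (· + ·) ?_ (map_smul (fibreCoord F x p) (g p : ℂ) _)
    refine (map_smul (fibreCoord F x p) ((realDeriv g p v : ℝ) : ℂ) _).trans ?_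
    rw [fibreCoord_fibreCoordSymm hp]
    rfl
  let b := Module.finBasis ℝ F
  have hsum (s : Finset (Fin (Module.finrank ℝ F))) : P fun q => ∑ j ∈ s, b.repr (u q) j • b j := by
    induction s using Finset.induction_on with
    | empty => simpa using hzero
    | insert j s hj ih =>
      simp only [Finset.sum_insert hj]
      refine hadd _ _ (hsmul _ ?_ _) ih
      exact (b.coord j).toContinuousLinearMap.differentiable.differentiableAt.mdifferentiableAt.comp
        p hu
  have := hsum Finset.univ
  simp only [b.sum_repr] at this
  exact this.2

/-- The definition goes through a basis of `F`. Complex linearity of `f ↦ D (s f)` on constant `f`,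
which uses compatibility, makes the sum over the basis equal to the value at `f`. -/
theorem connectionForm_apply (hD : IsCompatible D) {x : X} {z : V}
    (hp : (extChartAt 𝓘(ℝ, V) x).symm z ∈ (trivializationAt F E x).baseSet) (w : V) (f : F) :
    connectionForm F 𝓘(ℝ, V) id D x z w f =
      frameForm D x ((extChartAt 𝓘(ℝ, V) x).symm z) (chartSymmDeriv x z w) f := by
  set b := Module.finBasis ℂ F
  let L : F →ₗ[ℂ] F :=
    { toFun := frameForm D x ((extChartAt 𝓘(ℝ, V) x).symm z) (chartSymmDeriv x z w)
      map_add' := frameForm_add hp _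
      map_smul' := frameForm_smul hD hp _ }
  have h : connectionForm F 𝓘(ℝ, V) id D x z w f = ∑ j, b.coord j f • L (b j) := by
    simp [connectionForm]
    rfl
  rw [h]
  change _ = L f
  conv_rhs => rw [← b.sum_repr f, map_sum]
  simp only [map_smul, Module.Basis.coord_apply]

/-- The change of the connection form under a change of frame. -/
theorem frameForm_frameChange (hD : IsCompatible D) {x y p : X}
    (hx : p ∈ (trivializationAt F E x).baseSet) (hy : p ∈ (trivializationAt F E y).baseSet)
    (v : V) (f : F) :
    frameForm D x p v f = frameChange F E y x p
      (realDeriv (fun q => frameChange F E x y q f) p v +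
        frameForm D y p v (frameChange F E x y p f)) := by
  have hu : MDifferentiableAt 𝓘(ℝ, V) 𝓘(ℝ, F) (fun q => frameChange F E x y q f) p :=
    mdifferentiableAt_clm_apply (mdifferentiableAt_frameChange hx hy) mdifferentiableAt_const
  rw [← fibreCoord_covariantDerivative hD hy hu, frameForm]
  have e : ∀ᶠ q in 𝓝 p, fibreCoordSymm (E := E) F x q f =
      fibreCoordSymm F y q (frameChange F E x y q f) := by
    filter_upwards [(trivializationAt F E y).open_baseSet.mem_nhds hy] with q hq
    exact (fibreCoordSymm_fibreCoord hq _).symm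
  rw [D.isCovariantDerivativeOnUniv.congr_of_eventuallyEq (mdifferentiableAt_frame_const hx f)
    (mdifferentiableAt_frame hy hu) Filter.univ_mem e, frameChange, ContinuousLinearMap.comp_apply,
    fibreCoordSymm_fibreCoord hy]

/-- The connection form of a compatible connection in a holomorphic frame is of type `(1, 0)`. -/
theorem frameForm_I_smul (hD : IsCompatible D) {x p : X}
    (hp : p ∈ (trivializationAt F E x).baseSet) (v : V) (f : F) :
    frameForm D x p (Complex.I • v) f = Complex.I • frameForm D x p v f := by
  have hp' : p ∈ (trivializationAt F E p).baseSet := mem_baseSet_trivializationAt F E p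
  have h := hD.zero_one_part _ p (mdifferentiableAt_frame_const hp f) v
  have hz : extChartAt 𝓘(ℂ, V) p p ∈ (extChartAt 𝓘(ℂ, V) p).target := mem_extChartAt_target p
  have hi : (extChartAt 𝓘(ℂ, V) p).symm (extChartAt 𝓘(ℂ, V) p p) = p := extChartAt_to_inv p
  have hd : DifferentiableAt ℂ
      (fun z => frameChange F E x p ((extChartAt 𝓘(ℂ, V) p).symm z) f)
      (extChartAt 𝓘(ℂ, V) p p) :=
    ((contDiffAt_frameChange (E := E) (x := x) (y := p) hz (by rwa [hi])
      (by rwa [hi])).differentiableAt (by simp)).clm_apply (differentiableAt_const f)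
  -- Read in the trivialization at `p`, the frame at `x` is a holomorphic function. Its real
  -- differential is therefore complex linear, and the antilinear part vanishes.
  have hI : dbarE F (fun q => fibreCoordSymm (E := E) F x q f) p v = 0 := by
    have e : fderiv ℝ (fun z => fibreCoord F p _ (fibreCoordSymm (E := E) F x
        ((extChartAt 𝓘(ℝ, V) p).symm z) f)) (extChartAt 𝓘(ℝ, V) p p) = _ :=
      hd.fderiv_restrictScalars ℝ
    simp only [dbarE]
    rw [e]
    simp [smul_smul]
  rw [hI] at h
  have h2 := (smul_eq_zero.1 h).resolve_left (by norm_num)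
  have h3 := congrArg (fibreCoord F x p) h2
  have h4 : frameForm D x p v f + Complex.I • frameForm D x p (Complex.I • v) f = 0 := by
    refine Eq.trans ?_ (h3.trans (map_zero _))
    exact ((map_add (fibreCoord F x p) _ _).trans
      (congrArg _ (map_smul (fibreCoord F x p) Complex.I _))).symm
  have h5 := congrArg (fun w => Complex.I • w) h4
  simp only [smul_add, smul_smul, Complex.I_mul_I, neg_one_smul, smul_zero] at h5
  exact (sub_eq_zero.1 ((sub_eq_add_neg _ _).trans h5)).symm

end Frames

/-! ### The curvature `dA + A ∧ A` and its behaviour under changes of frame and chart. -/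

section LocalCurvature

variable {H : Type*} [NormedAddCommGroup H] [NormedSpace ℝ H]
  {M : Type*} [NormedRing M] [NormedAlgebra ℝ M]

/-- A linear map as a 1-form. -/
def oneForm {T W : Type*} [AddCommGroup T] [Module ℝ T] [AddCommGroup W] [Module ℝ W]
    (L : T →ₗ[ℝ] W) : T [⋀^Fin 1]→ₗ[ℝ] W :=
  AlternatingMap.ofSubsingleton ℝ T W 0 L

/-- The curvature `dA + A ∧ A` of a connection form on a vector space. -/
def curvForm (A : H → H →L[ℝ] M) (z : H) : H [⋀^Fin 2]→ₗ[ℝ] M :=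
  let A' : H → H [⋀^Fin 1]→L[ℝ] M := fun z => ContinuousAlternatingMap.ofSubsingleton ℝ H M 0 (A z)
  (extDeriv A' z).toAlternatingMap + wedge (A' z).toAlternatingMap (A' z).toAlternatingMap

theorem wedge_apply_one_one {T A : Type*} [AddCommGroup T] [Module ℝ T] [Ring A] [Algebra ℝ A]
    (α β : T [⋀^Fin 1]→ₗ[ℝ] A) (v : Fin 2 → T) :
    wedge α β v = α (fun _ => v 0) * β (fun _ => v 1) - α (fun _ => v 1) * β (fun _ => v 0) := by
  have h := factorial_smul_wedge_apply α β v
  simp only [Nat.factorial_one, one_mul, one_smul] at h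
  rw [h]
  have e : (Finset.univ : Finset (Equiv.Perm (Fin 1 ⊕ Fin 1))) =
      {1, Equiv.swap (Sum.inl 0) (Sum.inr 0)} := by decide
  rw [e, Finset.sum_pair (by decide)]
  have e1 (σ : Equiv.Perm (Fin 1 ⊕ Fin 1)) (i : Fin 1) : σ (Sum.inl i) = σ (Sum.inl 0) := by
    rw [Subsingleton.elim i 0]
  have e2 (σ : Equiv.Perm (Fin 1 ⊕ Fin 1)) (i : Fin 1) : σ (Sum.inr i) = σ (Sum.inr 0) := by
    rw [Subsingleton.elim i 0]
  simp only [e1, e2]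
  simp [sub_eq_add_neg]
  rfl

theorem curvForm_apply {A : H → H →L[ℝ] M} {z : H} (hA : DifferentiableAt ℝ A z) (v : Fin 2 → H) :
    curvForm A z v = fderiv ℝ A z (v 0) (v 1) - fderiv ℝ A z (v 1) (v 0) +
      (A z (v 0) * A z (v 1) - A z (v 1) * A z (v 0)) := by
  let Φ := (ContinuousAlternatingMap.ofSubsingletonLIE (𝕜 := ℝ) (E := H) (F := M)
    (0 : Fin 1)).toContinuousLinearEquiv
  have h : DifferentiableAt ℝ
      (fun z => ContinuousAlternatingMap.ofSubsingleton ℝ H M (0 : Fin 1) (A z)) z :=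
    Φ.differentiable.differentiableAt.comp z hA
  have h2 (w : H) : fderiv ℝ (fun z => A z w) z = (fderiv ℝ A z).flip w := by
    rw [fderiv_clm_apply hA (differentiableAt_const w)]
    ext u
    simp
  rw [curvForm, AlternatingMap.add_apply, wedge_apply_one_one]
  congr 1
  refine (extDeriv_apply h v).trans ?_
  rw [Fin.sum_univ_two]
  simp [h2, Fin.removeNth, sub_eq_add_neg]
  rfl

/-- The curvature under a change of frame and coordinates. -/
theorem curvForm_gauge {A A' : H → H →L[ℝ] M} {g h : H → M} {σ : H → H} {z : H}
    (hA : DifferentiableAt ℝ A z) (hA' : DifferentiableAt ℝ A' (σ z))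
    (hg : ContDiffAt ℝ 2 g z) (hh : DifferentiableAt ℝ h z) (hσ : ContDiffAt ℝ 2 σ z)
    (hgh : ∀ᶠ y in 𝓝 z, h y * g y = 1) (hhg : g z * h z = 1)
    (e : ∀ᶠ y in 𝓝 z, ∀ w, A y w =
      h y * (fderiv ℝ g y w + A' (σ y) (fderiv ℝ σ y w) * g y)) (v : Fin 2 → H) :
    curvForm A z v = h z * curvForm A' (σ z) (fun i => fderiv ℝ σ z (v i)) * g z := by
  have hg1 : HasFDerivAt g (fderiv ℝ g z) z := (hg.differentiableAt (by simp)).hasFDerivAt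
  have hσ1 : HasFDerivAt σ (fderiv ℝ σ z) z := (hσ.differentiableAt (by simp)).hasFDerivAt
  have hg2 : HasFDerivAt (fderiv ℝ g) (fderiv ℝ (fderiv ℝ g) z) z :=
    ((hg.fderiv_right (m := 1) le_rfl).differentiableAt (by simp)).hasFDerivAt
  have hσ2 : HasFDerivAt (fderiv ℝ σ) (fderiv ℝ (fderiv ℝ σ) z) z :=
    ((hσ.fderiv_right (m := 1) le_rfl).differentiableAt (by simp)).hasFDerivAt
  have sg (u w : H) := (hg.isSymmSndFDerivAt (by simp)).eq u w
  have sσ (u w : H) := (hσ.isSymmSndFDerivAt (by simp)).eq u w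
  -- The derivative of an inverse: differentiate `h g = 1` and multiply by `h` from the right.
  have dh (u : H) : fderiv ℝ h z u = -(h z * fderiv ℝ g z u * h z) := by
    have h1 := (hh.hasFDerivAt.mul' hg1).congr_of_eventuallyEq
      (f₁ := fun _ => (1 : M)) (hgh.mono fun _ hy => hy.symm)
    have h2 := h1.unique (hasFDerivAt_const (1 : M) z)
    have h3 := congrArg (fun L : H →L[ℝ] M => L u * h z) h2
    simp [add_mul, mul_assoc, hhg] at h3
    rw [mul_assoc]
    exact eq_neg_of_add_eq_zero_right h3
  have key (u w : H) : fderiv ℝ A z u w =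
      fderiv ℝ h z u * (fderiv ℝ g z w + A' (σ z) (fderiv ℝ σ z w) * g z) +
      h z * (fderiv ℝ (fderiv ℝ g) z u w +
        ((fderiv ℝ A' (σ z) (fderiv ℝ σ z u) (fderiv ℝ σ z w) +
          A' (σ z) (fderiv ℝ (fderiv ℝ σ) z u w)) * g z +
          A' (σ z) (fderiv ℝ σ z w) * fderiv ℝ g z u)) := by
    have d1 : HasFDerivAt (fun y => A y w) ((fderiv ℝ A z).flip w) z := by
      simpa using hA.hasFDerivAt.clm_apply (hasFDerivAt_const w z)
    have d2 : HasFDerivAt (fun y => fderiv ℝ g y w) ((fderiv ℝ (fderiv ℝ g) z).flip w) z := by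
      simpa using hg2.clm_apply (hasFDerivAt_const w z)
    have d3 : HasFDerivAt (fun y => fderiv ℝ σ y w) ((fderiv ℝ (fderiv ℝ σ) z).flip w) z := by
      simpa using hσ2.clm_apply (hasFDerivAt_const w z)
    have d4 := (hA'.hasFDerivAt.comp z hσ1).clm_apply d3
    have d5 := hh.hasFDerivAt.mul' (d2.add (d4.mul' hg1))
    have d6 := d5.congr_of_eventuallyEq (f₁ := fun y => A y w) (e.mono fun y hy => hy w)
    have d7 := congrArg (fun L : H →L[ℝ] M => L u) (d1.unique d6)
    simp at d7
    rw [d7]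
    noncomm_ring
  -- The second derivatives of `g` and `σ` are symmetric, so they cancel when the two arguments are
  -- exchanged and subtracted. In the quadratic terms `g h = 1` removes the inner factors, after
  -- which the terms with `dg` cancel as well.
  rw [curvForm_apply hA, curvForm_apply hA', key, key, e.self_of_nhds, e.self_of_nhds, dh, dh,
    sg (v 1) (v 0), sσ (v 1) (v 0)]
  have prod (a P x : M) : h z * (a + P * g z) * (h z * x) = h z * a * h z * x + h z * P * x := by
    have : h z * (a + P * g z) * (h z * x) = h z * a * h z * x + h z * P * (g z * h z) * x := by
      noncomm_ring
    rw [this, hhg, mul_one]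
  rw [prod, prod]
  noncomm_ring
end LocalCurvature

/-! ### Compatibility of the wedge product with pull-backs and algebra homomorphisms. -/

section Multiplicative

variable {T T' A B : Type*} [AddCommGroup T] [Module ℝ T] [AddCommGroup T'] [Module ℝ T']
  [Ring A] [Algebra ℝ A] [Ring B] [Algebra ℝ B] {m n : ℕ}

/-- Pulling a form back only changes the family of vectors at which its generating function is
taken. -/
theorem wedge_compLinearMap (g : T →ₗ[ℝ] T') (α : T' [⋀^Fin m]→ₗ[ℝ] A) (β : T' [⋀^Fin n]→ₗ[ℝ] A) :
    wedge (α.compLinearMap g) (β.compLinearMap g) = (wedge α β).compLinearMap g :=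
  genFun_ext fun v => by
    rw [genFun_wedge]
    exact (genFun_wedge (g ∘ v) α β).symm

theorem wedgePow_compLinearMap (g : T →ₗ[ℝ] T') (α : T' [⋀^Fin 2]→ₗ[ℝ] A) (k : ℕ) :
    wedgePow (α.compLinearMap g) k = (wedgePow α k).compLinearMap g := by
  induction k with
  | zero => rfl
  | succ k ih => rw [wedgePow, ih, wedge_compLinearMap]; rfl

theorem wedge_compAlternatingMap (f : A →ₗ[ℝ] B) (hf : ∀ a b, f (a * b) = f a * f b)
    (α : T [⋀^Fin m]→ₗ[ℝ] A) (β : T [⋀^Fin n]→ₗ[ℝ] A) :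
    wedge (f.compAlternatingMap α) (f.compAlternatingMap β) = f.compAlternatingMap (wedge α β) := by
  ext v
  have h : ((m.factorial * n.factorial : ℕ) : ℝ) ≠ 0 :=
    Nat.cast_ne_zero.2 (Nat.mul_ne_zero m.factorial_ne_zero n.factorial_ne_zero)
  refine smul_right_injective _ h ?_
  simp only [Nat.cast_smul_eq_nsmul]
  rw [factorial_smul_wedge_apply, LinearMap.compAlternatingMap_apply, ← map_nsmul,
    factorial_smul_wedge_apply, map_sum]
  refine Finset.sum_congr rfl fun σ _ => ?_
  rw [Units.smul_def, Units.smul_def, map_zsmul, hf]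
  rfl

theorem wedgePow_compAlternatingMap (f : A →ₗ[ℝ] B) (hf : ∀ a b, f (a * b) = f a * f b)
    (h1 : f 1 = 1) (α : T [⋀^Fin 2]→ₗ[ℝ] A) (k : ℕ) :
    wedgePow (f.compAlternatingMap α) k = f.compAlternatingMap (wedgePow α k) := by
  induction k with
  | zero =>
    ext v
    exact h1.symm
  | succ k ih => rw [wedgePow, ih, wedge_compAlternatingMap f hf]; rfl

end Multiplicative

/-! ### Endomorphism valued forms in a chart and a frame. -/

section ChartForms

variable {V : Type*} [NormedAddCommGroup V] [NormedSpace ℂ V] [FiniteDimensional ℂ V]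
  {X : Type*} [TopologicalSpace X] [ChartedSpace V X]
  {F : Type*} [NormedAddCommGroup F] [NormedSpace ℂ F] [FiniteDimensional ℂ F]
  {E : X → Type*} [TopologicalSpace (TotalSpace F E)]
  [∀ x, AddCommGroup (E x)] [∀ x, Module ℂ (E x)] [∀ x, TopologicalSpace (E x)]
  [∀ x, IsTopologicalAddGroup (E x)] [∀ x, ContinuousSMul ℂ (E x)]
  [FiberBundle F E] [VectorBundle ℂ F E] {m n : ℕ}

variable (F E) in
/-- The points of the model space that correspond to points in the domain of the preferred
chart and of the preferred trivialization at `x`. -/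
def frameSet (x : X) : Set V :=
  (extChartAt 𝓘(ℝ, V) x).target ∩
    (extChartAt 𝓘(ℝ, V) x).symm ⁻¹' (trivializationAt F E x).baseSet

theorem isOpen_frameSet (x : X) : IsOpen (frameSet (V := V) F E x) :=
  (continuousOn_extChartAt_symm x).isOpen_inter_preimage (isOpen_extChartAt_target x)
    (trivializationAt F E x).open_baseSet

theorem center_mem_frameSet (x : X) : extChartAt 𝓘(ℝ, V) x x ∈ frameSet (V := V) F E x :=
  ⟨mem_extChartAt_target x, by
    rw [Set.mem_preimage, extChartAt_to_inv]; exact mem_baseSet_trivializationAt F E x⟩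

theorem eventually_mem_frameSet (x : X) :
    ∀ᶠ z in 𝓝 (extChartAt 𝓘(ℝ, V) x x), z ∈ frameSet (V := V) F E x :=
  (isOpen_frameSet x).mem_nhds (center_mem_frameSet x)

theorem endToModel_mul {x p : X} (hp : p ∈ (trivializationAt F E x).baseSet)
    (L L' : Module.End ℂ (E p)) :
    endToModel F x p (L * L') = endToModel F x p L * endToModel F x p L' := by
  ext f
  change fibreCoord F x p (L (L' (fibreCoordSymm F x p f))) =
    fibreCoord F x p (L (fibreCoordSymm F x p (fibreCoord F x p (L' (fibreCoordSymm F x p f)))))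
  rw [fibreCoordSymm_fibreCoord hp]

theorem endToModel_one {x p : X} (hp : p ∈ (trivializationAt F E x).baseSet) :
    endToModel F x p (1 : Module.End ℂ (E p)) = 1 := by
  ext f
  exact fibreCoord_fibreCoordSymm hp f

theorem endToModel_smul (x p : X) (c : ℂ) (L : Module.End ℂ (E p)) :
    endToModel F x p (c • L) = c • endToModel F x p L := by
  ext f
  exact map_smul (fibreCoord F x p) c _

theorem endOfModel_smul (x p : X) (c : ℂ) (L : F →L[ℂ] F) :
    endOfModel F x p (c • L) = c • endOfModel (E := E) F x p L := by
  ext e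
  exact map_smul (fibreCoordSymm F x p) c _

theorem endToModel_endOfModel (x y p : X) (L : F →L[ℂ] F) :
    endToModel F x p (endOfModel (E := E) F y p L) =
      frameChange F E y x p * L * frameChange F E x y p := rfl

theorem endToModel_endOfModel_self {x p : X} (hp : p ∈ (trivializationAt F E x).baseSet)
    (L : F →L[ℂ] F) : endToModel F x p (endOfModel (E := E) F x p L) = L := by
  ext f
  change fibreCoord F x p (fibreCoordSymm F x p (L (fibreCoord F x p (fibreCoordSymm F x p f)))) = _
  rw [fibreCoord_fibreCoordSymm hp, fibreCoord_fibreCoordSymm hp]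

theorem endOfModel_endToModel {x p : X} (hp : p ∈ (trivializationAt F E x).baseSet)
    (L : Module.End ℂ (E p)) : endOfModel F x p (endToModel F x p L) = L := by
  ext e
  change fibreCoordSymm F x p (fibreCoord F x p (L (fibreCoordSymm F x p (fibreCoord F x p e)))) = _
  rw [fibreCoordSymm_fibreCoord hp, fibreCoordSymm_fibreCoord hp]

/-- The trace on endomorphisms of the model fibre. -/
def modelTrace (F : Type*) [NormedAddCommGroup F] [NormedSpace ℂ F] : (F →L[ℂ] F) →ₗ[ℂ] ℂ :=
  LinearMap.trace ℂ F ∘ₗ ContinuousLinearMap.coeLM ℂ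

theorem modelTrace_mul_comm (L L' : F →L[ℂ] F) : modelTrace F (L * L') = modelTrace F (L' * L) :=
  LinearMap.trace_mul_comm ℂ (L : F →ₗ[ℂ] F) L'

/-- Over the domain of the trivialization the coordinate map is an isomorphism, and the trace is
invariant under conjugation. -/
theorem modelTrace_endToModel {x p : X} (hp : p ∈ (trivializationAt F E x).baseSet)
    (L : Module.End ℂ (E p)) : modelTrace F (endToModel F x p L) = LinearMap.trace ℂ (E p) L := by
  let e : E p ≃ₗ[ℂ] F :=
    { (fibreCoord F x p).toLinearMap with
      invFun := fibreCoordSymm F x p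
      left_inv := fibreCoordSymm_fibreCoord hp
      right_inv := fibreCoord_fibreCoordSymm hp }
  exact LinearMap.trace_conj' L e

/-- The expression of a form with values in `End E` in the preferred chart and trivialization. -/
def EndForm.chartForm (F : Type*) [NormedAddCommGroup F] [NormedSpace ℂ F] [FiniteDimensional ℂ F]
    [TopologicalSpace (TotalSpace F E)] [FiberBundle F E] [VectorBundle ℂ F E]
    (α : EndForm V E n) (x : X) (z : V) : V [⋀^Fin n]→ₗ[ℝ] (F →L[ℂ] F) :=
  (endToModel F x ((extChartAt 𝓘(ℝ, V) x).symm z)).compAlternatingMap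
    ((α ((extChartAt 𝓘(ℝ, V) x).symm z)).compLinearMap (chartSymmDeriv x z).toLinearMap)

theorem EndForm.chartForm_wedge (α : EndForm V E m) (β : EndForm V E n) {x : X} {z : V}
    (hz : z ∈ frameSet F E x) :
    EndForm.chartForm F (fun p => wedge (α p) (β p)) x z =
      wedge (α.chartForm F x z) (β.chartForm F x z) := by
  rw [chartForm, chartForm, chartForm, wedge_compAlternatingMap _ (endToModel_mul hz.2),
    wedge_compLinearMap]

theorem EndForm.chartForm_wedgePow (α : EndForm V E 2) (k : ℕ) {x : X} {z : V}
    (hz : z ∈ frameSet F E x) :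
    EndForm.chartForm F (fun p => wedgePow (α p) k) x z = wedgePow (α.chartForm F x z) k := by
  rw [chartForm, chartForm, wedgePow_compAlternatingMap _ (endToModel_mul hz.2)
    (endToModel_one hz.2), wedgePow_compLinearMap]

/-- The trace of a form with values in the endomorphisms of the model fibre. -/
def modelTraceForm {T : Type*} [AddCommGroup T] [Module ℝ T] (α : T [⋀^Fin n]→ₗ[ℝ] (F →L[ℂ] F)) :
    T [⋀^Fin n]→ₗ[ℝ] ℂ :=
  ((modelTrace F).restrictScalars ℝ).compAlternatingMap α

theorem EndForm.chartForm_center (α : EndForm V E n) (x : X)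
    [IsManifold 𝓘(ℂ, V) ω X] :
    α.chartForm F x (extChartAt 𝓘(ℝ, V) x x) = (endToModel F x x).compAlternatingMap (α x) := by
  rw [chartForm, chartSymmDeriv_center]
  have e : (extChartAt 𝓘(ℝ, V) x).symm (extChartAt 𝓘(ℝ, V) x x) = x := extChartAt_to_inv x
  exact congrArg (fun p => (endToModel F x p).compAlternatingMap (α p)) e

theorem EndForm.isOfType_chartForm [IsManifold 𝓘(ℂ, V) ω X] {p q : ℕ} {α : EndForm V E n}
    (hα : ∀ x, IsOfType p q (α x)) {x : X} {z : V} (hz : z ∈ frameSet F E x) :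
    IsOfType p q (α.chartForm F x z) :=
  ((hα _).compLinearMap _ (chartSymmDeriv_smul hz.1)).compAlternatingMap _ (endToModel_smul x _)

theorem EndForm.chartForm_typePart [IsManifold 𝓘(ℂ, V) ω X] {p q : ℕ} (α : EndForm V E n)
    {x : X} {z : V} (hz : z ∈ frameSet F E x) :
    EndForm.chartForm F (fun y => typePart p q (α y)) x z = typePart p q (α.chartForm F x z) := by
  rw [chartForm, chartForm, typePart_compAlternatingMap _ (endToModel_smul x _),
    typePart_compLinearMap _ (chartSymmDeriv_smul hz.1)]

end ChartForms

/-! ### Connection form and curvature in a fixed chart and frame near a point. -/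

section ConnectionInChart

variable {V : Type*} [NormedAddCommGroup V] [NormedSpace ℂ V] [FiniteDimensional ℂ V]
  {X : Type*} [TopologicalSpace X] [ChartedSpace V X] [IsManifold 𝓘(ℂ, V) ω X]
  {F : Type*} [NormedAddCommGroup F] [NormedSpace ℂ F] [FiniteDimensional ℂ F]
  {E : X → Type*} [TopologicalSpace (TotalSpace F E)]
  [∀ x, AddCommGroup (E x)] [∀ x, Module ℂ (E x)] [∀ x, TopologicalSpace (E x)]
  [∀ x, IsTopologicalAddGroup (E x)] [∀ x, ContinuousSMul ℂ (E x)]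
  [FiberBundle F E] [VectorBundle ℂ F E] [ContMDiffVectorBundle ω F E 𝓘(ℂ, V)]

/-- The connection form of a connection in the preferred chart and trivialization at `x`. -/
def connForm (D : CovariantDerivative 𝓘(ℝ, V) F E) (x : X) (z : V) : V →L[ℝ] (F →L[ℂ] F) :=
  connectionForm F 𝓘(ℝ, V) id D x z

variable {D D' : CovariantDerivative 𝓘(ℝ, V) F E}

theorem connForm_apply (hD : IsCompatible D) {x : X} {z : V} (hz : z ∈ frameSet F E x)
    (w : V) (f : F) :
    connForm D x z w f =
      frameForm D x ((extChartAt 𝓘(ℝ, V) x).symm z) (chartSymmDeriv x z w) f :=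
  connectionForm_apply hD hz.2 w f

theorem eventually_differentiableAt_connForm (hD : IsCompatible D) (x : X) :
    ∀ᶠ z in 𝓝 (extChartAt 𝓘(ℝ, V) x x), DifferentiableAt ℝ (connForm D x) z :=
  (((hD.smooth x).of_le (m := 1) (by simp)).eventually (by simp)).mono
    fun _ h => h.differentiableAt (by simp)

theorem isOfType_oneForm_connForm (hD : IsCompatible D) {x : X} {z : V}
    (hz : z ∈ frameSet F E x) : IsOfType 1 0 (oneForm (connForm D x z : V →ₗ[ℝ] F →L[ℂ] F)) := by
  have hI (w : V) : connForm D x z (Complex.I • w) = Complex.I • connForm D x z w := by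
    ext f
    rw [connForm_apply hD hz, chartSymmDeriv_smul hz.1, frameForm_I_smul hD hz.2,
      ← connForm_apply hD hz]
    rfl
  intro c v
  have h := real_linear_apply_smul (connForm D x z : V →ₗ[ℝ] F →L[ℂ] F) c (v 0)
  have h1 : c = (c.re : ℂ) + c.im * Complex.I := (Complex.re_add_im c).symm
  refine h.trans ?_
  rw [ContinuousLinearMap.coe_coe, hI]
  conv_rhs => rw [pow_one, pow_zero, mul_one, h1, add_smul, mul_smul]
  rfl

/-- The change of the connection form under a change of frame and chart. -/
theorem connForm_transition (hD : IsCompatible D) {x y : X} {z : V} (hz : z ∈ frameSet F E x)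
    (hy : (extChartAt 𝓘(ℝ, V) x).symm z ∈ (chartAt V y).source)
    (hy' : (extChartAt 𝓘(ℝ, V) x).symm z ∈ (trivializationAt F E y).baseSet) (w : V) :
    connForm D x z w = frameChange F E y x ((extChartAt 𝓘(ℝ, V) x).symm z) *
      (fderiv ℝ (fun z => frameChange F E x y ((extChartAt 𝓘(ℝ, V) x).symm z)) z w +
        connForm D y (extChartAt 𝓘(ℝ, V) y ((extChartAt 𝓘(ℝ, V) x).symm z))
          (fderiv ℝ (extChartAt 𝓘(ℝ, V) y ∘ (extChartAt 𝓘(ℝ, V) x).symm) z w) *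
        frameChange F E x y ((extChartAt 𝓘(ℝ, V) x).symm z)) := by
  have hs : (extChartAt 𝓘(ℝ, V) x).symm z ∈ (extChartAt 𝓘(ℝ, V) y).source := by
    rwa [extChartAt_source]
  have hi := (extChartAt 𝓘(ℝ, V) y).left_inv hs
  have hz' : extChartAt 𝓘(ℝ, V) y ((extChartAt 𝓘(ℝ, V) x).symm z) ∈ frameSet F E y :=
    ⟨(extChartAt 𝓘(ℝ, V) y).map_source hs, by rwa [Set.mem_preimage, hi]⟩
  ext f
  have hu : MDifferentiableAt 𝓘(ℝ, V) 𝓘(ℝ, F) (fun q => frameChange F E x y q f)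
      ((extChartAt 𝓘(ℝ, V) x).symm z) :=
    mdifferentiableAt_clm_apply (mdifferentiableAt_frameChange hz.2 hy') mdifferentiableAt_const
  have hg : DifferentiableAt ℝ (fun z => frameChange F E x y ((extChartAt 𝓘(ℝ, V) x).symm z)) z := by
    have h : ContDiffAt ℂ ω (fun z => frameChange F E x y ((extChartAt 𝓘(ℂ, V) x).symm z)) z :=
      contDiffAt_frameChange hz.1 hz.2 hy'
    exact (h.restrict_scalars ℝ).differentiableAt (by simp)
  have hd : fderiv ℝ (fun z => frameChange F E x y ((extChartAt 𝓘(ℝ, V) x).symm z) f) z w =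
      fderiv ℝ (fun z => frameChange F E x y ((extChartAt 𝓘(ℝ, V) x).symm z)) z w f := by
    let ev : (F →L[ℂ] F) →L[ℝ] F := (ContinuousLinearMap.apply ℂ F f).restrictScalars ℝ
    exact congrArg (fun L : V →L[ℝ] F => L w) (ev.hasFDerivAt.comp z hg.hasFDerivAt).fderiv
  rw [connForm_apply hD hz, frameForm_frameChange hD hz.2 hy']
  have e1 := fderiv_comp_extChartAt_symm hz.1 hu w
  have e2 := connForm_apply hD hz'
    (fderiv ℝ (extChartAt 𝓘(ℝ, V) y ∘ (extChartAt 𝓘(ℝ, V) x).symm) z w)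
    (frameChange F E x y ((extChartAt 𝓘(ℝ, V) x).symm z) f)
  rw [chartSymmDeriv_transition hz.1 hy, hi] at e2
  simp only [ContinuousLinearMap.mul_def,
    ContinuousLinearMap.comp_apply, add_apply]
  rw [e2, ← hd]
  exact congrArg (fun t => frameChange F E y x ((extChartAt 𝓘(ℝ, V) x).symm z)
    (t + _)) e1.symm

/-- The curvature as a form with values in `End E`. -/
def curvatureForm (D : CovariantDerivative 𝓘(ℝ, V) F E) : EndForm V E 2 :=
  fun x => curvature F 𝓘(ℝ, V) id D x

/-- At the point `p` over `z` the curvature is computed in the chart and frame at `p`. The gauge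
law, with `g` the change of frame from `x` to `p` and `σ` the transition map, brings it to the chart
and frame at `x`. Thus a family of pointwise definitions becomes one expression that can be
differentiated. -/
theorem chartForm_curvatureForm (hD : IsCompatible D) {x : X} {z : V}
    (hz : z ∈ frameSet F E x) (hA : DifferentiableAt ℝ (connForm D x) z) :
    (curvatureForm D).chartForm F x z = curvForm (connForm D x) z := by
  set p := (extChartAt 𝓘(ℝ, V) x).symm z with hp
  have hpc : p ∈ (chartAt V p).source := mem_chart_source V p
  have hpb : p ∈ (trivializationAt F E p).baseSet := mem_baseSet_trivializationAt F E p
  have hev : ∀ᶠ y in 𝓝 z, y ∈ frameSet F E x ∧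
      (extChartAt 𝓘(ℝ, V) x).symm y ∈ (chartAt V p).source ∧
      (extChartAt 𝓘(ℝ, V) x).symm y ∈ (trivializationAt F E p).baseSet := by
    have hc := continuousAt_extChartAt_symm'' hz.1
    filter_upwards [(isOpen_frameSet x).mem_nhds hz,
      hc.preimage_mem_nhds ((chartAt V p).open_source.mem_nhds hpc),
      hc.preimage_mem_nhds ((trivializationAt F E p).open_baseSet.mem_nhds hpb)]
      with y h1 h2 h3 using ⟨h1, h2, h3⟩
  have hg := (contDiffAt_frameChange (V := V) (E := E) (y := p) hz.1 hz.2 hpb).restrict_scalars ℝ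
  have hh := (contDiffAt_frameChange (V := V) (E := E) (x := p) hz.1 hpb hz.2).restrict_scalars ℝ
  have key (v : Fin 2 → V) := curvForm_gauge (A := connForm D x) (A' := connForm D p)
    (g := fun y => frameChange F E x p ((extChartAt 𝓘(ℝ, V) x).symm y))
    (h := fun y => frameChange F E p x ((extChartAt 𝓘(ℝ, V) x).symm y))
    (σ := extChartAt 𝓘(ℝ, V) p ∘ (extChartAt 𝓘(ℝ, V) x).symm) (z := z) hA
    (eventually_differentiableAt_connForm hD p).self_of_nhds (hg.of_le (by simp))
    (hh.differentiableAt (by simp))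
    (((contDiffAt_transition hz.1 hpc).restrict_scalars ℝ).of_le (by simp))
    (hev.mono fun y hy => frameChange_mul_frameChange hy.1.2 hy.2.2)
    (frameChange_mul_frameChange hpb hz.2)
    (hev.mono fun y hy w => connForm_transition hD hy.1 hy.2.1 hy.2.2 w) v
  ext1 v
  rw [key]
  refine (endToModel_endOfModel x p p _).trans ?_
  rw [← chartSymmDeriv_eq_fderiv hz.1]
  rfl

end ConnectionInChart

/-! ### Scalar forms given by local expressions. -/

section ScalarForms

variable {V : Type*} [NormedAddCommGroup V] [NormedSpace ℂ V] [FiniteDimensional ℂ V]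
  {X : Type*} [TopologicalSpace X] [ChartedSpace V X] [IsManifold 𝓘(ℂ, V) ω X] {p q n : ℕ}

theorem Form.toAlternatingMap_inChart_center (η : Form V X n) (x : X) :
    (η.inChart x (extChartAt 𝓘(ℝ, V) x x)).toAlternatingMap = η x := by
  rw [Form.inChart, chartSymmDeriv_center, extChartAt_to_inv]
  rfl

/-- The form `η` on `X` is smooth of type `(p, q)` and is given near each point `x` by `ζ x` in the
preferred chart at `x`. -/
structure IsLocalExpr (p q : ℕ) (η : Form V X n) (ζ : X → V → V [⋀^Fin n]→ₗ[ℝ] ℂ) : Prop where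
  type : ∀ x, IsOfType p q (η x)
  eventually_eq : ∀ x, ∀ᶠ z in 𝓝 (extChartAt 𝓘(ℝ, V) x x), η.inChart x z = toCont (ζ x z)
  smooth : ∀ x, FormContDiffAt ∞ (ζ x) (extChartAt 𝓘(ℝ, V) x x)

theorem IsLocalExpr.eq_center {η : Form V X n} {ζ : X → V → V [⋀^Fin n]→ₗ[ℝ] ℂ}
    (h : IsLocalExpr p q η ζ) (x : X) : η x = ζ x (extChartAt 𝓘(ℝ, V) x x) := by
  rw [← Form.toAlternatingMap_inChart_center η x, (h.eventually_eq x).self_of_nhds]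
  rfl

theorem IsLocalExpr.isSmooth {η : Form V X n} {ζ : X → V → V [⋀^Fin n]→ₗ[ℝ] ℂ}
    (h : IsLocalExpr p q η ζ) : η.IsSmooth :=
  fun x => ContDiffAt.congr_of_eventuallyEq (h.smooth x) (h.eventually_eq x)

/-- Inverse charts have complex linear differentials, so the local expression inherits the type of
`η` near the centre. There the projected exterior derivative is the explicit `∂̄`. -/
theorem IsLocalExpr.dbar_apply {η : Form V X (p + q)} {ζ : X → V → V [⋀^Fin (p + q)]→ₗ[ℝ] ℂ}
    (h : IsLocalExpr p q η ζ) (x : X) :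
    dbar p q η x = dbarAt (ζ x) (extChartAt 𝓘(ℝ, V) x x) := by
  have hty : ∀ᶠ z in 𝓝 (extChartAt 𝓘(ℝ, V) x x), IsOfType p q (ζ x z) := by
    filter_upwards [h.eventually_eq x, eventually_mem_target x] with z hz hz'
    have e : ζ x z = (η ((extChartAt 𝓘(ℝ, V) x).symm z)).compLinearMap
        (chartSymmDeriv x z).toLinearMap := (congrArg (·.toAlternatingMap) hz).symm
    rw [e]
    exact (h.type _).compLinearMap _ (chartSymmDeriv_smul hz')
  have he : η.inChart x =ᶠ[𝓝 (extChartAt 𝓘(ℝ, V) x x)] fun z => toCont (ζ x z) :=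
    h.eventually_eq x
  rw [dbar, Form.extDeriv, he.extDeriv_eq]
  exact typePart_extDeriv hty ((h.smooth x).differentiableAt (by simp)) rfl

theorem IsLocalExpr.mem_closedForms {η : Form V X n} {ζ : X → V → V [⋀^Fin n]→ₗ[ℝ] ℂ}
    (h : IsLocalExpr p q η ζ) (e : n = p + q)
    (hd : ∀ x, dbarAt (ζ x) (extChartAt 𝓘(ℝ, V) x x) = 0) :
    (fun x => (η x).domDomCongr (finCongr e)) ∈ closedForms V X p q := by
  subst e
  exact ⟨⟨h.isSmooth, h.type⟩, funext fun x => (h.dbar_apply x).trans (hd x)⟩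

theorem IsLocalExpr.mem_exactForms {β : Form V X n} {ζ : X → V → V [⋀^Fin n]→ₗ[ℝ] ℂ}
    (h : IsLocalExpr p q β ζ) (e : n = p + q) {η : Form V X (p + (q + 1))}
    (hη : η ∈ smoothForms V X p (q + 1)) (e' : n + 1 = p + (q + 1))
    (hd : ∀ x, η x = (dbarAt (ζ x) (extChartAt 𝓘(ℝ, V) x x)).domDomCongr (finCongr e')) :
    η ∈ exactForms V X p (q + 1) := by
  subst e
  exact ⟨hη, β, ⟨h.isSmooth, h.type⟩, funext fun x => (hd x).trans (h.dbar_apply x).symm⟩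

end ScalarForms

/-! ### The (1,1)-part of the curvature is `∂̄A`. -/

section LocalHiggs

variable {V : Type*} [NormedAddCommGroup V] [NormedSpace ℂ V] [FiniteDimensional ℂ V]
  {X : Type*} [TopologicalSpace X] [ChartedSpace V X] [IsManifold 𝓘(ℂ, V) ω X]
  {F : Type*} [NormedAddCommGroup F] [NormedSpace ℂ F] [FiniteDimensional ℂ F]
  {E : X → Type*} [TopologicalSpace (TotalSpace F E)]
  [∀ x, AddCommGroup (E x)] [∀ x, Module ℂ (E x)] [∀ x, TopologicalSpace (E x)]
  [∀ x, IsTopologicalAddGroup (E x)] [∀ x, ContinuousSMul ℂ (E x)]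
  [FiberBundle F E] [VectorBundle ℂ F E] [ContMDiffVectorBundle ω F E 𝓘(ℂ, V)]
  {D D' : CovariantDerivative 𝓘(ℝ, V) F E} {θ : EndForm V E 1}

theorem formContDiffAt_oneForm {W : Type*} [NormedAddCommGroup W] [NormedSpace ℂ W]
    {r : WithTop ℕ∞} {A : V → V →L[ℝ] W} {c : V} (h : ContDiffAt ℝ r A c) :
    FormContDiffAt r (fun z => oneForm (A z : V →ₗ[ℝ] W)) c := by
  let Φ := (ContinuousAlternatingMap.ofSubsingletonLIE (𝕜 := ℝ) (E := V) (F := W)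
    (0 : Fin 1)).toContinuousLinearEquiv
  exact Φ.contDiff.contDiffAt.comp c h

theorem FormContDiffAt.of_le {W : Type*} [NormedAddCommGroup W] [NormedSpace ℂ W]
    [FiniteDimensional ℂ W] {r s : WithTop ℕ∞} {n : ℕ} {η : V → V [⋀^Fin n]→ₗ[ℝ] W} {c : V}
    (h : FormContDiffAt r η c) (hs : s ≤ r) : FormContDiffAt s η c :=
  ContDiffAt.of_le h hs

theorem FormContDiffAt.eventually_differentiableAt {W : Type*} [NormedAddCommGroup W]
    [NormedSpace ℂ W] [FiniteDimensional ℂ W] {n : ℕ} {η : V → V [⋀^Fin n]→ₗ[ℝ] W} {c : V}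
    (h : FormContDiffAt 1 η c) : ∀ᶠ z in 𝓝 c, DifferentiableAt ℝ (fun z => toCont (η z)) z :=
  (ContDiffAt.eventually h (by simp)).mono fun _ hz => hz.differentiableAt (by simp)

/-- The connection form as a 1-form with values in the endomorphisms of the model fibre. -/
def connOneForm (D : CovariantDerivative 𝓘(ℝ, V) F E) (x : X) (z : V) :
    V [⋀^Fin 1]→ₗ[ℝ] (F →L[ℂ] F) :=
  oneForm (connForm D x z : V →ₗ[ℝ] F →L[ℂ] F)

theorem formContDiffAt_connOneForm (hD : IsCompatible D) (x : X) :
    FormContDiffAt ∞ (connOneForm D x) (extChartAt 𝓘(ℝ, V) x x) := by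
  exact formContDiffAt_oneForm (hD.smooth x)

theorem dbarAt_sub {W : Type*} [NormedAddCommGroup W] [NormedSpace ℂ W] [FiniteDimensional ℂ W]
    {n : ℕ} {η ζ : V → V [⋀^Fin n]→ₗ[ℝ] W} {c : V}
    (hη : FormContDiffAt 1 η c) (hζ : FormContDiffAt 1 ζ c) :
    dbarAt (fun z => η z - ζ z) c = dbarAt η c - dbarAt ζ c := by
  rw [eq_sub_iff_add_eq, ← dbarAt_add ((hη.sub hζ).differentiableAt (by simp))
    (hζ.differentiableAt (by simp))]
  simp only [sub_add_cancel]

theorem dbarAt_smul {W : Type*} [NormedAddCommGroup W] [NormedSpace ℂ W] [FiniteDimensional ℂ W]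
    {n : ℕ} (r : ℂ) {η : V → V [⋀^Fin n]→ₗ[ℝ] W} {c : V} (hη : FormContDiffAt 1 η c) :
    dbarAt (fun z => r • η z) c = r • dbarAt η c := by
  have h := dbarAt_compAlternatingMap (r • (LinearMap.id : W →ₗ[ℂ] W))
    (hη.differentiableAt (by simp))
  exact h

/-- The difference between the curvature of a connection form of type `(1, 0)` and its
`(1, 1)`-part. -/
theorem isOfType_curvForm_sub_dbarAt {A : V → V →L[ℝ] (F →L[ℂ] F)} {z : V}
    (h : ∀ᶠ y in 𝓝 z, IsOfType 1 0 (oneForm (A y : V →ₗ[ℝ] F →L[ℂ] F)))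
    (hd : DifferentiableAt ℝ (fun y => toCont (oneForm (A y : V →ₗ[ℝ] F →L[ℂ] F))) z) :
    IsOfType 1 1 (dbarAt (fun y => oneForm (A y : V →ₗ[ℝ] F →L[ℂ] F)) z) ∧
      IsOfType 2 0 (curvForm A z - dbarAt (fun y => oneForm (A y : V →ₗ[ℝ] F →L[ℂ] F)) z) := by
  have h4 := isOfType_formDeriv h hd
  refine ⟨isOfType_dbarAlt h4, ?_⟩
  have e : curvForm A z - dbarAt (fun y => oneForm (A y : V →ₗ[ℝ] F →L[ℂ] F)) z =
      (AlternatingMap.alternatizeUncurryFin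
          (formDeriv (fun y => oneForm (A y : V →ₗ[ℝ] F →L[ℂ] F)) z) -
        dbarAlt (formDeriv (fun y => oneForm (A y : V →ₗ[ℝ] F →L[ℂ] F)) z)) +
      wedge (oneForm (A z : V →ₗ[ℝ] F →L[ℂ] F)) (oneForm (A z : V →ₗ[ℝ] F →L[ℂ] F)) := by
    rw [← toAlternatingMap_extDeriv]
    exact add_sub_right_comm _ _ _
  rw [e]
  exact (isOfType_alternatize_sub_dbarAlt h4).add (h.self_of_nhds.wedge h.self_of_nhds)

theorem curvForm_sub_dbarAt_mem (hD : IsCompatible D) (x : X) :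
    ∀ᶠ z in 𝓝 (extChartAt 𝓘(ℝ, V) x x), IsOfType 1 1 (dbarAt (connOneForm D x) z) ∧
      IsOfType 2 0 (curvForm (connForm D x) z - dbarAt (connOneForm D x) z) := by
  have hf : ∀ᶠ z in 𝓝 (extChartAt 𝓘(ℝ, V) x x), IsOfType 1 0 (connOneForm D x z) :=
    (eventually_mem_frameSet (F := F) (E := E) x).mono fun z hz => isOfType_oneForm_connForm hD hz
  have hs : ∀ᶠ z in 𝓝 (extChartAt 𝓘(ℝ, V) x x),
      DifferentiableAt ℝ (fun z => toCont (connOneForm D x z)) z :=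
    ((formContDiffAt_connOneForm hD x).of_le (by simp)).eventually_differentiableAt
  filter_upwards [hf.eventually_nhds, hs] with z h2 h3
  exact isOfType_curvForm_sub_dbarAt h2 h3

/-- The connection form `A` is of type (1,0), so `dA + A ∧ A` differs from `∂̄A` by a form of type
(2,0), which the projection kills. -/
theorem chartForm_curvature11 (hD : IsCompatible D) (x : X) :
    ∀ᶠ z in 𝓝 (extChartAt 𝓘(ℝ, V) x x),
      (curvature11 D).chartForm F x z = dbarAt (connOneForm D x) z := by
  filter_upwards [eventually_mem_frameSet (F := F) (E := E) x, eventually_differentiableAt_connForm hD x,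
    curvForm_sub_dbarAt_mem hD x] with z hz hA h
  refine (EndForm.chartForm_typePart (curvatureForm D) hz).trans ?_
  rw [chartForm_curvatureForm hD hz hA, ← sub_add_cancel (curvForm (connForm D x) z)
    (dbarAt (connOneForm D x) z), typePart_add, typePart_of_isOfType (p := 1) (q := 1) (p' := 2) (q' := 0) rfl rfl h.2,
    typePart_of_isOfType rfl rfl h.1]
  simp

/-- The type is read off from `∂̄A` at the centre of the chart and carried back to the fibre by the
frame. -/
theorem isOfType_curvature11 (hD : IsCompatible D) (x : X) : IsOfType 1 1 (curvature11 D x) := by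
  have hb : x ∈ (trivializationAt F E x).baseSet := mem_baseSet_trivializationAt F E x
  have h := (chartForm_curvature11 hD x).self_of_nhds
  rw [EndForm.chartForm_center] at h
  have e : curvature11 D x = (endOfModel F x x).compAlternatingMap
      ((endToModel F x x).compAlternatingMap (curvature11 D x)) := by
    ext1 v
    exact (endOfModel_endToModel hb _).symm
  rw [e, h]
  exact (curvForm_sub_dbarAt_mem hD x).self_of_nhds.1.compAlternatingMap _ (endOfModel_smul x x)

theorem formContDiffAt_dbarAt_connOneForm (hD : IsCompatible D) (x : X) :
    FormContDiffAt ∞ (dbarAt (connOneForm D x)) (extChartAt 𝓘(ℝ, V) x x) :=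
  FormContDiffAt.dbarAt (r := ∞) (s := ∞) (formContDiffAt_connOneForm hD x) le_rfl

/-- The Bianchi identity for the (1,1)-part of the curvature, which locally is `∂̄A`. -/
theorem dbarAt_dbarAt_connOneForm (hD : IsCompatible D) (x : X) :
    dbarAt (dbarAt (connOneForm D x)) (extChartAt 𝓘(ℝ, V) x x) = 0 :=
  dbarAt_dbarAt (p := 1) (q := 0)
    ((eventually_mem_frameSet (F := F) (E := E) x).mono fun _ hz => isOfType_oneForm_connForm hD hz)
    (FormContDiffAt.of_le (r := ∞) (formContDiffAt_connOneForm hD x) (ENat.LEInfty.out)) rfl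

theorem dbarAt_chartForm_higgsField (hθ : IsHiggsField F θ) (x : X) :
    dbarAt (θ.chartForm F x) (extChartAt 𝓘(ℝ, V) x x) = 0 := by
  rw [← hθ.holomorphic x]
  exact (typePart_extDeriv (p := 1) (q := 0) ((eventually_mem_frameSet (F := F) (E := E) x).mono fun _ hz =>
    EndForm.isOfType_chartForm hθ.type_one_zero hz)
    (FormContDiffAt.differentiableAt (hθ.smooth x) (by simp)) rfl).symm

end LocalHiggs

/-! ### The Dolbeault class of `ah_k`: closedness and independence of the connection. -/

section HiggsClass

variable {V : Type*} [NormedAddCommGroup V] [NormedSpace ℂ V] [FiniteDimensional ℂ V]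
  {X : Type*} [TopologicalSpace X] [ChartedSpace V X] [IsManifold 𝓘(ℂ, V) ω X]
  {F : Type*} [NormedAddCommGroup F] [NormedSpace ℂ F] [FiniteDimensional ℂ F]
  {E : X → Type*} [TopologicalSpace (TotalSpace F E)]
  [∀ x, AddCommGroup (E x)] [∀ x, Module ℂ (E x)] [∀ x, TopologicalSpace (E x)]
  [∀ x, IsTopologicalAddGroup (E x)] [∀ x, ContinuousSMul ℂ (E x)]
  [FiberBundle F E] [VectorBundle ℂ F E]
  {D D' : CovariantDerivative 𝓘(ℝ, V) F E} {θ : EndForm V E 1} {p q n : ℕ}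

/-- The trace is invariant under conjugation, so it may be taken of the matrix of `α` in the frame;
smoothness passes through because the trace is a linear operator on forms. -/
theorem isLocalExpr_trForm {α : EndForm V E n} {ζ : X → V → V [⋀^Fin n]→ₗ[ℝ] (F →L[ℂ] F)}
    (hα : ∀ x, IsOfType p q (α x))
    (h : ∀ x, ∀ᶠ z in 𝓝 (extChartAt 𝓘(ℝ, V) x x), α.chartForm F x z = ζ x z)
    (hs : ∀ x, FormContDiffAt ∞ (ζ x) (extChartAt 𝓘(ℝ, V) x x)) (c : ℂ) :
    IsLocalExpr p q (fun x => c • trForm (α x)) (fun x z => c • modelTraceForm (ζ x z)) where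
  type x := ((hα x).compAlternatingMap ((LinearMap.trace ℂ (E x)).restrictScalars ℝ)
    (LinearMap.trace ℂ (E x)).map_smul).smul c
  eventually_eq x := by
    filter_upwards [h x, eventually_mem_frameSet (F := F) (E := E) x] with z hz hz'
    refine congrArg toCont ?_
    rw [← hz]
    ext v
    exact congrArg (c • ·) (modelTrace_endToModel hz'.2 _).symm
  smooth x := (hs x).operator
    { toFun := fun α => c • modelTraceForm α
      map_add' := fun α β => by ext v; simp [modelTraceForm]
      map_smul' := fun r α => by ext v; simp [modelTraceForm, mul_left_comm] }

theorem dbarAt_smul_modelTraceForm (c : ℂ) {ζ : V → V [⋀^Fin n]→ₗ[ℝ] (F →L[ℂ] F)} {z : V}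
    (h : DifferentiableAt ℝ (fun z => toCont (ζ z)) z) :
    dbarAt (fun z => c • modelTraceForm (ζ z)) z = c • modelTraceForm (dbarAt ζ z) :=
  dbarAt_compAlternatingMap (c • modelTrace F) h

variable [ContMDiffVectorBundle ω F E 𝓘(ℂ, V)]

/-- The form `ah_k(E, θ, D)` in degree `2k + 1`. -/
theorem isLocalExpr_ahForm (hθ : IsHiggsField F θ) (hD : IsCompatible D) (k : ℕ) (c : ℂ) :
    IsLocalExpr (k + 1) k (fun x => c • trForm (wedge (wedgePow (curvature11 D x) k) (θ x)))
      (fun x z => c • modelTraceForm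
        (wedge (wedgePow (dbarAt (connOneForm D x) z) k) (θ.chartForm F x z))) := by
  refine isLocalExpr_trForm (α := fun x => wedge (wedgePow (curvature11 D x) k) (θ x))
    (fun x => (isOfType_wedgePow (isOfType_curvature11 hD x) k).wedge (hθ.type_one_zero x))
    (fun x => ?_) (fun x => ?_) c
  · filter_upwards [chartForm_curvature11 hD x, eventually_mem_frameSet (F := F) (E := E) x]
      with z hz hz'
    rw [EndForm.chartForm_wedge _ _ hz', EndForm.chartForm_wedgePow _ _ hz', hz]
  · exact ((formContDiffAt_dbarAt_connOneForm hD x).wedgePow k).wedge (hθ.smooth x)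

/-- Locally the form is a multiple of `tr ((∂̄A)^k ∧ θ)`. Here `∂̄` commutes with the trace and
annihilates both `∂̄A` and `θ`. -/
theorem ahForm_mem_closedForms (hθ : IsHiggsField F θ) (hD : IsCompatible D) (k : ℕ) :
    ahForm D θ k ∈ closedForms V X (k + 1) k := by
  refine (isLocalExpr_ahForm hθ hD k _).mem_closedForms (by omega) fun x => ?_
  have h1 := FormContDiffAt.of_le (s := 1) (formContDiffAt_dbarAt_connOneForm hD x) (by simp)
  have h2 : FormContDiffAt 1 (θ.chartForm F x) (extChartAt 𝓘(ℝ, V) x x) :=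
    FormContDiffAt.of_le (r := ∞) (hθ.smooth x) (by simp)
  rw [dbarAt_smul_modelTraceForm _ (((h1.wedgePow k).wedge h2).differentiableAt (by simp)),
    dbarAt_wedgePow_wedge h1 (dbarAt_dbarAt_connOneForm hD x) h2
      (dbarAt_chartForm_higgsField hθ x)]
  ext v
  simp [modelTraceForm]

/-- The difference of two connections as a 1-form with values in `End E`. -/
def connDiff (D D' : CovariantDerivative 𝓘(ℝ, V) F E) : EndForm V E 1 := fun x =>
  (endOfModel F x x).compAlternatingMap
    (connOneForm D' x (extChartAt 𝓘(ℝ, V) x x) - connOneForm D x (extChartAt 𝓘(ℝ, V) x x))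

theorem isOfType_connDiff (hD : IsCompatible D) (hD' : IsCompatible D') (x : X) :
    IsOfType 1 0 (connDiff D D' x) :=
  ((isOfType_oneForm_connForm hD' (center_mem_frameSet x)).sub
    (isOfType_oneForm_connForm hD (center_mem_frameSet x))).compAlternatingMap _
      (endOfModel_smul x x)

/-- Under a change of frame both connection forms acquire the same inhomogeneous term `g⁻¹ dg`. It
cancels in the difference, which is therefore tensorial. -/
theorem chartForm_connDiff (hD : IsCompatible D) (hD' : IsCompatible D') {x : X} {z : V}
    (hz : z ∈ frameSet F E x) :
    (connDiff D D').chartForm F x z = connOneForm D' x z - connOneForm D x z := by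
  set p := (extChartAt 𝓘(ℝ, V) x).symm z with hp
  have hpc : p ∈ (chartAt V p).source := mem_chart_source V p
  have hpb : p ∈ (trivializationAt F E p).baseSet := mem_baseSet_trivializationAt F E p
  ext1 v
  have e : (connOneForm D' x z - connOneForm D x z) v = connForm D' x z (v 0) - connForm D x z (v 0) :=
    rfl
  rw [e, connForm_transition hD hz hpc hpb, connForm_transition hD' hz hpc hpb, ← mul_sub,
    add_sub_add_left_eq_sub, ← sub_mul, ← mul_assoc, ← hp]
  refine (endToModel_endOfModel x p p _).trans ?_
  rw [← chartSymmDeriv_eq_fderiv hz.1]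
  rfl

/-- The form `∑ i, R'^i ∧ (D' - D) ∧ R^(j - i)`, where `R` and `R'` are the `(1, 1)`-parts of the
curvatures. -/
def connTelescope (D D' : CovariantDerivative 𝓘(ℝ, V) F E) (j : ℕ) : EndForm V E (2 * j + 1) :=
  fun x => telescope (curvature11 D' x) (curvature11 D x) (connDiff D D' x) j

theorem isOfType_connTelescope (hD : IsCompatible D) (hD' : IsCompatible D') (j : ℕ) (x : X) :
    IsOfType (j + 1) j (connTelescope D D' j x) :=
  isOfType_telescope (isOfType_curvature11 hD' x) (isOfType_curvature11 hD x)
    (isOfType_connDiff hD hD' x) j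

/-- The local expression of `connTelescope`. -/
def localTelescope (D D' : CovariantDerivative 𝓘(ℝ, V) F E) (j : ℕ) (x : X) (z : V) :
    V [⋀^Fin (2 * j + 1)]→ₗ[ℝ] (F →L[ℂ] F) :=
  telescope (dbarAt (connOneForm D' x) z) (dbarAt (connOneForm D x) z)
    (connOneForm D' x z - connOneForm D x z) j

theorem chartForm_telescope (α β : EndForm V E 2) (γ : EndForm V E 1) (j : ℕ) {x : X} {z : V}
    (hz : z ∈ frameSet F E x) :
    EndForm.chartForm F (fun p => telescope (α p) (β p) (γ p) j) x z =
      telescope (α.chartForm F x z) (β.chartForm F x z) (γ.chartForm F x z) j := by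
  induction j with
  | zero => rfl
  | succ j ih =>
    rw [telescope, ← ih, ← EndForm.chartForm_wedgePow _ _ hz, ← EndForm.chartForm_wedge _ _ hz,
      ← EndForm.chartForm_wedge _ _ hz]
    ext1 v
    exact map_add (endToModel F x _) _ _

theorem eventually_chartForm_connTelescope (hD : IsCompatible D) (hD' : IsCompatible D') (j : ℕ)
    (x : X) : ∀ᶠ z in 𝓝 (extChartAt 𝓘(ℝ, V) x x),
      (connTelescope D D' j).chartForm F x z = localTelescope D D' j x z := by
  filter_upwards [chartForm_curvature11 hD x, chartForm_curvature11 hD' x,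
    eventually_mem_frameSet (F := F) (E := E) x] with z h h' hz
  refine (chartForm_telescope _ _ _ j hz).trans ?_
  rw [h, h', chartForm_connDiff hD hD' hz, localTelescope]

theorem formContDiffAt_localTelescope (hD : IsCompatible D) (hD' : IsCompatible D') (j : ℕ)
    (x : X) : FormContDiffAt ∞ (localTelescope D D' j x) (extChartAt 𝓘(ℝ, V) x x) :=
  FormContDiffAt.telescope (formContDiffAt_dbarAt_connOneForm hD' x)
    (formContDiffAt_dbarAt_connOneForm hD x)
    ((formContDiffAt_connOneForm hD' x).sub (formContDiffAt_connOneForm hD x)) j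

theorem isLocalExpr_connTelescope (hθ : IsHiggsField F θ) (hD : IsCompatible D)
    (hD' : IsCompatible D') (j : ℕ) (c : ℂ) :
    IsLocalExpr (j + 1 + 1) j (fun x => c • trForm (wedge (connTelescope D D' j x) (θ x)))
      (fun x z => c • modelTraceForm (wedge (localTelescope D D' j x z) (θ.chartForm F x z))) := by
  refine isLocalExpr_trForm (α := fun x => wedge (connTelescope D D' j x) (θ x))
    (fun x => ((isOfType_connTelescope hD hD' j x).wedge (hθ.type_one_zero x) :
      IsOfType (j + 1 + 1) (j + 0) _)) (fun x => ?_) (fun x => ?_) c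
  · filter_upwards [eventually_chartForm_connTelescope hD hD' j x,
      eventually_mem_frameSet (F := F) (E := E) x] with z hz hz'
    rw [EndForm.chartForm_wedge _ _ hz', hz]
  · exact (formContDiffAt_localTelescope hD hD' j x).wedge (hθ.smooth x)

theorem dbarAt_localTelescope_wedge (hθ : IsHiggsField F θ) (hD : IsCompatible D)
    (hD' : IsCompatible D') (j : ℕ) (c : ℂ) (x : X) :
    dbarAt (fun z => c • modelTraceForm (wedge (localTelescope D D' j x z) (θ.chartForm F x z)))
      (extChartAt 𝓘(ℝ, V) x x) =
    c • modelTraceForm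
        (wedge (wedgePow (dbarAt (connOneForm D' x) (extChartAt 𝓘(ℝ, V) x x)) (j + 1))
          (θ.chartForm F x (extChartAt 𝓘(ℝ, V) x x))) -
      c • modelTraceForm
        (wedge (wedgePow (dbarAt (connOneForm D x) (extChartAt 𝓘(ℝ, V) x x)) (j + 1))
          (θ.chartForm F x (extChartAt 𝓘(ℝ, V) x x))) := by
  have h1 := FormContDiffAt.of_le (s := 1) (formContDiffAt_dbarAt_connOneForm hD x) (by simp)
  have h1' := FormContDiffAt.of_le (s := 1) (formContDiffAt_dbarAt_connOneForm hD' x) (by simp)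
  have h2 : FormContDiffAt 1 (θ.chartForm F x) (extChartAt 𝓘(ℝ, V) x x) :=
    FormContDiffAt.of_le (r := ∞) (hθ.smooth x) (by simp)
  have h3 := FormContDiffAt.of_le (s := 1) (formContDiffAt_connOneForm hD x) (by simp)
  have h3' := FormContDiffAt.of_le (s := 1) (formContDiffAt_connOneForm hD' x) (by simp)
  have h4 := FormContDiffAt.of_le (s := 1) (formContDiffAt_localTelescope hD hD' j x) (by simp)
  have key : dbarAt (fun z => wedge (localTelescope D D' j x z) (θ.chartForm F x z))
      (extChartAt 𝓘(ℝ, V) x x) =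
      wedge (wedgePow (dbarAt (connOneForm D' x) (extChartAt 𝓘(ℝ, V) x x)) (j + 1) -
        wedgePow (dbarAt (connOneForm D x) (extChartAt 𝓘(ℝ, V) x x)) (j + 1))
        (θ.chartForm F x (extChartAt 𝓘(ℝ, V) x x)) := by
    refine genFun_ext fun v => ?_
    -- With `β = A' - A` one has `∂̄β = ∂̄A' - ∂̄A`, so the sum telescopes; the other Leibniz term
    -- vanishes because `∂̄θ = 0`.
    have h5 := dbarAt_telescope h1' h1 (h3'.sub h3) (dbarAt_dbarAt_connOneForm hD' x)
      (dbarAt_dbarAt_connOneForm hD x) (dbarAt_sub h3' h3) j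
    rw [genFun_dbarAt_wedge (h4.differentiableAt (by simp)) (h2.differentiableAt (by simp)),
      dbarAt_chartForm_higgsField hθ x, genFun_zero, mul_zero, smul_zero, add_zero]
    refine (congrArg (fun η => genFun v η * _) h5).trans ?_
    exact (genFun_wedge v _ _).symm
  rw [dbarAt_smul_modelTraceForm c ((h4.wedge h2).differentiableAt (by simp)), key,
    wedge_sub_left, ← smul_sub]
  ext1 v
  simp [modelTraceForm]

/-- For `k = j + 1` a primitive is the trace of the telescoping sum wedged with `θ`. For `k = 0`
there is no space of primitives, but the curvature does not enter and the two forms coincide. -/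
theorem ahForm_sub_mem_exactForms (hθ : IsHiggsField F θ) (hD : IsCompatible D)
    (hD' : IsCompatible D') (k : ℕ) :
    ahForm D' θ k - ahForm D θ k ∈ exactForms V X (k + 1) k := by
  have hsub := sub_mem (ahForm_mem_closedForms hθ hD' k).1 (ahForm_mem_closedForms hθ hD k).1
  cases k with
  | zero =>
    have : ahForm D' θ 0 = ahForm D θ 0 := by
      funext x
      have h : wedgePow (curvature11 D' x) 0 = wedgePow (curvature11 D x) 0 := by
        rw [wedgePow, wedgePow]
      rw [ahForm, ahForm, h]
    rw [this, sub_self]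
    exact zero_mem _
  | succ j =>
    set c : ℂ := ((j + 1).factorial : ℂ)⁻¹ * (Complex.I / (2 * Real.pi)) ^ (j + 1) with hc
    refine (isLocalExpr_connTelescope hθ hD hD' j c).mem_exactForms (by omega) hsub (by omega)
      fun x => ?_
    rw [dbarAt_localTelescope_wedge hθ hD hD' j c x]
    have e (D : CovariantDerivative 𝓘(ℝ, V) F E) (hD : IsCompatible D) :
        ahForm D θ (j + 1) x = (c • modelTraceForm
        (wedge (wedgePow (dbarAt (connOneForm D x) (extChartAt 𝓘(ℝ, V) x x)) (j + 1))
          (θ.chartForm F x (extChartAt 𝓘(ℝ, V) x x)))).domDomCongr (finCongr (by omega)) := by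
      rw [← (isLocalExpr_ahForm hθ hD (j + 1) c).eq_center x]
      rfl
    rw [Pi.sub_apply, e D hD, e D' hD']
    rfl

theorem isHiggsClass_ahForm (hθ : IsHiggsField F θ) (hD : IsCompatible D) (k : ℕ) :
    IsHiggsClass (F := F) θ k (dolbeaultClass _ (ahForm_mem_closedForms hθ hD k)) := by
  intro D' hD'
  refine ⟨ahForm_mem_closedForms hθ hD' k, ?_⟩
  rw [dolbeaultClass, dolbeaultClass, Submodule.Quotient.eq]
  exact ahForm_sub_mem_exactForms hθ hD' hD k

end HiggsClass

/-! ### Forms with a factor `dt` and the trace of a power. -/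

section TimeWedge

open scoped TensorProduct

variable {T W A : Type*} [AddCommGroup T] [Module ℝ T] [AddCommGroup W] [Module ℝ W]
  [Ring A] [Algebra ℝ A] {m n N : ℕ}

/-- The form `dt ∧ β` on `T × ℝ`. -/
def timeWedge (β : (T × ℝ) [⋀^Fin n]→ₗ[ℝ] W) : (T × ℝ) [⋀^Fin (n + 1)]→ₗ[ℝ] W :=
  AlternatingMap.alternatizeUncurryFin ((LinearMap.snd ℝ T ℝ).smulRight β)

/-- The contraction of a form on `T × ℝ` with `∂/∂t`, restricted to `T`. -/
def timeContract (η : (T × ℝ) [⋀^Fin (n + 1)]→ₗ[ℝ] W) : T [⋀^Fin n]→ₗ[ℝ] W :=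
  (η.curryLeft (0, 1)).compLinearMap (LinearMap.inl ℝ T ℝ)

theorem timeContract_apply (η : (T × ℝ) [⋀^Fin (n + 1)]→ₗ[ℝ] W) (v : Fin n → T) :
    timeContract η v = η (Fin.cons (0, 1) fun i => (v i, 0)) := rfl

theorem timeContract_timeWedge (β : T [⋀^Fin n]→ₗ[ℝ] W) :
    timeContract (timeWedge (β.compLinearMap (LinearMap.fst ℝ T ℝ))) = β := by
  ext v
  rw [timeContract_apply, timeWedge, AlternatingMap.alternatizeUncurryFin_apply, Fin.sum_univ_succ]
  simp

theorem timeContract_compLinearMap_fst (β : T [⋀^Fin (n + 1)]→ₗ[ℝ] W) :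
    timeContract (β.compLinearMap (LinearMap.fst ℝ T ℝ)) = 0 := by
  ext v
  rw [timeContract_apply]
  exact β.map_coord_zero 0 rfl

/-- In generating functions `dt` becomes the single odd element `∑ dt(v_j) ε_j`, whose square is
zero. -/
theorem genFun_timeWedge (v : Fin N → T × ℝ) (β : (T × ℝ) [⋀^Fin n]→ₗ[ℝ] A) :
    genFun v (timeWedge β) =
      (1 : A) ⊗ₜ[ℝ] ExteriorAlgebra.ι ℝ (∑ j, (v j).2 • gen j) * genFun v β := by
  rw [timeWedge, genFun_alternatizeUncurryFin, map_sum, TensorProduct.tmul_sum, Finset.sum_mul]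
  refine Finset.sum_congr rfl fun j _ => ?_
  rw [LinearMap.smulRight_apply, genFun_smul, map_smul, TensorProduct.tmul_smul, smul_mul_assoc,
    mul_smul_comm]
  rfl

/-- A perturbation of square zero inside the trace of a power. -/
theorem trace_add_pow {R M : Type*} [Ring R] [AddCommGroup M] (τ : R →+ M) (c e : R)
    (h : ∀ i : ℕ, e * c ^ i * e = 0) (hτ : ∀ i j : ℕ, τ (c ^ i * e * c ^ j) = τ (c ^ (i + j) * e))
    (k : ℕ) : τ ((c + e) ^ (k + 1)) = τ (c ^ (k + 1)) + (k + 1) • τ (c ^ k * e) := by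
  -- Here `s` is the part of `(c + e)^(n+1)` that is linear in `e`; there is no part of higher
  -- order. The trailing power `c ^ j` is carried along because the next `s` contains `s * c`.
  have key : ∀ n : ℕ, ∃ s, (c + e) ^ (n + 1) = c ^ (n + 1) + s ∧ (∀ j : ℕ, s * c ^ j * e = 0) ∧
      ∀ j : ℕ, τ (s * c ^ j) = (n + 1) • τ (c ^ (n + j) * e) := by
    intro n
    induction n with
    | zero =>
      refine ⟨e, by simp, h, fun j => ?_⟩
      simpa using hτ 0 j
    | succ n ih =>
      obtain ⟨s, h1, h2, h3⟩ := ih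
      have h2' : s * e = 0 := by simpa using h2 0
      refine ⟨s * c + c ^ (n + 1) * e, ?_, fun j => ?_, fun j => ?_⟩
      · rw [pow_succ, h1, mul_add, add_mul, add_mul, h2', pow_succ c (n + 1)]
        abel
      · rw [add_mul, add_mul, mul_assoc s, ← pow_succ', h2, zero_add, mul_assoc (c ^ (n + 1)),
          mul_assoc (c ^ (n + 1)), h, mul_zero]
      · rw [add_mul, map_add, mul_assoc s, ← pow_succ', h3, hτ, add_smul (n + 1) 1, one_smul,
          show n + (j + 1) = n + 1 + j by omega]
  obtain ⟨s, h1, -, h3⟩ := key k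
  have h4 := h3 0
  simp only [pow_zero, mul_one, add_zero] at h4
  rw [h1, map_add, h4]

/-- The trace of a power of `α + dt ∧ β`. -/
theorem trace_wedgePow_add_timeWedge {f : A →ₗ[ℝ] W} (hf : ∀ a b, f (a * b) = f (b * a))
    (α : (T × ℝ) [⋀^Fin 2]→ₗ[ℝ] A) (β : (T × ℝ) [⋀^Fin 1]→ₗ[ℝ] A) (k : ℕ) :
    f.compAlternatingMap (wedgePow (α + timeWedge β) (k + 1)) =
      f.compAlternatingMap (wedgePow α (k + 1)) +
        ((k + 1 : ℕ) : ℝ) • f.compAlternatingMap (timeWedge (wedge (wedgePow α k) β)) := by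
  refine genFun_ext fun v => ?_
  set E : A ⊗[ℝ] ExteriorAlgebra ℝ (Fin (2 * (k + 1)) → ℝ) :=
    (1 : A) ⊗ₜ[ℝ] ExteriorAlgebra.ι ℝ (∑ j, (v j).2 • gen j) with hE
  have hc (j : ℕ) : genFun v (wedgePow α j) * E = E * genFun v (wedgePow α j) := by
    rw [hE, genFun_mul_iota, (even_two_mul j).neg_one_pow, one_smul]
  have hβ : genFun v β * E = -(E * genFun v β) := by
    rw [hE, genFun_mul_iota]
    simp
  have hEE : E * E = 0 := by
    rw [hE, Algebra.TensorProduct.tmul_mul_tmul, ExteriorAlgebra.ι_sq_zero, TensorProduct.tmul_zero]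
  have he : genFun v (timeWedge β) = E * genFun v β := genFun_timeWedge v β
  -- The second `E` passes the even factor `α^i` freely and `β` with a sign, until it meets the
  -- first one, and `E² = 0`.
  have h (i : ℕ) : E * genFun v β * genFun v α ^ i * (E * genFun v β) = 0 := by
    rw [← genFun_wedgePow, ← mul_assoc, mul_assoc (E * genFun v β), hc, ← mul_assoc, mul_assoc E, hβ,
      mul_neg, ← mul_assoc, hEE]
    simp
  -- Cyclicity brings the even factor `α^j` round to the front without a sign.
  have hτ (i j : ℕ) : f.rTensor _ (genFun v α ^ i * (E * genFun v β) * genFun v α ^ j) =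
      f.rTensor (ExteriorAlgebra ℝ (Fin (2 * (k + 1)) → ℝ))
        (genFun v α ^ (i + j) * (E * genFun v β)) := by
    have := rTensor_genFun_mul_comm v hf (wedgePow α j) (even_two_mul j)
      (wedge (wedgePow α i) (timeWedge β))
    rw [genFun_wedge, genFun_wedgePow, genFun_wedgePow, he] at this
    rw [← this, ← mul_assoc, ← pow_add, add_comm j i]
  have key := trace_add_pow
    (f.rTensor (ExteriorAlgebra ℝ (Fin (2 * (k + 1)) → ℝ))).toAddMonoidHom
    (genFun v α) (E * genFun v β) h hτ k
  rw [genFun_add, genFun_smul, genFun_compAlternatingMap, genFun_compAlternatingMap,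
    genFun_compAlternatingMap, genFun_wedgePow, genFun_wedgePow, genFun_add, he]
  have e2 : genFun v (timeWedge (wedge (wedgePow α k) β)) = genFun v α ^ k * (E * genFun v β) := by
    rw [genFun_timeWedge, genFun_wedge, ← hE, ← mul_assoc, ← hc, mul_assoc, genFun_wedgePow]
  refine key.trans ?_
  rw [Nat.cast_smul_eq_nsmul]
  exact congrArg (fun t => _ + (k + 1) • f.rTensor _ t) e2.symm

/-- The contraction kills the term without `dt` and strips `dt` off the other. The factor `k + 1`
counts the positions of `dt ∧ β` in the product, all equal under the trace. -/
theorem timeContract_trace_wedgePow {f : A →ₗ[ℝ] W} (hf : ∀ a b, f (a * b) = f (b * a))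
    (α : T [⋀^Fin 2]→ₗ[ℝ] A) (β : T [⋀^Fin 1]→ₗ[ℝ] A) (k : ℕ) :
    timeContract (n := 2 * k + 1) (f.compAlternatingMap (wedgePow
      (α.compLinearMap (LinearMap.fst ℝ T ℝ) +
        timeWedge (β.compLinearMap (LinearMap.fst ℝ T ℝ))) (k + 1))) =
      ((k + 1 : ℕ) : ℝ) • f.compAlternatingMap (wedge (wedgePow α k) β) := by
  rw [trace_wedgePow_add_timeWedge hf, wedgePow_compLinearMap, wedgePow_compLinearMap,
    wedge_compLinearMap]
  have h1 := timeContract_compLinearMap_fst (n := 2 * k + 1)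
    (f.compAlternatingMap (wedgePow α (k + 1)))
  have h2 := timeContract_timeWedge (wedge (wedgePow α k) β)
  ext v
  have h1v := congrArg (fun η => η v) h1
  have h2v := congrArg (fun η => f (η v)) h2
  simp only [timeContract_apply] at h1v h2v ⊢
  rw [AlternatingMap.add_apply]
  refine (congrArg₂ (· + ·) h1v (congrArg (((k + 1 : ℕ) : ℝ) • ·) h2v)).trans ?_
  simp

end TimeWedge

/-! ### Curvature of a path of connection forms. -/

section PathCurvature

variable {H M : Type*} [NormedAddCommGroup H] [NormedSpace ℝ H] [NormedRing M] [NormedAlgebra ℝ M]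

theorem curvForm_congr {A A' : H → H →L[ℝ] M} {z : H} (h : A =ᶠ[𝓝 z] A') :
    curvForm A z = curvForm A' z := by
  have h' : (fun z => ContinuousAlternatingMap.ofSubsingleton ℝ H M (0 : Fin 1) (A z)) =ᶠ[𝓝 z]
      fun z => ContinuousAlternatingMap.ofSubsingleton ℝ H M (0 : Fin 1) (A' z) :=
    h.mono fun _ hy => congrArg _ hy
  simp only [curvForm, h'.extDeriv_eq, h.self_of_nhds]

/-- The curvature of the connection form `A + s B` on `H × ℝ`. -/
theorem curvForm_path {A B : H → H →L[ℝ] M} {z : H} (hA : DifferentiableAt ℝ A z)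
    (hB : DifferentiableAt ℝ B z) (t : ℝ) :
    curvForm (fun p : H × ℝ => (A p.1 + p.2 • B p.1) ∘L ContinuousLinearMap.fst ℝ H ℝ) (z, t) =
      (curvForm (fun y => A y + t • B y) z).compLinearMap (LinearMap.fst ℝ H ℝ) +
        timeWedge ((oneForm (B z : H →ₗ[ℝ] M)).compLinearMap (LinearMap.fst ℝ H ℝ)) := by
  have hA' : HasFDerivAt (fun p : H × ℝ => A p.1)
      ((fderiv ℝ A z) ∘L ContinuousLinearMap.fst ℝ H ℝ) (z, t) :=
    HasFDerivAt.comp (g := A) (z, t) hA.hasFDerivAt hasFDerivAt_fst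
  have hB' : HasFDerivAt (fun p : H × ℝ => B p.1)
      ((fderiv ℝ B z) ∘L ContinuousLinearMap.fst ℝ H ℝ) (z, t) :=
    HasFDerivAt.comp (g := B) (z, t) hB.hasFDerivAt hasFDerivAt_fst
  -- The product rule for `s B` gives, besides the derivatives along `H`, the value `B` in the
  -- direction `∂/∂s`. This is the only source of `dt ∧ B`, the connection form having no
  -- `dt`-component.
  have h1 := hA'.add ((hasFDerivAt_snd (𝕜 := ℝ) (p := (z, t))).smul hB')
  have hL : HasFDerivAt (fun L : H →L[ℝ] M => L ∘L ContinuousLinearMap.fst ℝ H ℝ)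
      ((ContinuousLinearMap.compL ℝ (H × ℝ) H M).flip (ContinuousLinearMap.fst ℝ H ℝ))
      (A z + t • B z) :=
    ((ContinuousLinearMap.compL ℝ (H × ℝ) H M).flip (ContinuousLinearMap.fst ℝ H ℝ)).hasFDerivAt
  have h2 : HasFDerivAt
      (fun p : H × ℝ => (A p.1 + p.2 • B p.1) ∘L ContinuousLinearMap.fst ℝ H ℝ) _ (z, t) :=
    HasFDerivAt.comp (g := fun L : H →L[ℝ] M => L ∘L ContinuousLinearMap.fst ℝ H ℝ)
      (f := fun p : H × ℝ => A p.1 + p.2 • B p.1) (z, t) hL h1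
  have h3 : HasFDerivAt (fun y => A y + t • B y) (fderiv ℝ A z + t • fderiv ℝ B z) z :=
    hA.hasFDerivAt.add (hB.hasFDerivAt.const_smul t)
  have h3' : fderiv ℝ (fun y => A y + t • B y) z = fderiv ℝ A z + t • fderiv ℝ B z := h3.fderiv
  ext v
  rw [curvForm_apply h2.differentiableAt, h2.fderiv, AlternatingMap.add_apply,
    AlternatingMap.compLinearMap_apply, curvForm_apply h3.differentiableAt, h3', timeWedge,
    AlternatingMap.alternatizeUncurryFin_apply, Fin.sum_univ_two]
  simp [oneForm, Fin.removeNth]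
  rw [show Fin.tail v 0 = v 1 from rfl]
  noncomm_ring

end PathCurvature

/-! ### The connection form of the path on `X × ℝ`. -/

section PathConnection

variable {V : Type*} [NormedAddCommGroup V] [NormedSpace ℂ V] [FiniteDimensional ℂ V]
  {X : Type*} [TopologicalSpace X] [ChartedSpace V X] [IsManifold 𝓘(ℂ, V) ω X]
  {F : Type*} [NormedAddCommGroup F] [NormedSpace ℂ F] [FiniteDimensional ℂ F]
  {E : X → Type*} [TopologicalSpace (TotalSpace F E)]
  [∀ x, AddCommGroup (E x)] [∀ x, Module ℂ (E x)] [∀ x, TopologicalSpace (E x)]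
  [∀ x, IsTopologicalAddGroup (E x)] [∀ x, ContinuousSMul ℂ (E x)]
  [FiberBundle F E] [VectorBundle ℂ F E] [ContMDiffVectorBundle ω F E 𝓘(ℂ, V)]
  {D : CovariantDerivative 𝓘(ℝ, V) F E} {θ : EndForm V E 1}

/-- The expression of a 1-form with values in `End E` in the preferred chart and trivialization
at `x`. -/
def higgsForm (F : Type*) [NormedAddCommGroup F] [NormedSpace ℂ F] [FiniteDimensional ℂ F]
    [TopologicalSpace (TotalSpace F E)] [FiberBundle F E] [VectorBundle ℂ F E]
    (θ : EndForm V E 1) (x : X) (z : V) : V →L[ℝ] (F →L[ℂ] F) :=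
  (ContinuousAlternatingMap.ofSubsingleton ℝ V (F →L[ℂ] F) (0 : Fin 1)).symm (θ.inChart F x z)

theorem oneForm_higgsForm (θ : EndForm V E 1) (x : X) (z : V) :
    oneForm (higgsForm F θ x z : V →ₗ[ℝ] F →L[ℂ] F) = θ.chartForm F x z := by
  ext1 v
  refine congrArg (θ.chartForm F x z) ?_
  funext i
  rw [Subsingleton.elim i 0]

theorem contDiffAt_ofSubsingleton_symm {W : Type*} [NormedAddCommGroup W] [NormedSpace ℝ W]
    {r : WithTop ℕ∞} {ζ : V → V [⋀^Fin 1]→L[ℝ] W} {c : V} (h : ContDiffAt ℝ r ζ c) :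
    ContDiffAt ℝ r
      (fun z => (ContinuousAlternatingMap.ofSubsingleton ℝ V W (0 : Fin 1)).symm (ζ z)) c := by
  let Φ := (ContinuousAlternatingMap.ofSubsingletonLIE (𝕜 := ℝ) (E := V) (F := W)
    (0 : Fin 1)).symm.toContinuousLinearEquiv
  exact Φ.contDiff.contDiffAt.comp _ h

theorem contDiffAt_higgsForm (hθ : IsHiggsField F θ) (x : X) :
    ContDiffAt ℝ ∞ (higgsForm F θ x) (extChartAt 𝓘(ℝ, V) x x) := by
  exact contDiffAt_ofSubsingleton_symm (hθ.smooth x)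

/-- Charts of `X × ℝ` are products, so projecting to `X` after the inverse chart is the inverse
chart of `X` after projecting to `V`. The two compositions are differentiated. -/
theorem mfderiv_extChartAt_prod_symm_fst (x : X) (t : ℝ) {z : V} (s : ℝ)
    (hz : z ∈ (extChartAt 𝓘(ℝ, V) x).target) (w : V × ℝ) :
    (show V × ℝ from mfderiv 𝓘(ℝ, V × ℝ) (𝓘(ℝ, V).prod 𝓘(ℝ, ℝ))
      (extChartAt (𝓘(ℝ, V).prod 𝓘(ℝ, ℝ)) ((x, t) : X × ℝ)).symm (z, s) w).1 =
      chartSymmDeriv x z w.1 := by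
  have ht : (z, s) ∈ (extChartAt (𝓘(ℝ, V).prod 𝓘(ℝ, ℝ)) ((x, t) : X × ℝ)).target := by
    rw [extChartAt_prod]
    exact ⟨hz, by simp [chartAt_self_eq]⟩
  have h1 : MDifferentiableAt 𝓘(ℝ, V × ℝ) (𝓘(ℝ, V).prod 𝓘(ℝ, ℝ))
      (extChartAt (𝓘(ℝ, V).prod 𝓘(ℝ, ℝ)) ((x, t) : X × ℝ)).symm (z, s) :=
    (mdifferentiableOn_extChartAt_symm.mdifferentiableAt
      ((isOpen_extChartAt_target (I := 𝓘(ℝ, V).prod 𝓘(ℝ, ℝ)) ((x, t) : X × ℝ)).mem_nhds ht))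
  have h2 : MDifferentiableAt 𝓘(ℝ, V) 𝓘(ℝ, V) (extChartAt 𝓘(ℝ, V) x).symm z :=
    (contMDiffAt_real_extChartAt_symm_of_mem hz).mdifferentiableAt (by simp)
  have h3 := hasMFDerivAt_fst (I := 𝓘(ℝ, V)) (I' := 𝓘(ℝ, ℝ))
    ((extChartAt (𝓘(ℝ, V).prod 𝓘(ℝ, ℝ)) ((x, t) : X × ℝ)).symm (z, s))
  have h4 := (h3.comp (z, s) h1.hasMFDerivAt).mfderiv
  have h5 : HasMFDerivAt 𝓘(ℝ, V × ℝ) 𝓘(ℝ, V) (Prod.fst : V × ℝ → V) (z, s)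
      (ContinuousLinearMap.fst ℝ V ℝ) := hasFDerivAt_fst.hasMFDerivAt
  have h6 := (HasMFDerivAt.comp (g := (extChartAt 𝓘(ℝ, V) x).symm) (z, s)
    h2.hasMFDerivAt h5).mfderiv
  exact congrArg (fun L : V × ℝ →L[ℝ] V => L w) (h4.symm.trans h6)

/-- Frame sections pulled back from `X` do not depend on time, so the term `dt ⊗ ∂/∂t` contributes
nothing and no `dt`-component appears. -/
theorem connectionForm_pathConnection (D : CovariantDerivative 𝓘(ℝ, V) F E) (θ : EndForm V E 1)
    (x : X) (t : ℝ) {z : V} (s : ℝ) (hz : z ∈ frameSet F E x) :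
    connectionForm F (𝓘(ℝ, V).prod 𝓘(ℝ, ℝ)) Prod.fst (pathConnection D (addEndForm D θ)) (x, t)
      (z, s) = (connForm D x z + s • higgsForm F θ x z) ∘L ContinuousLinearMap.fst ℝ V ℝ := by
  set b := Module.finBasis ℂ F with hb
  set p := (extChartAt 𝓘(ℝ, V) x).symm z with hp
  refine ContinuousLinearMap.ext fun w => ContinuousLinearMap.ext fun f => ?_
  have e1 : connectionForm F (𝓘(ℝ, V).prod 𝓘(ℝ, ℝ)) Prod.fst
      (pathConnection D (addEndForm D θ)) (x, t) (z, s) w f =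
      ∑ j, b.coord j f • fibreCoord F x p (pathConnection D (addEndForm D θ)
        (fun y => fibreCoordSymm F x y.1 (b j)) (p, s)
          (mfderiv 𝓘(ℝ, V × ℝ) (𝓘(ℝ, V).prod 𝓘(ℝ, ℝ))
      (extChartAt (𝓘(ℝ, V).prod 𝓘(ℝ, ℝ)) ((x, t) : X × ℝ)).symm (z, s) w)) := by
    simp [connectionForm]
    rfl
  have e2 : connForm D x z w.1 f = ∑ j, b.coord j f • fibreCoord F x p
      (D (fun y => fibreCoordSymm F x y (b j)) p (chartSymmDeriv x z w.1)) := by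
    simp [connForm, connectionForm]
    rfl
  have e3 : higgsForm F θ x z w.1 f = ∑ j, b.coord j f • fibreCoord F x p
      (θ p (fun _ => chartSymmDeriv x z w.1) (fibreCoordSymm F x p (b j))) := by
    have : higgsForm F θ x z w.1 f = fibreCoord F x p
      (θ p (fun _ => chartSymmDeriv x z w.1) (fibreCoordSymm F x p f)) := rfl
    rw [this]
    conv_lhs => rw [← b.sum_repr f]
    simp only [map_sum, map_smul, Module.Basis.coord_apply]
  have e4 (j) (u : V × ℝ) : pathConnection D (addEndForm D θ)
        (fun y => fibreCoordSymm F x y.1 (b j)) (p, s) u =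
      D (fun y => fibreCoordSymm F x y (b j)) p u.1 +
        (s : ℂ) • θ p (fun _ => u.1) (fibreCoordSymm F x p (b j)) := by
    have hd : deriv (fun _ : ℝ => fibreCoordSymm (E := E) F x p (b j)) s = 0 := by
      rw [deriv, fderiv_const_apply]
      rfl
    have h0 : pathConnection D (addEndForm D θ) (fun y => fibreCoordSymm F x y.1 (b j)) (p, s) u =
      D (fun y => fibreCoordSymm F x y (b j)) p u.1 +
        s • ((D (fun y => fibreCoordSymm F x y (b j)) p u.1 +
          θ p (fun _ => u.1) (fibreCoordSymm F x p (b j))) -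
            D (fun y => fibreCoordSymm F x y (b j)) p u.1) +
        u.2 • deriv (fun _ : ℝ => fibreCoordSymm (E := E) F x p (b j)) s := rfl
    rw [h0, hd, smul_zero, add_zero, add_sub_cancel_left]
    rfl
  set u : V × ℝ := mfderiv 𝓘(ℝ, V × ℝ) (𝓘(ℝ, V).prod 𝓘(ℝ, ℝ))
      (extChartAt (𝓘(ℝ, V).prod 𝓘(ℝ, ℝ)) ((x, t) : X × ℝ)).symm (z, s) w with hu
  have hu1 : u.1 = chartSymmDeriv x z w.1 := mfderiv_extChartAt_prod_symm_fst x t s hz.1 w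
  have e5 : ((connForm D x z + s • higgsForm F θ x z) ∘L ContinuousLinearMap.fst ℝ V ℝ) w f =
    connForm D x z w.1 f + (s : ℂ) • higgsForm F θ x z w.1 f := rfl
  rw [e1, e5, e2, e3, Finset.smul_sum, ← Finset.sum_add_distrib]
  refine Finset.sum_congr rfl fun j _ => ?_
  rw [smul_comm, ← smul_add, ← hu1]
  refine congrArg (b.coord j f • ·) ?_
  refine (congrArg (fibreCoord F x p) (e4 j u)).trans ?_
  exact (map_add (fibreCoord F x p) _ _).trans
    (congrArg _ (map_smul (fibreCoord F x p) (s : ℂ) _))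

end PathConnection

/-! ### Continuity in `t`, needed for the fibre integral. -/

section Continuity

variable {V W W' A : Type*} [NormedAddCommGroup V] [NormedSpace ℂ V] [FiniteDimensional ℂ V]
  [NormedAddCommGroup W] [NormedSpace ℂ W] [FiniteDimensional ℂ W]
  [NormedAddCommGroup W'] [NormedSpace ℂ W'] [FiniteDimensional ℂ W']
  [NormedRing A] [NormedAlgebra ℂ A] [FiniteDimensional ℂ A] {m n : ℕ}

theorem continuous_operator {f : ℝ → V [⋀^Fin n]→ₗ[ℝ] W} (hf : Continuous fun t => toCont (f t))
    (Φ : (V [⋀^Fin n]→ₗ[ℝ] W) →ₗ[ℝ] (V [⋀^Fin m]→ₗ[ℝ] W')) :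
    Continuous fun t => toCont (Φ (f t)) :=
  (contOperator Φ).continuous.comp hf

theorem continuous_wedge {f : ℝ → V [⋀^Fin m]→ₗ[ℝ] A}
    {g : ℝ → V [⋀^Fin n]→ₗ[ℝ] A} (hf : Continuous fun t => toCont (f t))
    (hg : Continuous fun t => toCont (g t)) : Continuous fun t => toCont (wedge (f t) (g t)) := by
  have h : ContDiff ℝ 0 (wedgeCLM V A m n) := ContinuousLinearMap.contDiff _
  have h1 : Continuous fun t => wedgeCLM V A m n (toCont (f t)) := h.continuous.comp hf
  have h2 : Continuous fun t => wedgeCLM V A m n (toCont (f t)) (toCont (g t)) :=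
    h1.clm_apply hg
  exact h2

theorem continuous_wedgePow {f : ℝ → V [⋀^Fin 2]→ₗ[ℝ] A}
    (hf : Continuous fun t => toCont (f t)) (k : ℕ) :
    Continuous fun t => toCont (wedgePow (f t) k) := by
  induction k with
  | zero =>
    change Continuous fun _ : ℝ => toCont (AlternatingMap.constOfIsEmpty ℝ V (Fin 0) (1 : A))
    exact continuous_const
  | succ k ih => exact continuous_wedge ih hf

/-- A form is determined by its values on tuples of basis vectors, and a linear left inverse of this
evaluation is continuous in finite dimension. -/
theorem continuous_toCont {f : ℝ → V [⋀^Fin n]→ₗ[ℝ] W} (hf : ∀ v, Continuous fun t => f t v) :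
    Continuous fun t => toCont (f t) := by
  let b := Module.finBasis ℝ V
  let ev : (V [⋀^Fin n]→L[ℝ] W) →ₗ[ℝ] ((Fin n → Fin (Module.finrank ℝ V)) → W) :=
    LinearMap.pi fun r => (ContinuousAlternatingMap.apply ℝ V W (b ∘ r)).toLinearMap
  have hev : LinearMap.ker ev = ⊥ := LinearMap.ker_eq_bot.2 fun α β h => by
    apply ContinuousAlternatingMap.toAlternatingMap_injective
    exact b.ext_alternating fun r _ => congrFun h r
  obtain ⟨g, hg⟩ := ev.exists_leftInverse_of_injective hev
  have h : Continuous fun t => g (ev (toCont (f t))) :=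
    g.continuous_of_finiteDimensional.comp (continuous_pi fun r => hf (b ∘ r))
  exact h.congr fun t => LinearMap.congr_fun hg (toCont (f t))

theorem continuous_curvForm {B C : V → V →L[ℝ] A} {z : V} (hB : DifferentiableAt ℝ B z)
    (hC : DifferentiableAt ℝ C z) :
    Continuous fun t : ℝ => toCont (curvForm (fun y => B y + t • C y) z) := by
  refine continuous_toCont fun v => ?_
  have h (t : ℝ) : HasFDerivAt (fun y => B y + t • C y) (fderiv ℝ B z + t • fderiv ℝ C z) z :=
    hB.hasFDerivAt.add (hC.hasFDerivAt.const_smul t)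
  simp only [fun t => curvForm_apply (h t).differentiableAt v, fun t => (h t).fderiv,
    add_apply, smul_apply]
  fun_prop

end Continuity

/-! ### The transgression form and the comparison of constants. -/

section Transgression

variable {V : Type*} [NormedAddCommGroup V] [NormedSpace ℂ V] [FiniteDimensional ℂ V]
  {X : Type*} [TopologicalSpace X] [ChartedSpace V X] [IsManifold 𝓘(ℂ, V) ω X]
  {F : Type*} [NormedAddCommGroup F] [NormedSpace ℂ F] [FiniteDimensional ℂ F]
  {E : X → Type*} [TopologicalSpace (TotalSpace F E)]
  [∀ x, AddCommGroup (E x)] [∀ x, Module ℂ (E x)] [∀ x, TopologicalSpace (E x)]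
  [∀ x, IsTopologicalAddGroup (E x)] [∀ x, ContinuousSMul ℂ (E x)]
  [FiberBundle F E] [VectorBundle ℂ F E]
  {D : CovariantDerivative 𝓘(ℝ, V) F E} {θ : EndForm V E 1} {n p q : ℕ}

theorem endOfModel_mul (x : X) (L L' : F →L[ℂ] F) :
    endOfModel F x x (L * L') = endOfModel (E := E) F x x L * endOfModel F x x L' := by
  have hb : x ∈ (trivializationAt F E x).baseSet := mem_baseSet_trivializationAt F E x
  ext e
  change fibreCoordSymm F x x (L (L' (fibreCoord F x x e))) = fibreCoordSymm F x x
    (L (fibreCoord F x x (fibreCoordSymm F x x (L' (fibreCoord F x x e)))))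
  rw [fibreCoord_fibreCoordSymm hb]

theorem endOfModel_one (x : X) : endOfModel (E := E) F x x 1 = 1 := by
  ext e
  exact fibreCoordSymm_fibreCoord (mem_baseSet_trivializationAt F E x) e

theorem trForm_wedgePow_endOfModel {T : Type*} [AddCommGroup T] [Module ℝ T] (x : X)
    (α : T [⋀^Fin 2]→ₗ[ℝ] (F →L[ℂ] F)) (k : ℕ) :
    trForm (wedgePow ((endOfModel (E := E) F x x).compAlternatingMap α) k) =
      modelTraceForm (wedgePow α k) := by
  have hb : x ∈ (trivializationAt F E x).baseSet := mem_baseSet_trivializationAt F E x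
  rw [wedgePow_compAlternatingMap _ (endOfModel_mul x) (endOfModel_one x)]
  ext v
  refine (modelTrace_endToModel hb _).symm.trans ?_
  exact congrArg (modelTrace F) (endToModel_endOfModel_self hb _)

/-- The projection is linear, hence continuous, and commutes with the integral. The integrand may
vary with `t`; its `(p, q)`-part does not, and the interval has length one. -/
theorem typePart_integral_toCont {S : V [⋀^Fin n]→ₗ[ℝ] ℂ} {f : ℝ → V [⋀^Fin n]→ₗ[ℝ] ℂ}
    (hf : Continuous fun t => toCont (f t)) (h : ∀ t, typePart p q (f t) = S) :
    typePart p q (∫ t in (0 : ℝ)..1, toCont (f t)).toAlternatingMap = S := by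
  let Φ : (V [⋀^Fin n]→ₗ[ℝ] ℂ) →ₗ[ℝ] (V [⋀^Fin n]→ₗ[ℝ] ℂ) :=
    { toFun := typePart p q
      map_add' := typePart_add p q
      map_smul' := fun r α => typePart_smul p q (r : ℂ) α }
  have h1 := (contOperator Φ).intervalIntegral_comp_comm (hf.intervalIntegrable (μ := MeasureTheory.volume) 0 1)
  have h2 : ∀ t, contOperator Φ (toCont (f t)) = toCont S := fun t => congrArg toCont (h t)
  simp only [h2, intervalIntegral.integral_const, sub_zero, one_smul] at h1
  exact (congrArg (·.toAlternatingMap) h1).symm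

variable [ContMDiffVectorBundle ω F E 𝓘(ℂ, V)]

/-- The curvature at time `t` of the path `D + t θ`, in the preferred chart and trivialization. -/
def pathCurv (D : CovariantDerivative 𝓘(ℝ, V) F E) (θ : EndForm V E 1) (x : X) (t : ℝ) :
    V [⋀^Fin 2]→ₗ[ℝ] (F →L[ℂ] F) :=
  curvForm (fun z => connForm D x z + t • higgsForm F θ x z) (extChartAt 𝓘(ℝ, V) x x)

/-- The formula for the connection form holds on a neighbourhood, so it determines the curvature at
`(x, t)`. The chart and frame used there are already those at `x`, and no gauge change is needed. -/
theorem curvature_pathConnection (hθ : IsHiggsField F θ) (hD : IsCompatible D) (x : X) (t : ℝ) :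
    curvature F (𝓘(ℝ, V).prod 𝓘(ℝ, ℝ)) Prod.fst (pathConnection D (addEndForm D θ)) (x, t) =
      (endOfModel F x x).compAlternatingMap
        ((pathCurv D θ x t).compLinearMap (LinearMap.fst ℝ V ℝ) +
          timeWedge ((θ.chartForm F x (extChartAt 𝓘(ℝ, V) x x)).compLinearMap
            (LinearMap.fst ℝ V ℝ))) := by
  have e : connectionForm F (𝓘(ℝ, V).prod 𝓘(ℝ, ℝ)) Prod.fst
      (pathConnection D (addEndForm D θ)) (x, t) =ᶠ[𝓝 (extChartAt 𝓘(ℝ, V) x x, t)]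
      fun p : V × ℝ => (connForm D x p.1 + p.2 • higgsForm F θ x p.1) ∘L
        ContinuousLinearMap.fst ℝ V ℝ := by
    have h : ∀ᶠ p : V × ℝ in 𝓝 (extChartAt 𝓘(ℝ, V) x x, t), p.1 ∈ frameSet F E x :=
      continuous_fst.continuousAt.eventually (eventually_mem_frameSet x)
    exact h.mono fun p hp => connectionForm_pathConnection D θ x t p.2 hp
  have h1 := (curvForm_congr e).trans (curvForm_path
    (eventually_differentiableAt_connForm hD x).self_of_nhds
    ((contDiffAt_higgsForm hθ x).differentiableAt (by simp)) t)
  rw [oneForm_higgsForm] at h1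
  exact congrArg (endOfModel F x x).compAlternatingMap h1

theorem continuous_pathCurv (hθ : IsHiggsField F θ) (hD : IsCompatible D) (x : X) :
    Continuous fun t => toCont (pathCurv D θ x t) := by
  exact continuous_curvForm
    (eventually_differentiableAt_connForm hD x).self_of_nhds
    ((contDiffAt_higgsForm hθ x).differentiableAt (by simp))

/-- The (1,1)-part of the curvature of `A + tθ` is `∂̄A + t ∂̄θ = ∂̄A`, independent of `t`; the rest
is of type (2,0) and cannot reach type `(k + 1, k)`. -/
theorem typePart_pathCurv (hθ : IsHiggsField F θ) (hD : IsCompatible D) (x : X) (t : ℝ) (k : ℕ) :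
    typePart (k + 1) k (wedge (wedgePow (pathCurv D θ x t) k)
      (θ.chartForm F x (extChartAt 𝓘(ℝ, V) x x))) =
    wedge (wedgePow (dbarAt (connOneForm D x) (extChartAt 𝓘(ℝ, V) x x)) k)
      (θ.chartForm F x (extChartAt 𝓘(ℝ, V) x x)) := by
  have hA : FormContDiffAt 1 (connOneForm D x) (extChartAt 𝓘(ℝ, V) x x) :=
    FormContDiffAt.of_le (r := ∞) (formContDiffAt_connOneForm hD x) (by simp)
  have hB : FormContDiffAt 1 (θ.chartForm F x) (extChartAt 𝓘(ℝ, V) x x) :=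
    FormContDiffAt.of_le (r := ∞) (hθ.smooth x) (by simp)
  have hB' : FormContDiffAt 1 (fun z => (t : ℂ) • θ.chartForm F x z) (extChartAt 𝓘(ℝ, V) x x) :=
    ContDiffAt.const_smul (t : ℂ) hB
  have e (z : V) : oneForm ((connForm D x z + t • higgsForm F θ x z : V →L[ℝ] F →L[ℂ] F) :
      V →ₗ[ℝ] F →L[ℂ] F) = connOneForm D x z + (t : ℂ) • θ.chartForm F x z := by
    rw [← oneForm_higgsForm]
    rfl
  have hty : ∀ᶠ z in 𝓝 (extChartAt 𝓘(ℝ, V) x x), IsOfType 1 0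
      (oneForm ((connForm D x z + t • higgsForm F θ x z : V →L[ℝ] F →L[ℂ] F) :
        V →ₗ[ℝ] F →L[ℂ] F)) := by
    filter_upwards [eventually_mem_frameSet (F := F) (E := E) x] with z hz
    rw [e]
    exact (isOfType_oneForm_connForm hD hz).add
      ((EndForm.isOfType_chartForm hθ.type_one_zero hz).smul _)
  have key := isOfType_curvForm_sub_dbarAt hty (by
    simp only [e]
    exact (hA.add hB').differentiableAt (by simp))
  simp only [e] at key
  rw [dbarAt_add (hA.differentiableAt (by simp)) (hB'.differentiableAt (by simp)),
    dbarAt_smul _ hB, dbarAt_chartForm_higgsField hθ x, smul_zero, add_zero] at key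
  exact typePart_wedgePow_wedge key.1 (key.2.mem_hodgeFil rfl le_rfl)
    (EndForm.isOfType_chartForm hθ.type_one_zero (center_mem_frameSet x)) k

/-- A multiple of the trace, as a linear operator on forms. -/
def smulModelTraceForm (c : ℂ) : (V [⋀^Fin n]→ₗ[ℝ] (F →L[ℂ] F)) →ₗ[ℝ] (V [⋀^Fin n]→ₗ[ℝ] ℂ) where
  toFun α := c • modelTraceForm α
  map_add' α β := by ext v; simp [modelTraceForm]
  map_smul' r α := by ext v; simp [modelTraceForm, mul_left_comm]

/-- In the constant, `k + 1` comes from the cyclicity of the trace, and the sign `(-1)^(2k+1)` from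
moving `dt` from the first place to the last. -/
theorem typePart_fibreIntegral (hθ : IsHiggsField F θ) (hD : IsCompatible D) (k : ℕ) (x : X) :
    typePart (k + 1) k (fibreIntegral (n := 2 * k + 1) (fun p => trForm (wedgePow
      (curvature F (𝓘(ℝ, V).prod 𝓘(ℝ, ℝ)) Prod.fst (pathConnection D (addEndForm D θ)) p)
        (k + 1))) x) =
    (-((k : ℂ) + 1)) • modelTraceForm
      (wedge (wedgePow (dbarAt (connOneForm D x) (extChartAt 𝓘(ℝ, V) x x)) k)
        (θ.chartForm F x (extChartAt 𝓘(ℝ, V) x x))) := by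
  set Θ := θ.chartForm F x (extChartAt 𝓘(ℝ, V) x x) with hΘ
  have e (t : ℝ) : (-1 : ℂ) ^ (2 * k + 1) • timeContract (n := 2 * k + 1) (trForm (wedgePow
      (curvature F (𝓘(ℝ, V).prod 𝓘(ℝ, ℝ)) Prod.fst (pathConnection D (addEndForm D θ)) (x, t))
        (k + 1))) = (-((k : ℂ) + 1)) • modelTraceForm (wedge (wedgePow (pathCurv D θ x t) k) Θ) := by
    rw [curvature_pathConnection hθ hD, trForm_wedgePow_endOfModel]
    have h := timeContract_trace_wedgePow
      (f := (modelTrace F).restrictScalars ℝ) modelTrace_mul_comm (pathCurv D θ x t) Θ k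
    refine (congrArg ((-1 : ℂ) ^ (2 * k + 1) • ·) h).trans ?_
    ext v
    simp [modelTraceForm, pow_succ, pow_mul]
    ring
  refine typePart_integral_toCont (f := fun t => (-1 : ℂ) ^ (2 * k + 1) •
    timeContract (n := 2 * k + 1) (trForm (wedgePow
      (curvature F (𝓘(ℝ, V).prod 𝓘(ℝ, ℝ)) Prod.fst (pathConnection D (addEndForm D θ)) (x, t))
        (k + 1)))) ?_ fun t => ?_
  · simp only [e]
    have h1 := continuous_wedge (continuous_wedgePow (continuous_pathCurv hθ hD x) k)
      (continuous_const (y := toCont Θ))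
    exact continuous_operator h1 (smulModelTraceForm (V := V) (F := F) (-((k : ℂ) + 1)))
  · simp only [e]
    rw [typePart_smul, modelTraceForm, typePart_compAlternatingMap _ (modelTrace F).map_smul,
      typePart_pathCurv hθ hD x t k]
    rfl

/-- The Higgs form is the transgression form of the scalar Atiyah class. -/
theorem ahForm_eq_atTransgression (hθ : IsHiggsField F θ) (hD : IsCompatible D) (k : ℕ) :
    ahForm D θ k = (2 * (Real.pi : ℂ) * Complex.I) • atTransgression D (addEndForm D θ) k := by
  funext x
  have h1 := (isLocalExpr_ahForm hθ hD k
    (((k.factorial : ℂ)⁻¹ * (Complex.I / (2 * Real.pi)) ^ k))).eq_center x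
  have h2 := typePart_fibreIntegral hθ hD k x
  have h3 : atTransgression D (addEndForm D θ) k x = ((((k + 1).factorial : ℂ)⁻¹ *
      (Complex.I / (2 * Real.pi)) ^ (k + 1)) • (-((k : ℂ) + 1)) • modelTraceForm
      (wedge (wedgePow (dbarAt (connOneForm D x) (extChartAt 𝓘(ℝ, V) x x)) k)
        (θ.chartForm F x (extChartAt 𝓘(ℝ, V) x x)))).domDomCongr (finCongr (by omega)) := by
    rw [← h2, ← typePart_smul]
    rfl
  rw [ahForm, h1, Pi.smul_apply, h3]
  -- This is `(k + 1)/(k + 1)! = 1/k!` together with `2πi · (i/2π) · (-1) = 1`.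
  have hc : (k.factorial : ℂ)⁻¹ * (Complex.I / (2 * Real.pi)) ^ k =
      2 * (Real.pi : ℂ) * Complex.I * ((((k + 1).factorial : ℂ)⁻¹ *
      (Complex.I / (2 * Real.pi)) ^ (k + 1)) * (-((k : ℂ) + 1))) := by
    have hpi : (Real.pi : ℂ) ≠ 0 := by exact_mod_cast Real.pi_ne_zero
    have hk : ((k : ℂ) + 1) ≠ 0 := by exact_mod_cast k.succ_ne_zero
    have hf : (k.factorial : ℂ) ≠ 0 := by exact_mod_cast k.factorial_ne_zero
    rw [Nat.factorial_succ, pow_succ]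
    push_cast
    field_simp
    rw [Complex.I_sq]
    ring
  rw [hc]
  ext v
  simp [mul_assoc]

end Transgression

end Higgs

end

/-! ### The theorem. -/

theorem mainTheorem3
    {V : Type*} [NormedAddCommGroup V] [NormedSpace ℂ V] [FiniteDimensional ℂ V]
    {X : Type*} [TopologicalSpace X] [ChartedSpace V X] [IsManifold 𝓘(ℂ, V) ω X]
    {F : Type*} [NormedAddCommGroup F] [NormedSpace ℂ F] [FiniteDimensional ℂ F]
    {E : X → Type*} [TopologicalSpace (TotalSpace F E)]
    [∀ x, AddCommGroup (E x)] [∀ x, Module ℂ (E x)] [∀ x, TopologicalSpace (E x)]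
    [∀ x, IsTopologicalAddGroup (E x)] [∀ x, ContinuousSMul ℂ (E x)]
    [FiberBundle F E] [VectorBundle ℂ F E] [ContMDiffVectorBundle ω F E 𝓘(ℂ, V)]
    (θ : Higgs.EndForm V E 1) (hθ : Higgs.IsHiggsField F θ)
    (D : CovariantDerivative 𝓘(ℝ, V) F E) (hD : Higgs.IsCompatible D) (k : ℕ) :
    Higgs.ahForm D θ k =
        (2 * (Real.pi : ℂ) * Complex.I) •
          Higgs.atTransgression D (Higgs.addEndForm D θ) k ∧
      ∃ h : (2 * (Real.pi : ℂ) * Complex.I) •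
          Higgs.atTransgression D (Higgs.addEndForm D θ) k ∈ Higgs.closedForms V X (k + 1) k,
        Higgs.IsHiggsClass (F := F) θ k (Higgs.dolbeaultClass _ h) := by
  have e := Higgs.ahForm_eq_atTransgression hθ hD k
  refine ⟨e, ?_⟩
  -- The identity of forms transfers closedness and the Dolbeault class from `ah_k` to the
  -- transgression form.
  rw [← e]
  exact ⟨Higgs.ahForm_mem_closedForms hθ hD k, Higgs.isHiggsClass_ahForm hθ hD k⟩
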